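/- Let $1<p<\infty$, let $\Omega\subset\mathbb{R}^n$ ($n\ge 2$) be a bounded open set with $C^1$ boundary, and let $\gamma_1,\gamma_2$ be positive continuous functions on $\overline{\Omega}$. Let $X=W^{1,p}(\Omega;\mathbb{R})/W^{1,p}_0(\Omega;\mathbb{R})$ be the space of real boundary values, with dual $X'$, where $W^{1,p}_0$ is the closure of $C_c^\infty(\Omega)$ in $W^{1,p}$. For $\gamma=\gamma_1,\gamma_2$ let $\Lambda_\gamma^{\mathbb{R}}:X\to X'$ be the nonlinear Dirichlet-to-Neumann map $$\langle \Lambda_\gamma^{\mathbb{R}}(f),g\rangle=\int_\Omega \gamma\,|\nabla u_f|^{p-2}\nabla u_f\cdot\nabla g\,dx,$$ where $u_f\in W^{1,p}(\Omega;\mathbb{R})$ is the unique weak solution of $\operatorname{div}(\gamma|\nabla u|^{p-2}\nabla u)=0$ in $\Omega$ with $u_f-f\in W^{1,p}_0(\Omega;\mathbb{R})$. If $\Lambda_{\gamma_1}^{\mathbb{R}}=\Lambda_{\gamma_2}^{\mathbb{R}}$, then $\gamma_1=\gamma_2$ on $\partial\Omega$. -/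

import Mathlib

open MeasureTheory Topology Filter
open scoped ENNReal ContDiff RealInnerProductSpace

noncomputable section

namespace PLap

/-- `ℝⁿ` with its Euclidean norm. -/
abbrev Euc (n : ℕ) : Type := EuclideanSpace ℝ (Fin n)

/-- `Ω` has `C¹` boundary: near each of its boundary points `Ω` is the positivity set of a
`C¹` function with non-vanishing differential. -/
def HasC1Boundary {n : ℕ} (Ω : Set (Euc n)) : Prop :=
  ∀ x ∈ frontier Ω, ∃ (U : Set (Euc n)) (ρ : Euc n → ℝ),
    IsOpen U ∧ x ∈ U ∧ ContDiffOn ℝ 1 ρ U ∧ (∀ y ∈ U, fderiv ℝ ρ y ≠ 0) ∧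
      Ω ∩ U = {y | y ∈ U ∧ 0 < ρ y}

/-- `φ ∈ C_c^∞(Ω)`. -/
structure IsTestFunction {n : ℕ} (Ω : Set (Euc n)) (φ : Euc n → ℝ) : Prop where
  contDiff : ContDiff ℝ ∞ φ
  hasCompactSupport : HasCompactSupport φ
  tsupport_subset : tsupport φ ⊆ Ω

/-- The vector field `G` is the weak gradient of `u` in `Ω`:
`∫_Ω u ∂ᵢφ dx = - ∫_Ω Gᵢ φ dx` for all `φ ∈ C_c^∞(Ω)` and all `i`. -/
def IsWeakGradient {n : ℕ} (Ω : Set (Euc n)) (u : Euc n → ℝ) (G : Euc n → Euc n) : Prop :=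
  ∀ φ : Euc n → ℝ, IsTestFunction Ω φ → ∀ i : Fin n,
    ∫ x in Ω, u x * fderiv ℝ φ x (EuclideanSpace.single i 1) = - ∫ x in Ω, G x i * φ x

variable {n : ℕ} (Ω : Set (Euc n)) (p : ℝ≥0∞) [Fact (1 ≤ p)]

lemma IsTestFunction.continuous_partial {Ω : Set (Euc n)} {φ : Euc n → ℝ}
    (h : IsTestFunction Ω φ) (v : Euc n) : Continuous fun x => fderiv ℝ φ x v :=
  (h.contDiff.continuous_fderiv (by simp)).clm_apply continuous_const

lemma IsTestFunction.integrable_partial {Ω : Set (Euc n)} {p : ℝ≥0∞} [Fact (1 ≤ p)]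
    {φ : Euc n → ℝ} (h : IsTestFunction Ω φ)
    (u : Lp ℝ p (volume.restrict Ω)) (v : Euc n) :
    Integrable (fun x => u x * fderiv ℝ φ x v) (volume.restrict Ω) := by
  have hu := (Lp.memLp u).locallyIntegrable (Fact.out : 1 ≤ p)
  exact hu.integrable_smul_right_of_hasCompactSupport (h.continuous_partial v)
    (h.hasCompactSupport.fderiv_apply ℝ v)

lemma IsTestFunction.integrable_coord {Ω : Set (Euc n)} {p : ℝ≥0∞} [Fact (1 ≤ p)]
    {φ : Euc n → ℝ} (h : IsTestFunction Ω φ)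
    (G : Lp (Euc n) p (volume.restrict Ω)) (i : Fin n) :
    Integrable (fun x => G x i * φ x) (volume.restrict Ω) := by
  have hG := (Lp.memLp G).locallyIntegrable (Fact.out : 1 ≤ p)
  have h1 := hG.integrable_smul_left_of_hasCompactSupport h.contDiff.continuous
    h.hasCompactSupport
  have h2 := (EuclideanSpace.proj i : Euc n →L[ℝ] ℝ).integrable_comp h1
  refine h2.congr (Eventually.of_forall fun x => ?_)
  simp [mul_comm]

/-- The real Sobolev space `W^{1,p}(Ω)`, as the space of all pairs `(u, ∇u)` with
`u ∈ L^p(Ω; ℝ)` whose weak gradient `∇u` lies in `L^p(Ω; ℝⁿ)`. Its norm is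
`max (‖u‖_{L^p}) (‖∇u‖_{L^p})`, which is equivalent to the usual one. -/
def W1 : Submodule ℝ
    (Lp ℝ p ((volume : Measure (Euc n)).restrict Ω) ×
      Lp (Euc n) p ((volume : Measure (Euc n)).restrict Ω)) where
  carrier := {w | IsWeakGradient Ω w.1 w.2}
  zero_mem' := by
    intro φ hφ i
    rw [integral_eq_zero_of_ae, integral_eq_zero_of_ae, neg_zero]
    · filter_upwards [Lp.coeFn_zero (Euc n) p ((volume : Measure (Euc n)).restrict Ω)] with x hx
      change (((0 : Lp (Euc n) p ((volume : Measure (Euc n)).restrict Ω)) : Euc n → Euc n) x) i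
        * φ x = 0
      rw [hx]
      simp
    · filter_upwards [Lp.coeFn_zero ℝ p ((volume : Measure (Euc n)).restrict Ω)] with x hx
      change (((0 : Lp ℝ p ((volume : Measure (Euc n)).restrict Ω)) : Euc n → ℝ) x)
        * fderiv ℝ φ x (EuclideanSpace.single i 1) = 0
      rw [hx]
      simp
  add_mem' := by
    intro a b ha hb φ hφ i
    have e1 : ∫ x in Ω, (a + b).1 x * fderiv ℝ φ x (EuclideanSpace.single i 1)
        = (∫ x in Ω, a.1 x * fderiv ℝ φ x (EuclideanSpace.single i 1))
          + ∫ x in Ω, b.1 x * fderiv ℝ φ x (EuclideanSpace.single i 1) := by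
      rw [← integral_add (hφ.integrable_partial _ _) (hφ.integrable_partial _ _)]
      refine integral_congr_ae ?_
      filter_upwards [Lp.coeFn_add a.1 b.1] with x hx
      simp only [Prod.fst_add, hx, Pi.add_apply]
      ring
    have e2 : ∫ x in Ω, (a + b).2 x i * φ x
        = (∫ x in Ω, a.2 x i * φ x) + ∫ x in Ω, b.2 x i * φ x := by
      rw [← integral_add (hφ.integrable_coord _ _) (hφ.integrable_coord _ _)]
      refine integral_congr_ae ?_
      filter_upwards [Lp.coeFn_add a.2 b.2] with x hx
      simp only [Prod.snd_add, hx, Pi.add_apply, PiLp.add_apply]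
      ring
    rw [e1, e2, ha φ hφ i, hb φ hφ i]
    ring
  smul_mem' := by
    intro c a ha φ hφ i
    have e1 : ∫ x in Ω, (c • a).1 x * fderiv ℝ φ x (EuclideanSpace.single i 1)
        = c * ∫ x in Ω, a.1 x * fderiv ℝ φ x (EuclideanSpace.single i 1) := by
      rw [← integral_const_mul]
      refine integral_congr_ae ?_
      filter_upwards [Lp.coeFn_smul c a.1] with x hx
      simp only [Prod.smul_fst, hx, Pi.smul_apply, smul_eq_mul]
      ring
    have e2 : ∫ x in Ω, (c • a).2 x i * φ x = c * ∫ x in Ω, a.2 x i * φ x := by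
      rw [← integral_const_mul]
      refine integral_congr_ae ?_
      filter_upwards [Lp.coeFn_smul c a.2] with x hx
      simp only [Prod.smul_snd, hx, Pi.smul_apply, PiLp.smul_apply, smul_eq_mul]
      ring
    rw [e1, e2, ha φ hφ i]
    ring

/-- The weak gradient of a Sobolev function. -/
def grad {Ω : Set (Euc n)} {p : ℝ≥0∞} [Fact (1 ≤ p)] (u : W1 Ω p) :
    Lp (Euc n) p ((volume : Measure (Euc n)).restrict Ω) :=
  u.1.2

/-- The smooth compactly supported functions in `Ω`, as a subspace of `W^{1,p}(Ω)`. -/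
def testSubspace : Submodule ℝ (W1 Ω p) where
  carrier := {w | ∃ φ : Euc n → ℝ, IsTestFunction Ω φ ∧
    w.1.1 =ᵐ[volume.restrict Ω] φ ∧ grad w =ᵐ[volume.restrict Ω] gradient φ}
  zero_mem' := by
    refine ⟨0, ⟨contDiff_const, HasCompactSupport.zero, by simp⟩, Lp.coeFn_zero _ _ _, ?_⟩
    filter_upwards [Lp.coeFn_zero (Euc n) p ((volume : Measure (Euc n)).restrict Ω)] with x hx
    have : gradient (0 : Euc n → ℝ) x = 0 := by simp [gradient]
    rw [this]
    exact hx
  add_mem' := by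
    rintro a b ⟨φ, hφ, h1, h2⟩ ⟨ψ, hψ, k1, k2⟩
    refine ⟨φ + ψ, ⟨hφ.contDiff.add hψ.contDiff, hφ.hasCompactSupport.add hψ.hasCompactSupport,
      (tsupport_add φ ψ).trans (Set.union_subset hφ.tsupport_subset hψ.tsupport_subset)⟩,
      ?_, ?_⟩
    · exact (Lp.coeFn_add a.1.1 b.1.1).trans (h1.add k1)
    · refine (Lp.coeFn_add (grad a) (grad b)).trans ?_
      filter_upwards [h2, k2] with x hx kx
      have d1 := (hφ.contDiff.differentiable (by simp)) x
      have d2 := (hψ.contDiff.differentiable (by simp)) x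
      simp only [Pi.add_apply, hx, kx, gradient]
      rw [fderiv_add d1 d2, map_add]
  smul_mem' := by
    rintro c a ⟨φ, hφ, h1, h2⟩
    refine ⟨c • φ, ⟨hφ.contDiff.const_smul c, hφ.hasCompactSupport.smul_left,
      (tsupport_smul_subset_right (fun _ => c) φ).trans hφ.tsupport_subset⟩, ?_, ?_⟩
    · exact (Lp.coeFn_smul c a.1.1).trans (h1.const_smul c)
    · refine (Lp.coeFn_smul c (grad a)).trans ?_
      filter_upwards [h2] with x hx
      have d1 := (hφ.contDiff.differentiable (by simp)) x
      simp only [Pi.smul_apply, hx, gradient]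
      rw [fderiv_const_smul d1, map_smul]

/-- `W^{1,p}_0(Ω)`, the closure of the smooth compactly supported functions in `W^{1,p}(Ω)`. -/
def W10 : Submodule ℝ (W1 Ω p) := (testSubspace Ω p).topologicalClosure

/-- The space `X = W^{1,p}(Ω) / W^{1,p}_0(Ω)` of real boundary values. -/
abbrev TraceSpace : Type := W1 Ω p ⧸ W10 Ω p

/-- The boundary value `u|_{∂Ω} ∈ X` of `u ∈ W^{1,p}(Ω)`. -/
def trace (u : W1 Ω p) : TraceSpace Ω p := (W10 Ω p).mkQ u

variable {Ω p}

/-- `∫_Ω γ |∇u|^{p-2} ∇u · ∇v dx`. -/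
def pairing (γ : Euc n → ℝ) (u v : W1 Ω p) : ℝ :=
  ∫ x in Ω, γ x * ‖grad u x‖ ^ (p.toReal - 2) * ⟪grad u x, grad v x⟫

/-- `u` is a weak solution of `div (γ |∇u|^{p-2} ∇u) = 0` in `Ω`. -/
def IsWeakSolution (γ : Euc n → ℝ) (u : W1 Ω p) : Prop :=
  ∀ φ ∈ W10 Ω p, pairing γ u φ = 0

/-- `ℓ ∈ X'` is the (weak) current `γ |∇u|^{p-2} ∇u · ν` on `∂Ω` of a solution `u` of the
Dirichlet problem with boundary value `f`. -/
def IsBoundaryCurrent (γ : Euc n → ℝ) (f : TraceSpace Ω p)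
    (ℓ : StrongDual ℝ (TraceSpace Ω p)) : Prop :=
  ∃ u : W1 Ω p, IsWeakSolution γ u ∧ trace Ω p u = f ∧
    ∀ g : W1 Ω p, ℓ (trace Ω p g) = pairing γ u g

variable (Ω p)

open scoped Classical in
/-- The nonlinear Dirichlet-to-Neumann map `Λ_γ : X → X'` on real boundary values,
`⟨Λ_γ f, g⟩ = ∫_Ω γ |∇u_f|^{p-2} ∇u_f · ∇g dx`, where `u_f` solves
`div (γ |∇u|^{p-2} ∇u) = 0` in `Ω` and `u_f = f` on `∂Ω`. For `1 < p < ∞`, `Ω` bounded and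
open, and `γ` continuous and positive on the closure of `Ω`, the Dirichlet problem is well posed,
so that there is exactly one such functional for each `f`; the value `0` is never used then. -/
def dnMap (γ : Euc n → ℝ) (f : TraceSpace Ω p) : StrongDual ℝ (TraceSpace Ω p) :=
  if h : ∃ ℓ, IsBoundaryCurrent γ f ℓ then h.choose else 0

end PLap

end

namespace PLap

/-! ### Pointwise inequalities -/

/-! Suppose `γ₁ x₀ > γ₂ x₀` at a boundary point, so that `γ₁ ≥ γ₂ + ε` on `Ω` near `x₀`. Write
`E_i(u) = ∫ γ_i |∇u|^p`. If `u₁`, `u₂` solve the two equations with the same boundary value `f`,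
then `E₁(u₁) = ⟨Λf, f⟩ = E₂(u₂) ≤ E₂(u₁)`, because weak solutions minimize their energy
(`exists_isWeakSolution_of_dnMap_eq`). This is absurd once `u₁` carries almost all of its energy
near `x₀`. No asymptotics of solutions are needed, only boundary data that force this concentration.

The data are those of `v(x) = V((x - x₀)/δ)`, where `V` is smooth, compactly supported and linear
with a tangential slope `τ` near the origin. Put `D = δ^n / δ^p`. Comparison with `v` bounds
`‖∇u₁‖^p` above by a multiple of `D`. A lower bound of the same order (`exists_lower_bound`) comes
from the divergence-free field `(∂ₑχ) τ - (∂_τ χ) e`, with `χ` a bump at scale `δ` and `e` the inner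
normal: the integral of `∇u₁` against it depends only on the boundary value, so it can be computed
on `v`, and its rescaled limit is a nonzero half-space integral.

Concentration (`IsElliptic.integral_cutoff_le`) follows by testing the equation with `θ (u₁ - v)`,
where `θ` is a logarithmic cutoff that vanishes near the support of `∇v`, equals one away from `x₀`,
and has `|∇θ| ≤ A / (L |x - x₀|)`. The cross term contains `|u₁ - v| / |x - x₀|`, which Hardy's
inequality at the boundary (`exists_boundary_hardy`) controls by `∇(u₁ - v)`. Hence the energy seen
by `θ` is at most a constant times `D / L`. All constants are independent of `δ`: fixing `L` large
and then `δ` small contradicts the energy comparison.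

Since `dnMap` is defined by choice, solvability of the Dirichlet problem is proved as well, by the
direct method with uniform convexity and Poincaré's inequality. -/

lemma rpow_mul_le_young {q : ℝ} (hq : 1 < q) {s X Y : ℝ} (hs : 0 < s) (hX : 0 ≤ X) (hY : 0 ≤ Y) :
    X ^ (q - 1) * Y ≤ s * X ^ q + s ^ (1 - q) * Y ^ q := by
  have e1 : ∀ Z : ℝ, 0 ≤ Z → Z ^ q = Z ^ (q - 1) * Z := fun Z hZ => by
    rw [← Real.rpow_add_one' hZ (by linarith)]; ring_nf
  -- Each case gives one of the two terms by itself. The constants are not sharp, but `s` stays free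
  -- for later absorption.
  rcases le_total Y (s * X) with h | h
  · have : X ^ (q - 1) * Y ≤ X ^ (q - 1) * (s * X) := by gcongr
    have h2 : 0 ≤ s ^ (1 - q) * Y ^ q := by positivity
    rw [e1 X hX]; linarith
  · have h1 : X ≤ Y / s := by rw [le_div_iff₀ hs]; linarith
    have h2 : X ^ (q - 1) ≤ (Y / s) ^ (q - 1) :=
      Real.rpow_le_rpow hX h1 (by linarith)
    have h3 : (Y / s) ^ (q - 1) * Y = s ^ (1 - q) * Y ^ q := by
      rw [Real.div_rpow hY hs.le, e1 Y hY, show 1 - q = -(q - 1) by ring, Real.rpow_neg hs.le]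
      ring
    have h4 : X ^ (q - 1) * Y ≤ (Y / s) ^ (q - 1) * Y := by gcongr
    have h5 : 0 ≤ s * X ^ q := by positivity
    linarith

/-- Young's inequality with sharp coefficients (equality at `X = Y`). The sharpness is what makes
weak solutions minimizers and minimizers weak solutions. -/
lemma mul_rpow_mul_le {q : ℝ} (hq : 1 < q) {X Y : ℝ} (hX : 0 ≤ X) (hY : 0 ≤ Y) :
    q * (X ^ (q - 1) * Y) ≤ (q - 1) * X ^ q + Y ^ q := by
  have hq0 : 0 < q := by linarith
  have hpq : q.HolderConjugate (q / (q - 1)) := Real.HolderConjugate.conjExponent hq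
  have := Real.young_inequality_of_nonneg hY (Real.rpow_nonneg hX (q - 1)) hpq
  rw [← Real.rpow_mul hX, mul_div_cancel₀ _ (by linarith : q - 1 ≠ 0)] at this
  have h2 : q * (Y * X ^ (q - 1)) ≤ q * (Y ^ q / q + X ^ q / (q / (q - 1))) := by gcongr
  have h3 : q * (Y ^ q / q + X ^ q / (q / (q - 1))) = (q - 1) * X ^ q + Y ^ q := by
    have : q - 1 ≠ 0 := by linarith
    field_simp
    ring
  linarith

lemma add_rpow_le_two_rpow {q : ℝ} (hq : 1 < q) {X Y : ℝ} (hX : 0 ≤ X) (hY : 0 ≤ Y) :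
    (X + Y) ^ q ≤ 2 ^ q * (X ^ q + Y ^ q) := by
  have h : X + Y ≤ 2 * max X Y := by
    have := le_max_left X Y; have := le_max_right X Y; linarith
  have h1 : (X + Y) ^ q ≤ (2 * max X Y) ^ q := Real.rpow_le_rpow (by positivity) h (by linarith)
  rw [Real.mul_rpow (by norm_num) (by positivity)] at h1
  refine h1.trans ?_
  gcongr
  rcases max_cases X Y with ⟨h, _⟩ | ⟨h, _⟩ <;> rw [h]
  · have : 0 ≤ Y ^ q := by positivity
    linarith
  · have : 0 ≤ X ^ q := by positivity
    linarith

/-! ### Convexity and continuity of powers of a Hilbert norm -/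

section NormPow

variable {E : Type*} [NormedAddCommGroup E]

lemma norm_rpow_eq_mul {q : ℝ} (hq : 1 < q) (a : E) : ‖a‖ ^ q = ‖a‖ ^ (q - 1) * ‖a‖ := by
  rw [← Real.rpow_add_one' (norm_nonneg _) (by linarith)]; ring_nf

lemma norm_rpow_sub_two_mul {q : ℝ} (hq : 1 < q) (a : E) :
    ‖a‖ ^ (q - 2) * ‖a‖ = ‖a‖ ^ (q - 1) := by
  rw [← Real.rpow_add_one' (norm_nonneg _) (by linarith)]; ring_nf

lemma norm_add_rpow_le {q : ℝ} (hq : 1 < q) (a b : E) :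
    ‖a + b‖ ^ q ≤ 2 ^ q * (‖a‖ ^ q + ‖b‖ ^ q) :=
  (Real.rpow_le_rpow (norm_nonneg _) (norm_add_le a b) (by linarith)).trans
    (add_rpow_le_two_rpow hq (norm_nonneg _) (norm_nonneg _))

variable [InnerProductSpace ℝ E]

lemma norm_rpow_mul_inner_self {q : ℝ} (hq : 1 < q) (a : E) :
    ‖a‖ ^ (q - 2) * ⟪a, a⟫ = ‖a‖ ^ q := by
  rw [real_inner_self_eq_norm_mul_norm, ← mul_assoc, norm_rpow_sub_two_mul hq,
    ← norm_rpow_eq_mul hq]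

lemma abs_norm_rpow_mul_inner_le {q : ℝ} (hq : 1 < q) (a b : E) :
    |‖a‖ ^ (q - 2) * ⟪a, b⟫| ≤ ‖a‖ ^ (q - 1) * ‖b‖ := by
  rw [abs_mul, abs_of_nonneg (by positivity), ← norm_rpow_sub_two_mul hq, mul_assoc]
  gcongr
  exact abs_real_inner_le_norm a b

/-- Convexity of `‖·‖ ^ q`. -/
lemma mul_norm_rpow_mul_inner_le {q : ℝ} (hq : 1 < q) (a b : E) :
    q * (‖a‖ ^ (q - 2) * ⟪a, b⟫) ≤ (q - 1) * ‖a‖ ^ q + ‖b‖ ^ q :=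
  (mul_le_mul_of_nonneg_left ((le_abs_self _).trans (abs_norm_rpow_mul_inner_le hq a b))
    (by linarith)).trans (mul_rpow_mul_le hq (norm_nonneg a) (norm_nonneg b))

lemma norm_midpoint_rpow_le {q : ℝ} (hq : 1 < q) (a b : E) :
    ‖(1 / 2 : ℝ) • (a + b)‖ ^ q ≤ (‖a‖ ^ q + ‖b‖ ^ q) / 2 := by
  have h1 : ‖(1 / 2 : ℝ) • (a + b)‖ ≤ (1 / 2 : ℝ) * ‖a‖ + (1 / 2 : ℝ) * ‖b‖ := by
    rw [norm_smul, ← mul_add]; norm_num [norm_add_le]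
  have h2 := (convexOn_rpow hq.le).2 (Set.mem_Ici.2 (norm_nonneg a))
    (Set.mem_Ici.2 (norm_nonneg b)) (by norm_num : (0 : ℝ) ≤ 1 / 2)
    (by norm_num : (0 : ℝ) ≤ 1 / 2) (by norm_num)
  simp only [smul_eq_mul] at h2
  have h3 := Real.rpow_le_rpow (norm_nonneg _) h1 (by linarith : 0 ≤ q)
  linarith

/-- Strictness has two sources: strict convexity of the Hilbert ball if the norms agree, and strict
convexity of `t ^ q` if they differ. -/
lemma norm_midpoint_rpow_lt {q : ℝ} (hq : 1 < q) {a b : E} (hab : a ≠ b) :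
    ‖(1 / 2 : ℝ) • (a + b)‖ ^ q < (‖a‖ ^ q + ‖b‖ ^ q) / 2 := by
  have hq0 : 0 < q := by linarith
  by_cases h : ‖a‖ = ‖b‖
  · have h1 : ‖(1 / 2 : ℝ) • a + (1 / 2 : ℝ) • b‖ < ‖a‖ :=
      norm_combo_lt_of_ne le_rfl h.ge hab (by norm_num) (by norm_num) (by norm_num)
    rw [← smul_add] at h1
    have h2 := Real.rpow_lt_rpow (norm_nonneg _) h1 hq0
    rw [← h]; linarith
  · have h1 : ‖(1 / 2 : ℝ) • (a + b)‖ ≤ (1 / 2 : ℝ) * ‖a‖ + (1 / 2 : ℝ) * ‖b‖ := by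
      rw [norm_smul, ← mul_add]; norm_num [norm_add_le]
    have h2 := (strictConvexOn_rpow hq).2 (Set.mem_Ici.2 (norm_nonneg a))
      (Set.mem_Ici.2 (norm_nonneg b)) h (by norm_num : (0 : ℝ) < 1 / 2)
      (by norm_num : (0 : ℝ) < 1 / 2) (by norm_num)
    simp only [smul_eq_mul] at h2
    have h3 := Real.rpow_le_rpow (norm_nonneg _) h1 hq0.le
    linarith

/-- Uniform convexity of `‖·‖ ^ q` on a finite-dimensional space. -/
lemma exists_norm_sub_rpow_le [FiniteDimensional ℝ E] {q : ℝ} (hq : 1 < q) {ε : ℝ} (hε : 0 < ε) :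
    ∃ K : ℝ, 0 ≤ K ∧ ∀ a b : E, ‖a - b‖ ^ q ≤ ε * (‖a‖ ^ q + ‖b‖ ^ q)
      + K * ((‖a‖ ^ q + ‖b‖ ^ q) / 2 - ‖(1 / 2 : ℝ) • (a + b)‖ ^ q) := by
  have hq0 : 0 < q := by linarith
  let D : E × E → ℝ := fun z => (‖z.1‖ ^ q + ‖z.2‖ ^ q) / 2 - ‖(1 / 2 : ℝ) • (z.1 + z.2)‖ ^ q
  have c1 : ∀ f : E × E → E, Continuous f → Continuous fun z => ‖f z‖ ^ q := fun f hf =>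
    hf.norm.rpow_const fun _ => Or.inr hq0.le
  have hD : Continuous D := by
    have := c1 _ continuous_fst
    have := c1 _ continuous_snd
    have := c1 (fun z => (1 / 2 : ℝ) • (z.1 + z.2)) (by fun_prop)
    fun_prop
  -- Both sides are homogeneous of degree `q`, so the unit sphere of `E × E` suffices. On its
  -- compact part where `K = 0` might not do, the convexity defect `D` is positive and hence bounded
  -- below.
  let S : Set (E × E) := Metric.sphere 0 1 ∩
    {z | ε * (‖z.1‖ ^ q + ‖z.2‖ ^ q) ≤ ‖z.1 - z.2‖ ^ q}
  have hS : IsCompact S := (isCompact_sphere _ _).inter_right <| isClosed_le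
    (continuous_const.mul ((c1 _ continuous_fst).add (c1 _ continuous_snd)))
    (c1 (fun z => z.1 - z.2) (by fun_prop))
  have hDpos : ∀ z ∈ S, 0 < D z := by
    rintro ⟨a, b⟩ ⟨h1, h2⟩
    have hab : a ≠ b := by
      rintro rfl
      simp only [Set.mem_ofPred_eq, sub_self, norm_zero, Real.zero_rpow hq0.ne'] at h2
      have h3 : ‖a‖ ^ q ≤ 0 := by nlinarith
      have h4 : ‖a‖ = 0 := by
        by_contra h
        have : 0 < ‖a‖ := lt_of_le_of_ne (norm_nonneg _) (Ne.symm h)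
        have : 0 < ‖a‖ ^ q := by positivity
        linarith
      rw [norm_eq_zero] at h4
      subst h4
      simp at h1
    exact sub_pos.2 (norm_midpoint_rpow_lt hq hab)
  obtain ⟨m, hm, hmD⟩ : ∃ m : ℝ, 0 < m ∧ ∀ z ∈ S, m ≤ D z := by
    rcases S.eq_empty_or_nonempty with h | h
    · exact ⟨1, one_pos, by simp [h]⟩
    · obtain ⟨z, hz, hmin⟩ := hS.exists_isMinOn h hD.continuousOn
      exact ⟨D z, hDpos z hz, fun w hw => hmin hw⟩
  have hDnn : ∀ z, 0 ≤ D z := fun z => sub_nonneg.2 (norm_midpoint_rpow_le hq _ _)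
  -- With `t` the norm of `(a, b)`, scaling gives `D (a, b) ≥ m t ^ q`, while `‖a - b‖ ^ q ≤ (2 t) ^
  -- q`.
  refine ⟨2 ^ q / m, by positivity, fun a b => ?_⟩
  by_cases hz : ‖((a, b) : E × E)‖ = 0
  · rw [norm_eq_zero, Prod.mk_eq_zero] at hz
    obtain ⟨rfl, rfl⟩ := hz
    simp [Real.zero_rpow hq0.ne']
  set t : ℝ := ‖((a, b) : E × E)‖ with ht
  have htpos : 0 < t := lt_of_le_of_ne (norm_nonneg _) (Ne.symm hz)
  by_cases hcase : ε * (‖a‖ ^ q + ‖b‖ ^ q) ≤ ‖a - b‖ ^ q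
  swap
  · have := mul_nonneg (by positivity : (0 : ℝ) ≤ 2 ^ q / m) (hDnn (a, b))
    simp only [D] at this
    linarith
  have hsc : ∀ c : E, ‖t⁻¹ • c‖ ^ q = (t ^ q)⁻¹ * ‖c‖ ^ q := fun c => by
    rw [norm_smul, Real.mul_rpow (norm_nonneg _) (norm_nonneg _), Real.norm_of_nonneg
      (by positivity), Real.inv_rpow htpos.le]
  have hmem : (t⁻¹ • a, t⁻¹ • b) ∈ S := by
    refine ⟨?_, ?_⟩
    · rw [mem_sphere_zero_iff_norm, ← Prod.smul_mk, norm_smul, norm_inv, ← ht,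
        Real.norm_of_nonneg htpos.le, inv_mul_cancel₀ hz]
    · simp only [Set.mem_ofPred_eq, ← smul_sub, hsc]
      have : 0 ≤ (t ^ q)⁻¹ := by positivity
      nlinarith
  have h1 := hmD _ hmem
  have h2 : D (t⁻¹ • a, t⁻¹ • b) = (t ^ q)⁻¹ * D (a, b) := by
    simp only [D, ← smul_add, hsc, smul_comm (1 / 2 : ℝ) t⁻¹]
    ring
  rw [h2] at h1
  have htq : 0 < t ^ q := by positivity
  have h3 : m * t ^ q ≤ D (a, b) := by
    have := mul_le_mul_of_nonneg_left h1 htq.le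
    rw [mul_inv_cancel_left₀ htq.ne'] at this
    linarith
  have h4 : ‖a - b‖ ^ q ≤ 2 ^ q * t ^ q := by
    rw [← Real.mul_rpow (by norm_num) htpos.le]
    refine Real.rpow_le_rpow (norm_nonneg _) ?_ hq0.le
    have e1 : ‖a‖ ≤ t := norm_fst_le (a, b)
    have e2 : ‖b‖ ≤ t := norm_snd_le (a, b)
    have := norm_sub_le a b
    linarith
  have h5 : 2 ^ q * t ^ q ≤ 2 ^ q / m * D (a, b) := by
    rw [div_mul_eq_mul_div, mul_div_assoc]
    gcongr
    rwa [le_div_iff₀ hm, mul_comm]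
  have h6 : 0 ≤ ε * (‖a‖ ^ q + ‖b‖ ^ q) := by positivity
  have h7 : D (a, b) = (‖a‖ ^ q + ‖b‖ ^ q) / 2 - ‖(1 / 2 : ℝ) • (a + b)‖ ^ q := rfl
  rw [← h7]
  linarith

/-- For `q < 2` the power is singular at `0`, but the product is dominated by `‖a‖ ^ (q - 1) * ‖b‖`,
which tends to zero there. -/
lemma continuous_norm_rpow_mul_inner {q : ℝ} (hq : 1 < q) :
    Continuous fun z : E × E => ‖z.1‖ ^ (q - 2) * ⟪z.1, z.2⟫ := by
  rw [continuous_iff_continuousAt]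
  rintro ⟨a, b⟩
  by_cases ha : a = 0
  · subst ha
    have h1 : Tendsto (fun z : E × E => ‖z.1‖ ^ (q - 1) * ‖z.2‖) (𝓝 (0, b)) (𝓝 0) := by
      have : Continuous fun z : E × E => ‖z.1‖ ^ (q - 1) * ‖z.2‖ :=
        (continuous_fst.norm.rpow_const fun _ => Or.inr (by linarith)).mul continuous_snd.norm
      convert this.tendsto (0, b) using 2
      simp [Real.zero_rpow (by linarith : q - 1 ≠ 0)]
    have h2 : ‖((0 : E), b).1‖ ^ (q - 2) * ⟪((0 : E), b).1, ((0 : E), b).2⟫ = 0 := by simp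
    rw [ContinuousAt, h2]
    exact squeeze_zero_norm (fun z => abs_norm_rpow_mul_inner_le hq z.1 z.2) h1
  · have h1 : ContinuousAt (fun z : E × E => ‖z.1‖ ^ (q - 2)) (a, b) :=
      (continuous_fst.norm.continuousAt).rpow_const (Or.inl (by simpa using ha))
    exact h1.mul (by fun_prop)

end NormPow

end PLap

namespace PLap

/-! ### Integrals of powers of `L^p` functions -/

lemma one_lt_toReal {p : ℝ≥0∞} (hp : 1 < p) (hp' : p ≠ ⊤) : 1 < p.toReal := by
  rw [← ENNReal.toReal_one]
  exact (ENNReal.toReal_lt_toReal (by simp) hp').2 hp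

section LpIntegrals

variable {α E : Type*} [MeasurableSpace α] {μ : Measure α} [NormedAddCommGroup E]
  {p : ℝ≥0∞}

lemma Lp_integrable_norm_rpow (hp : 1 < p) (hp' : p ≠ ⊤) (G : Lp E p μ) :
    Integrable (fun x => ‖G x‖ ^ p.toReal) μ :=
  (Lp.memLp G).integrable_norm_rpow (zero_lt_one.trans hp).ne' hp'

lemma Lp_norm_rpow_eq_integral (hp : 1 < p) (hp' : p ≠ ⊤) (G : Lp E p μ) :
    ‖G‖ ^ p.toReal = ∫ x, ‖G x‖ ^ p.toReal ∂μ := by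
  have hq := one_lt_toReal hp hp'
  have h0 : 0 ≤ ∫ x, ‖G x‖ ^ p.toReal ∂μ := integral_nonneg fun x => by positivity
  rw [Lp.norm_def, (Lp.memLp G).eLpNorm_eq_integral_rpow_norm (zero_lt_one.trans hp).ne' hp',
    ENNReal.toReal_ofReal (by positivity), ← Real.rpow_mul h0, inv_mul_cancel₀ (by linarith),
    Real.rpow_one]

lemma integrable_bdd_mul {a f : α → ℝ} {M : ℝ} (hf : Integrable f μ)
    (ha : AEStronglyMeasurable a μ) (hb : ∀ᵐ x ∂μ, |a x| ≤ M) :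
    Integrable (fun x => a x * f x) μ :=
  hf.bdd_mul ha hb

lemma Lp_integrable_norm_rpow_mul_norm (hp : 1 < p) (hp' : p ≠ ⊤) (G H : Lp E p μ) :
    Integrable (fun x => ‖G x‖ ^ (p.toReal - 1) * ‖H x‖) μ := by
  have hq := one_lt_toReal hp hp'
  refine ((Lp_integrable_norm_rpow hp hp' G).add (Lp_integrable_norm_rpow hp hp' H)).mono'
    ?_ (Eventually.of_forall fun x => ?_)
  · exact ((((Lp.aestronglyMeasurable G).norm.aemeasurable.pow_const _).mul
      (Lp.aestronglyMeasurable H).norm.aemeasurable)).aestronglyMeasurable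
  · rw [Real.norm_of_nonneg (by positivity)]
    simpa using rpow_mul_le_young hq one_pos (norm_nonneg (G x)) (norm_nonneg (H x))

/-- Fatou's lemma for weighted integrals along an `L^p`-convergent sequence. -/
lemma integral_mul_norm_rpow_le_of_tendsto [Fact (1 ≤ p)] (hp : 1 < p) (hp' : p ≠ ⊤) {G : ℕ → Lp E p μ}
    {G₀ : Lp E p μ} (hG : Tendsto G atTop (𝓝 G₀)) {a : α → ℝ} (ha : AEStronglyMeasurable a μ)
    (ha0 : ∀ᵐ x ∂μ, 0 ≤ a x) {C : ℕ → ℝ} {C₀ : ℝ} (hC : Tendsto C atTop (𝓝 C₀))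
    (hint : ∀ k, Integrable (fun x => a x * ‖G k x‖ ^ p.toReal) μ)
    (hle : ∀ k, ∫ x, a x * ‖G k x‖ ^ p.toReal ∂μ ≤ C k) :
    Integrable (fun x => a x * ‖G₀ x‖ ^ p.toReal) μ ∧
      ∫ x, a x * ‖G₀ x‖ ^ p.toReal ∂μ ≤ C₀ := by
  have hq := one_lt_toReal hp hp'
  -- Only a subsequence converges almost everywhere. This is harmless because the bounds `C`
  -- converge along the full sequence.
  obtain ⟨ns, hns, hae⟩ := (tendstoInMeasure_of_tendsto_Lp hG).exists_seq_tendsto_ae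
  have hmeas : ∀ H : Lp E p μ, AEStronglyMeasurable (fun x => a x * ‖H x‖ ^ p.toReal) μ :=
    fun H => ha.mul
      ((Lp.aestronglyMeasurable H).norm.aemeasurable.pow_const _).aestronglyMeasurable
  have hnn : ∀ H : Lp E p μ, 0 ≤ᵐ[μ] fun x => a x * ‖H x‖ ^ p.toReal := fun H => by
    filter_upwards [ha0] with x hx
    simp only [Pi.zero_apply]
    positivity
  have key : ∫⁻ x, ENNReal.ofReal (a x * ‖G₀ x‖ ^ p.toReal) ∂μ ≤ ENNReal.ofReal C₀ := by
    have h1 : ∀ᵐ x ∂μ, ENNReal.ofReal (a x * ‖G₀ x‖ ^ p.toReal)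
        = liminf (fun k => ENNReal.ofReal (a x * ‖G (ns k) x‖ ^ p.toReal)) atTop := by
      filter_upwards [hae] with x hx
      refine (Tendsto.liminf_eq ?_).symm
      refine (ENNReal.continuous_ofReal.tendsto _).comp (Tendsto.const_mul _ ?_)
      exact (hx.norm).rpow_const (Or.inr (by linarith))
    rw [lintegral_congr_ae h1]
    refine (lintegral_liminf_le' fun k => (hmeas _).aemeasurable.ennreal_ofReal).trans ?_
    have h2 : Tendsto (fun k => ENNReal.ofReal (C (ns k))) atTop (𝓝 (ENNReal.ofReal C₀)) :=
      (ENNReal.continuous_ofReal.tendsto _).comp (hC.comp hns.tendsto_atTop)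
    rw [← h2.liminf_eq]
    refine liminf_le_liminf (Eventually.of_forall fun k => ?_)
    rw [← ofReal_integral_eq_lintegral_ofReal (hint _) (hnn _)]
    exact ENNReal.ofReal_le_ofReal (hle _)
  have hI : Integrable (fun x => a x * ‖G₀ x‖ ^ p.toReal) μ := by
    refine ⟨hmeas _, ?_⟩
    rw [hasFiniteIntegral_iff_ofReal (hnn _)]
    exact key.trans_lt ENNReal.ofReal_lt_top
  refine ⟨hI, ?_⟩
  rw [← ofReal_integral_eq_lintegral_ofReal hI (hnn _)] at key
  have hC0 : 0 ≤ C₀ := ge_of_tendsto' hC fun k =>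
    (integral_nonneg_of_ae (hnn (G k))).trans (hle k)
  exact (ENNReal.ofReal_le_ofReal_iff hC0).1 key

variable [InnerProductSpace ℝ E]

lemma Lp_integrable_flux (hp : 1 < p) (hp' : p ≠ ⊤) {a : α → ℝ} {M : ℝ}
    (ha : AEStronglyMeasurable a μ) (hb : ∀ᵐ x ∂μ, |a x| ≤ M) (G H : Lp E p μ) :
    Integrable (fun x => a x * ‖G x‖ ^ (p.toReal - 2) * ⟪G x, H x⟫) μ := by
  have hq := one_lt_toReal hp hp'
  have : Integrable (fun x => ‖G x‖ ^ (p.toReal - 2) * ⟪G x, H x⟫) μ := by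
    refine (Lp_integrable_norm_rpow_mul_norm hp hp' G H).mono' ?_
      (Eventually.of_forall fun x => abs_norm_rpow_mul_inner_le hq _ _)
    exact (continuous_norm_rpow_mul_inner hq).comp_aestronglyMeasurable
      ((Lp.aestronglyMeasurable G).prodMk (Lp.aestronglyMeasurable H))
  simpa only [mul_assoc] using integrable_bdd_mul this ha hb

end LpIntegrals

/-- `γ` is measurable on `Ω` with values in `[m, M]`, `m > 0`. -/
structure IsElliptic {n : ℕ} (Ω : Set (Euc n)) (γ : Euc n → ℝ) (m M : ℝ) : Prop where
  measurableSet : MeasurableSet Ω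
  aestronglyMeasurable : AEStronglyMeasurable γ (volume.restrict Ω)
  pos : 0 < m
  lower : ∀ x ∈ Ω, m ≤ γ x
  upper : ∀ x ∈ Ω, γ x ≤ M

/-! ### The energy and its convexity -/

section Energy

variable {n : ℕ} {Ω : Set (Euc n)} {p : ℝ≥0∞} [Fact (1 ≤ p)] {γ : Euc n → ℝ} {m M : ℝ}

lemma IsElliptic.ae_mem (h : IsElliptic Ω γ m M) : ∀ᵐ x ∂(volume.restrict Ω), x ∈ Ω :=
  ae_restrict_mem h.measurableSet

lemma IsElliptic.ae_abs_le (h : IsElliptic Ω γ m M) :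
    ∀ᵐ x ∂(volume.restrict Ω), |γ x| ≤ M := by
  filter_upwards [h.ae_mem] with x hx
  rw [abs_of_nonneg (h.pos.le.trans (h.lower x hx))]
  exact h.upper x hx

/-- `∫_Ω γ |∇u|^p dx`. -/
noncomputable def energy (γ : Euc n → ℝ) (u : W1 Ω p) : ℝ :=
  ∫ x in Ω, γ x * ‖grad u x‖ ^ p.toReal

lemma grad_sub (u v : W1 Ω p) : grad (u - v) = grad u - grad v := rfl

lemma grad_add_ae (u v : W1 Ω p) :
    ∀ᵐ x ∂(volume.restrict Ω), grad (u + v) x = grad u x + grad v x :=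
  Lp.coeFn_add (grad u) (grad v)

lemma grad_sub_ae (u v : W1 Ω p) :
    ∀ᵐ x ∂(volume.restrict Ω), grad (u - v) x = grad u x - grad v x :=
  Lp.coeFn_sub (grad u) (grad v)

lemma grad_smul_ae (c : ℝ) (u : W1 Ω p) :
    ∀ᵐ x ∂(volume.restrict Ω), grad (c • u) x = c • grad u x :=
  Lp.coeFn_smul c (grad u)

lemma IsElliptic.integrable_energy (h : IsElliptic Ω γ m M) (hp : 1 < p) (hp' : p ≠ ⊤)
    (u : W1 Ω p) :
    Integrable (fun x => γ x * ‖grad u x‖ ^ p.toReal) (volume.restrict Ω) :=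
  integrable_bdd_mul (Lp_integrable_norm_rpow hp hp' _) h.aestronglyMeasurable h.ae_abs_le

lemma IsElliptic.integrable_pairing (h : IsElliptic Ω γ m M) (hp : 1 < p) (hp' : p ≠ ⊤)
    (u v : W1 Ω p) :
    Integrable (fun x => γ x * ‖grad u x‖ ^ (p.toReal - 2) * ⟪grad u x, grad v x⟫)
      (volume.restrict Ω) :=
  Lp_integrable_flux hp hp' h.aestronglyMeasurable h.ae_abs_le _ _

lemma pairing_self (hp : 1 < p) (hp' : p ≠ ⊤) (γ : Euc n → ℝ) (u : W1 Ω p) :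
    pairing γ u u = energy γ u := by
  simp only [pairing, energy, mul_assoc, norm_rpow_mul_inner_self (one_lt_toReal hp hp')]

lemma IsElliptic.pairing_add (h : IsElliptic Ω γ m M) (hp : 1 < p) (hp' : p ≠ ⊤)
    (u v w : W1 Ω p) : pairing γ u (v + w) = pairing γ u v + pairing γ u w := by
  unfold pairing
  rw [← integral_add (h.integrable_pairing hp hp' u v) (h.integrable_pairing hp hp' u w)]
  refine integral_congr_ae ?_
  filter_upwards [grad_add_ae v w] with x hx
  rw [hx, inner_add_right, mul_add]

lemma pairing_smul (γ : Euc n → ℝ) (u v : W1 Ω p) (c : ℝ) :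
    pairing γ u (c • v) = c * pairing γ u v := by
  unfold pairing
  rw [← integral_const_mul]
  refine integral_congr_ae ?_
  filter_upwards [grad_smul_ae c v] with x hx
  rw [hx, inner_smul_right]
  ring

lemma IsElliptic.pairing_sub (h : IsElliptic Ω γ m M) (hp : 1 < p) (hp' : p ≠ ⊤)
    (u v w : W1 Ω p) : pairing γ u (v - w) = pairing γ u v - pairing γ u w := by
  have := h.pairing_add hp hp' u (v - w) w
  rw [sub_add_cancel] at this
  linarith

lemma IsElliptic.energy_mono (h : IsElliptic Ω γ m M) (hp : 1 < p) (hp' : p ≠ ⊤)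
    (u : W1 Ω p) : m * ‖grad u‖ ^ p.toReal ≤ energy γ u ∧ energy γ u ≤ M * ‖grad u‖ ^ p.toReal := by
  rw [Lp_norm_rpow_eq_integral hp hp', ← integral_const_mul, ← integral_const_mul]
  have hI := Lp_integrable_norm_rpow hp hp' (grad u)
  constructor
  · refine integral_mono_ae (hI.const_mul m) (h.integrable_energy hp hp' u) ?_
    filter_upwards [h.ae_mem] with x hx
    have := h.lower x hx
    gcongr
  · refine integral_mono_ae (h.integrable_energy hp hp' u) (hI.const_mul M) ?_
    filter_upwards [h.ae_mem] with x hx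
    have := h.upper x hx
    gcongr

/-- The convexity inequality for the energy. -/
lemma IsElliptic.mul_pairing_le (h : IsElliptic Ω γ m M) (hp : 1 < p) (hp' : p ≠ ⊤)
    (u v : W1 Ω p) :
    p.toReal * pairing γ u v ≤ (p.toReal - 1) * energy γ u + energy γ v := by
  unfold pairing energy
  rw [← integral_const_mul, ← integral_const_mul, ← integral_add
    ((h.integrable_energy hp hp' u).const_mul _) (h.integrable_energy hp hp' v)]
  refine integral_mono_ae ((h.integrable_pairing hp hp' u v).const_mul _)
    (((h.integrable_energy hp hp' u).const_mul _).add (h.integrable_energy hp hp' v)) ?_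
  filter_upwards [h.ae_mem] with x hx
  have h1 := mul_norm_rpow_mul_inner_le (one_lt_toReal hp hp') (grad u x) (grad v x)
  have h2 := mul_le_mul_of_nonneg_left h1 (h.pos.le.trans (h.lower x hx))
  linarith

/-- Weak solutions minimize the energy. -/
lemma IsElliptic.energy_le_of_isWeakSolution (h : IsElliptic Ω γ m M) (hp : 1 < p) (hp' : p ≠ ⊤)
    {u v : W1 Ω p} (hu : IsWeakSolution γ u) (hv : v - u ∈ W10 Ω p) :
    energy γ u ≤ energy γ v := by
  -- Testing with `v - u` turns `pairing γ u v` into `energy γ u`; the convexity inequality then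
  -- reads `q E(u) ≤ (q - 1) E(u) + E(v)`.
  have h1 := hu _ hv
  rw [h.pairing_sub hp hp', pairing_self hp hp'] at h1
  have h2 := h.mul_pairing_le hp hp' u v
  have h3 : pairing γ u v = energy γ u := by linarith
  rw [h3] at h2
  linarith

/-- Convexity applied to both `v` and `-v`. The bound is not homogeneous in `v`, but on the unit
ball it already gives continuity of the boundary current. -/
lemma IsElliptic.abs_pairing_le (h : IsElliptic Ω γ m M) (hp : 1 < p) (hp' : p ≠ ⊤)
    (u v : W1 Ω p) :
    p.toReal * |pairing γ u v| ≤ (p.toReal - 1) * energy γ u + energy γ v := by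
  rcases abs_cases (pairing γ u v) with ⟨h1, _⟩ | ⟨h1, _⟩ <;> rw [h1]
  · exact h.mul_pairing_le hp hp' u v
  · have h2 := h.mul_pairing_le hp hp' u ((-1 : ℝ) • v)
    have h3 : energy γ ((-1 : ℝ) • v) = energy γ v := by
      unfold energy
      refine integral_congr_ae ?_
      filter_upwards [grad_smul_ae (-1) v] with x hx
      rw [hx, norm_smul]
      simp
    rw [pairing_smul, h3] at h2
    linarith

end Energy

end PLap

namespace PLap

/-! ### The Sobolev space: completeness, smooth functions and multipliers -/

section Sobolev

lemma gradient_coord {n : ℕ} (f : Euc n → ℝ) (x : Euc n) (i : Fin n) :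
    gradient f x i = fderiv ℝ f x (EuclideanSpace.single i 1) := by
  rw [← inner_gradient_left, EuclideanSpace.inner_single_right]
  simp

lemma norm_gradient {n : ℕ} (f : Euc n → ℝ) (x : Euc n) : ‖gradient f x‖ = ‖fderiv ℝ f x‖ := by
  rw [gradient, LinearIsometryEquiv.norm_map]

lemma continuous_gradient {n : ℕ} {f : Euc n → ℝ} (hf : ContDiff ℝ 1 f) :
    Continuous (gradient f) :=
  (InnerProductSpace.toDual ℝ (Euc n)).symm.continuous.comp (hf.continuous_fderiv (by simp))

lemma gradient_mul {n : ℕ} {f g : Euc n → ℝ} {x : Euc n} (hf : DifferentiableAt ℝ f x)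
    (hg : DifferentiableAt ℝ g x) :
    gradient (fun y => f y * g y) x = f x • gradient g x + g x • gradient f x := by
  simp only [gradient]
  rw [fderiv_fun_mul hf hg, map_add, map_smul, map_smul]

lemma hasCompactSupport_gradient {n : ℕ} {f : Euc n → ℝ} (hf : HasCompactSupport f) :
    HasCompactSupport (gradient f) :=
  (hf.fderiv ℝ).comp_left (map_zero _)

/-- Hölder's inequality for `L^∞ × L^p → L^p`; the two terms `θ ∇u` and `u ∇θ` of the Leibniz rule
are both instances. -/
lemma exists_Lp_bilin {α E F G : Type*} [MeasurableSpace α] {μ : Measure α} {p : ℝ≥0∞}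
    [Fact (1 ≤ p)] [NormedAddCommGroup E] [NormedSpace ℝ E] [NormedAddCommGroup F] [NormedSpace ℝ F]
    [NormedAddCommGroup G] [NormedSpace ℝ G] (B : F →L[ℝ] E →L[ℝ] G) {Θ : α → F}
    (hΘ : MemLp Θ ⊤ μ) :
    ∃ T : Lp E p μ →L[ℝ] Lp G p μ, ∀ f, T f =ᵐ[μ] fun x => B (Θ x) (f x) := by
  refine ⟨B.holderL μ ⊤ p p (hΘ.toLp Θ), fun f => ?_⟩
  filter_upwards [B.coeFn_holder (r := p) (hΘ.toLp Θ) f, hΘ.coeFn_toLp] with x hx h1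
  rw [h1] at hx
  exact hx

section Mul

variable {α E : Type*} [MeasurableSpace α] {μ : Measure α} {p : ℝ≥0∞} [Fact (1 ≤ p)]
  [NormedAddCommGroup E] [NormedSpace ℝ E]

lemma exists_Lp_smul {θ : α → ℝ} (hθ : MemLp θ ⊤ μ) :
    ∃ T : Lp E p μ →L[ℝ] Lp E p μ, ∀ f, T f =ᵐ[μ] fun x => θ x • f x := by
  obtain ⟨T, hT⟩ := exists_Lp_bilin (p := p)
    (ContinuousLinearMap.lsmul ℝ ℝ : ℝ →L[ℝ] E →L[ℝ] E) hθ
  exact ⟨T, hT⟩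

lemma exists_Lp_smul_vector {Θ : α → E} (hΘ : MemLp Θ ⊤ μ) :
    ∃ T : Lp ℝ p μ →L[ℝ] Lp E p μ, ∀ f, T f =ᵐ[μ] fun x => f x • Θ x := by
  obtain ⟨T, hT⟩ := exists_Lp_bilin (p := p)
    (ContinuousLinearMap.lsmul ℝ ℝ : ℝ →L[ℝ] E →L[ℝ] E).flip hΘ
  exact ⟨T, hT⟩

lemma exists_codRestrict_prod {V W : Type*} [NormedAddCommGroup V] [NormedSpace ℝ V]
    [NormedAddCommGroup W] [NormedSpace ℝ W] (S : Submodule ℝ (V × W)) (A : V →L[ℝ] V)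
    (B : W →L[ℝ] W) (D : V →L[ℝ] W) (h : ∀ z ∈ S, (A z.1, B z.2 + D z.1) ∈ S) :
    ∃ T : S →L[ℝ] S, ∀ z : S, (T z : V × W) = (A z.1.1, B z.1.2 + D z.1.1) :=
  ⟨((((A.comp (ContinuousLinearMap.fst ℝ V W)).prod (B.comp (ContinuousLinearMap.snd ℝ V W)
    + D.comp (ContinuousLinearMap.fst ℝ V W))).comp S.subtypeL).codRestrict S
      fun z => h z z.2), fun _ => rfl⟩

end Mul

variable {α : Type*} [MeasurableSpace α] [TopologicalSpace α] [OpensMeasurableSpace α]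
  {μ : Measure α} [IsFiniteMeasureOnCompacts μ]
  {E : Type*} [NormedAddCommGroup E] [NormedSpace ℝ E] {p : ℝ≥0∞} [Fact (1 ≤ p)]

/-- A continuous compactly supported `ψ` lies in the conjugate Lebesgue space, so this is the
duality pairing. Continuity in `G` lets integral identities survive `L^p` limits. -/
lemma exists_integral_Lp_mul (L : E →L[ℝ] ℝ) {ψ : α → ℝ} (hψ : Continuous ψ)
    (hc : HasCompactSupport ψ) :
    ∃ T : Lp E p μ →L[ℝ] ℝ, ∀ G, T G = ∫ x, L (G x) * ψ x ∂μ := by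
  let q : ℝ≥0∞ := ENNReal.conjExponent p
  have hpq : p.HolderConjugate q := ENNReal.HolderConjugate.conjExponent Fact.out
  have hq : Fact (1 ≤ q) := ⟨hpq.symm.one_le⟩
  have hm : MemLp ψ q μ := hψ.memLp_of_hasCompactSupport hc
  let B : E →L[ℝ] ℝ →L[ℝ] ℝ := (ContinuousLinearMap.mul ℝ ℝ).comp L
  refine ⟨(B.lpPairing μ p q).flip (hm.toLp ψ), fun G => ?_⟩
  rw [ContinuousLinearMap.flip_apply, ContinuousLinearMap.lpPairing_eq_integral]
  refine integral_congr_ae ?_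
  filter_upwards [hm.coeFn_toLp] with x hx
  rw [hx]
  rfl

lemma continuous_integral_Lp_mul (L : E →L[ℝ] ℝ) {ψ : α → ℝ} (hψ : Continuous ψ)
    (hc : HasCompactSupport ψ) :
    Continuous fun G : Lp E p μ => ∫ x, L (G x) * ψ x ∂μ := by
  obtain ⟨T, hT⟩ := exists_integral_Lp_mul (p := p) (μ := μ) L hψ hc
  simp_rw [← hT]
  exact T.continuous

end Sobolev

/-! ### Completeness of the Sobolev space and multiplication by smooth functions -/

section W1

variable {n : ℕ} {Ω : Set (Euc n)} {p : ℝ≥0∞} [Fact (1 ≤ p)]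

lemma isClosed_W1 : IsClosed (SetLike.coe (W1 Ω p)) := by
  have : SetLike.coe (W1 Ω p) = ⋂ (φ : Euc n → ℝ) (_ : IsTestFunction Ω φ) (i : Fin n),
      {w | ∫ x in Ω, w.1 x * fderiv ℝ φ x (EuclideanSpace.single i 1)
        = - ∫ x in Ω, w.2 x i * φ x} := by
    ext w
    simp only [Set.mem_iInter]
    rfl
  rw [this]
  refine isClosed_iInter fun φ => isClosed_iInter fun hφ => isClosed_iInter fun i => ?_
  have h1 := continuous_integral_Lp_mul (μ := (volume : Measure (Euc n)).restrict Ω) (p := p)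
    (ContinuousLinearMap.id ℝ ℝ) (hφ.continuous_partial (EuclideanSpace.single i 1))
    (hφ.hasCompactSupport.fderiv_apply ℝ _)
  have h2 := continuous_integral_Lp_mul (μ := (volume : Measure (Euc n)).restrict Ω) (p := p)
    (EuclideanSpace.proj i : Euc n →L[ℝ] ℝ) hφ.contDiff.continuous hφ.hasCompactSupport
  exact isClosed_eq (h1.comp continuous_fst) (h2.comp continuous_snd).neg

instance : CompleteSpace (W1 Ω p) := isClosed_W1.completeSpace_coe

lemma integral_smul_fderiv_eq_neg {φ ψ : Euc n → ℝ} (hφ : ContDiff ℝ ∞ φ) (hψ : ContDiff ℝ ∞ ψ)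
    (hc : HasCompactSupport φ) (v : Euc n) :
    ∫ x, ψ x * fderiv ℝ φ x v = - ∫ x, fderiv ℝ ψ x v * φ x := by
  have d1 : Continuous fun x => fderiv ℝ φ x v :=
    (hφ.continuous_fderiv (by simp)).clm_apply continuous_const
  have d2 : Continuous fun x => fderiv ℝ ψ x v :=
    (hψ.continuous_fderiv (by simp)).clm_apply continuous_const
  refine integral_mul_fderiv_eq_neg_fderiv_mul_of_integrable ?_ ?_ ?_
    (fun x _ => hψ.differentiable (by simp) x) (fun x _ => hφ.differentiable (by simp) x)
  · exact (d2.mul hφ.continuous).integrable_of_hasCompactSupport hc.mul_left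
  · exact (hψ.continuous.mul d1).integrable_of_hasCompactSupport (hc.fderiv_apply ℝ v).mul_left
  · exact (hψ.continuous.mul hφ.continuous).integrable_of_hasCompactSupport hc.mul_left

lemma IsTestFunction.eq_zero_of_notMem {φ : Euc n → ℝ} (hφ : IsTestFunction Ω φ) {x : Euc n}
    (hx : x ∉ Ω) : φ x = 0 :=
  image_eq_zero_of_notMem_tsupport fun h => hx (hφ.tsupport_subset h)

lemma IsTestFunction.fderiv_eq_zero_of_notMem {φ : Euc n → ℝ} (hφ : IsTestFunction Ω φ)
    {x : Euc n} (hx : x ∉ Ω) : fderiv ℝ φ x = 0 :=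
  image_eq_zero_of_notMem_tsupport fun h => hx (hφ.tsupport_subset (tsupport_fderiv_subset ℝ (f := φ) h))

/-- Compactly supported smooth functions on `ℝⁿ` restrict to Sobolev functions on `Ω`. -/
lemma exists_W1_of_contDiff {v : Euc n → ℝ} (hv : ContDiff ℝ ∞ v) (hc : HasCompactSupport v) :
    ∃ w : W1 Ω p, w.1.1 =ᵐ[volume.restrict Ω] v ∧ grad w =ᵐ[volume.restrict Ω] gradient v := by
  have m1 : MemLp v p (volume.restrict Ω) := hv.continuous.memLp_of_hasCompactSupport hc
  have m2 : MemLp (gradient v) p (volume.restrict Ω) :=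
    (continuous_gradient (hv.of_le (by simp))).memLp_of_hasCompactSupport
      (hasCompactSupport_gradient hc)
  refine ⟨⟨(m1.toLp v, m2.toLp (gradient v)), ?_⟩, m1.coeFn_toLp, m2.coeFn_toLp⟩
  intro φ hφ i
  have e1 : ∫ x in Ω, (m1.toLp v) x * fderiv ℝ φ x (EuclideanSpace.single i 1)
      = ∫ x, v x * fderiv ℝ φ x (EuclideanSpace.single i 1) := by
    refine (integral_congr_ae ?_).trans
      (setIntegral_eq_integral_of_forall_compl_eq_zero (s := Ω) fun x hx => ?_)
    · filter_upwards [m1.coeFn_toLp] with x hx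
      rw [hx]
    · simp [hφ.fderiv_eq_zero_of_notMem hx]
  have e2 : ∫ x in Ω, (m2.toLp (gradient v)) x i * φ x
      = ∫ x, fderiv ℝ v x (EuclideanSpace.single i 1) * φ x := by
    refine (integral_congr_ae ?_).trans
      (setIntegral_eq_integral_of_forall_compl_eq_zero (s := Ω) fun x hx => ?_)
    · filter_upwards [m2.coeFn_toLp] with x hx
      rw [hx, gradient_coord]
    · simp [hφ.eq_zero_of_notMem hx]
  change ∫ x in Ω, (m1.toLp v) x * fderiv ℝ φ x (EuclideanSpace.single i 1)
    = - ∫ x in Ω, (m2.toLp (gradient v)) x i * φ x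
  rw [e1, e2]
  exact integral_smul_fderiv_eq_neg hφ.contDiff hv hφ.hasCompactSupport _

/-- `θ` is a smooth bounded function with bounded gradient. -/
structure IsMultiplier (θ : Euc n → ℝ) : Prop where
  contDiff : ContDiff ℝ ∞ θ
  bdd : ∃ C, ∀ x, ‖θ x‖ ≤ C
  bdd_gradient : ∃ C, ∀ x, ‖gradient θ x‖ ≤ C

lemma IsMultiplier.of_hasCompactSupport {θ : Euc n → ℝ} (h : ContDiff ℝ ∞ θ)
    (hc : HasCompactSupport θ) : IsMultiplier θ where
  contDiff := h
  bdd := hc.exists_bound_of_continuous h.continuous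
  bdd_gradient := (hasCompactSupport_gradient hc).exists_bound_of_continuous
    (continuous_gradient (h.of_le (by simp)))

lemma IsMultiplier.mul_isTestFunction {θ φ : Euc n → ℝ} (hθ : IsMultiplier θ)
    (hφ : IsTestFunction Ω φ) : IsTestFunction Ω (fun x => θ x * φ x) where
  contDiff := hθ.contDiff.mul hφ.contDiff
  hasCompactSupport := hφ.hasCompactSupport.mul_left
  tsupport_subset := (tsupport_mul_subset_right (f := θ) (g := φ)).trans hφ.tsupport_subset

/-- The weak Leibniz rule: test the weak gradient of `w` with `θ φ`, which is again a test function,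
and expand its derivative. -/
lemma IsMultiplier.mem_W1 {θ : Euc n → ℝ} (hθ : IsMultiplier θ) (w : W1 Ω p)
    {f : Lp ℝ p ((volume : Measure (Euc n)).restrict Ω)}
    {G : Lp (Euc n) p ((volume : Measure (Euc n)).restrict Ω)}
    (hf : f =ᵐ[volume.restrict Ω] fun x => θ x * w.1.1 x)
    (hG : G =ᵐ[volume.restrict Ω] fun x => θ x • w.1.2 x + w.1.1 x • gradient θ x) :
    (f, G) ∈ W1 Ω p := by
  intro φ hφ i
  have hθφ := hθ.mul_isTestFunction hφ
  have hw := w.2 _ hθφ i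
  have i1 := hθφ.integrable_partial w.1.1 (EuclideanSpace.single i 1)
  have hφθ : Continuous fun x => fderiv ℝ θ x (EuclideanSpace.single i 1) * φ x :=
    ((hθ.contDiff.continuous_fderiv (by simp)).clm_apply continuous_const).mul
      hφ.contDiff.continuous
  have i2 : Integrable (fun x => w.1.1 x * (fderiv ℝ θ x (EuclideanSpace.single i 1) * φ x))
      (volume.restrict Ω) := ((Lp.memLp w.1.1).locallyIntegrable
        (Fact.out : 1 ≤ p)).integrable_smul_right_of_hasCompactSupport hφθ
          hφ.hasCompactSupport.mul_left
  have i3 := hθφ.integrable_coord w.1.2 i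
  have e1 : ∫ x in Ω, f x * fderiv ℝ φ x (EuclideanSpace.single i 1)
      = (∫ x in Ω, w.1.1 x * fderiv ℝ (fun y => θ y * φ y) x (EuclideanSpace.single i 1))
        - ∫ x in Ω, w.1.1 x * (fderiv ℝ θ x (EuclideanSpace.single i 1) * φ x) := by
    rw [← integral_sub i1 i2]
    refine integral_congr_ae ?_
    filter_upwards [hf] with x hx
    rw [hx, fderiv_fun_mul (hθ.contDiff.differentiable (by simp) x)
      (hφ.contDiff.differentiable (by simp) x)]
    simp only [add_apply, smul_apply, smul_eq_mul]
    ring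
  have e2 : ∫ x in Ω, G x i * φ x = (∫ x in Ω, w.1.2 x i * (θ x * φ x))
        + ∫ x in Ω, w.1.1 x * (fderiv ℝ θ x (EuclideanSpace.single i 1) * φ x) := by
    rw [← integral_add i3 i2]
    refine integral_congr_ae ?_
    filter_upwards [hG] with x hx
    rw [hx, PiLp.add_apply, PiLp.smul_apply, PiLp.smul_apply, gradient_coord]
    simp only [smul_eq_mul]
    ring
  change ∫ x in Ω, f x * fderiv ℝ φ x (EuclideanSpace.single i 1) = - ∫ x in Ω, G x i * φ x
  rw [e1, e2, hw]
  ring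

lemma IsMultiplier.mem_testSubspace {θ : Euc n → ℝ} (hθ : IsMultiplier θ) {w w' : W1 Ω p}
    (hf : w'.1.1 =ᵐ[volume.restrict Ω] fun x => θ x * w.1.1 x)
    (hG : grad w' =ᵐ[volume.restrict Ω] fun x => θ x • grad w x + w.1.1 x • gradient θ x)
    (hw : w ∈ testSubspace Ω p) : w' ∈ testSubspace Ω p := by
  obtain ⟨φ, hφ, h1, h2⟩ := hw
  refine ⟨_, hθ.mul_isTestFunction hφ, ?_, ?_⟩
  · filter_upwards [hf, h1] with x hx h1x
    rw [hx, h1x]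
  · filter_upwards [hG, h1, h2] with x hx h1x h2x
    rw [hx, gradient_mul (hθ.contDiff.differentiable (by simp) x)
      (hφ.contDiff.differentiable (by simp) x), h1x, h2x]

/-- `T` acts on `W^{1,p}(Ω)` as the multiplication by `θ`. -/
structure IsMulOperator (θ : Euc n → ℝ) (T : W1 Ω p →L[ℝ] W1 Ω p) : Prop where
  fst_ae : ∀ w, (T w).1.1 =ᵐ[volume.restrict Ω] fun x => θ x * w.1.1 x
  grad_ae : ∀ w, grad (T w) =ᵐ[volume.restrict Ω]
    fun x => θ x • grad w x + w.1.1 x • gradient θ x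
  mem_W10 : ∀ w ∈ W10 Ω p, T w ∈ W10 Ω p

set_option maxHeartbeats 1000000 in
/-- Multiplication by `θ` is bounded on `W^{1,p}(Ω)` and preserves `W^{1,p}_0(Ω)`. -/
lemma IsMultiplier.exists_isMulOperator {θ : Euc n → ℝ} (hθ : IsMultiplier θ) :
    ∃ T : W1 Ω p →L[ℝ] W1 Ω p, IsMulOperator θ T := by
  obtain ⟨C, hC⟩ := hθ.bdd
  obtain ⟨C', hC'⟩ := hθ.bdd_gradient
  have m1 : MemLp θ ⊤ (volume.restrict Ω) := memLp_top_of_bound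
    hθ.contDiff.continuous.aestronglyMeasurable C (Eventually.of_forall hC)
  have m2 : MemLp (gradient θ) ⊤ (volume.restrict Ω) := memLp_top_of_bound
    (continuous_gradient (hθ.contDiff.of_le (by simp))).aestronglyMeasurable C'
    (Eventually.of_forall hC')
  obtain ⟨A, hA⟩ := exists_Lp_smul (E := ℝ) (p := p) m1
  obtain ⟨B, hB⟩ := exists_Lp_smul (E := Euc n) (p := p) m1
  obtain ⟨D, hD⟩ := exists_Lp_smul_vector (p := p) m2
  have g2 : ∀ w : W1 Ω p, ((B w.1.2 + D w.1.1 : Lp (Euc n) p _) : Euc n → Euc n)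
      =ᵐ[volume.restrict Ω] fun x => θ x • w.1.2 x + w.1.1 x • gradient θ x := fun w => by
    filter_upwards [Lp.coeFn_add (B w.1.2) (D w.1.1), hB w.1.2, hD w.1.1] with x h1 h2 h3
    rw [h1, Pi.add_apply, h2, h3]
  obtain ⟨T, hT⟩ := exists_codRestrict_prod (W1 Ω p) A B D
    fun z hz => hθ.mem_W1 ⟨z, hz⟩ (hA z.1) (g2 ⟨z, hz⟩)
  have t1 : ∀ w, (T w).1.1 =ᵐ[volume.restrict Ω] fun x => θ x * w.1.1 x := fun w => by
    rw [hT]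
    exact hA w.1.1
  have t2 : ∀ w, grad (T w) =ᵐ[volume.restrict Ω]
      fun x => θ x • grad w x + w.1.1 x • gradient θ x := fun w => by
    rw [grad, hT]
    exact g2 w
  -- `T` is continuous and maps test functions to test functions, hence it maps the closure into the
  -- closure.
  exact ⟨T, t1, t2, fun w hw => Set.MapsTo.closure
    (fun w hw => hθ.mem_testSubspace (t1 w) (t2 w) hw) T.continuous hw⟩

/-- Every element of `W^{1,p}_0(Ω)` is a limit of test functions. -/
lemma exists_seq_testSubspace {w : W1 Ω p} (hw : w ∈ W10 Ω p) :
    ∃ W : ℕ → W1 Ω p, (∀ k, W k ∈ testSubspace Ω p) ∧ Tendsto W atTop (𝓝 w) :=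
  mem_closure_iff_seq_limit.1 hw

lemma continuous_grad : Continuous (grad : W1 Ω p → _) :=
  continuous_snd.comp continuous_subtype_val

lemma continuous_fst_W1 : Continuous (fun w : W1 Ω p => w.1.1) :=
  continuous_fst.comp continuous_subtype_val

end W1

end PLap

namespace PLap

/-! ### Hardy and Poincaré inequalities -/

section Hardy

/-- Powers of the Hardy weight are continuous only where the weight is positive, but each integrand
below vanishes off the support of `φ`. -/
lemma integrable_of_continuousOn_compact {X : Type*} [TopologicalSpace X] [T2Space X]
    [MeasurableSpace X] [OpensMeasurableSpace X] {μ : Measure X} [IsFiniteMeasureOnCompacts μ]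
    {K : Set X} (hK : IsCompact K) {h : X → ℝ} (hc : ContinuousOn h K)
    (hs : ∀ x ∉ K, h x = 0) : Integrable h μ :=
  (integrableOn_iff_integrable_of_support_subset fun x hx => by
    by_contra hxK
    exact hx (hs x hxK)).1 (hc.integrableOn_compact hK)

variable {n : ℕ}

/-- A Hardy inequality: if `g > 0` grows at least linearly in the direction `e`, then `φ / g` is
controlled by the gradient of `φ`. -/
lemma exists_hardy_const {q c : ℝ} (hq : 1 < q) (hc : 0 < c) :
    ∃ C : ℝ, 0 ≤ C ∧ ∀ (U : Set (Euc n)) (g φ : Euc n → ℝ) (e : Euc n), IsOpen U →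
      ContDiffOn ℝ 1 g U → (∀ x ∈ U, 0 < g x) → (∀ x ∈ U, c ≤ fderiv ℝ g x e) → ‖e‖ ≤ 1 →
      ContDiff ℝ ∞ φ → HasCompactSupport φ → tsupport φ ⊆ U →
      Integrable (fun x => (‖φ x‖ / g x) ^ q) ∧
      ∫ x, (‖φ x‖ / g x) ^ q ≤ C * ∫ x, ‖gradient φ x‖ ^ q := by
  have hq0 : 0 < q := by linarith
  have hq1 : 0 < q - 1 := by linarith
  -- With this `s`, the Young term `q s ∫ (|φ| / g) ^ q` is half of the left side `c (q - 1) ∫ (|φ|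
  -- / g) ^ q` and can be absorbed.
  set s : ℝ := c * (q - 1) / (2 * q) with hs
  have hspos : 0 < s := by positivity
  refine ⟨2 * q * s ^ (1 - q) / (c * (q - 1)), by positivity, ?_⟩
  intro U g φ e hU hg hgpos hge he hφ hcs hsub
  have hφ1 : ContDiff ℝ 1 φ := hφ.of_le (by simp)
  set K := tsupport φ with hK
  have hKc : IsCompact K := hcs
  have hφ0 : ∀ x ∉ K, φ x = 0 := fun x hx => image_eq_zero_of_notMem_tsupport hx
  have hgK : ContinuousOn g K := hg.continuousOn.mono hsub
  have hgpK : ∀ x ∈ K, 0 < g x := fun x hx => hgpos x (hsub hx)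
  have hgd : ∀ x ∈ U, HasFDerivAt g (fderiv ℝ g x) x := fun x hx =>
    ((hg.contDiffAt (hU.mem_nhds hx)).differentiableAt one_ne_zero).hasFDerivAt
  have hgdc : ContinuousOn (fun x => fderiv ℝ g x e) K :=
    ((hg.continuousOn_fderiv_of_isOpen hU le_rfl).clm_apply continuousOn_const).mono hsub
  have hψ : ContDiff ℝ 1 fun x => ‖φ x‖ ^ q := hφ1.norm_rpow hq
  have hψts : tsupport (fun x => ‖φ x‖ ^ q) ⊆ K := by
    refine closure_mono fun x hx => ?_
    intro h0
    exact hx (by simp [h0, Real.zero_rpow hq0.ne'])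
  have hfd : ∀ x ∈ U, HasFDerivAt (fun y => g y ^ (1 - q))
      (((1 - q) * g x ^ (1 - q - 1)) • fderiv ℝ g x) x := fun x hx =>
    (hgd x hx).rpow_const (Or.inl (hgpos x hx).ne')
  have cφ : Continuous φ := hφ.continuous
  have cψ : Continuous fun x => ‖φ x‖ ^ q := hψ.continuous
  have cdψ : Continuous fun x => fderiv ℝ (fun y => ‖φ y‖ ^ q) x e :=
    (hψ.continuous_fderiv one_ne_zero).clm_apply continuous_const
  have cgr : ∀ r : ℝ, ContinuousOn (fun x => g x ^ r) K := fun r =>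
    hgK.rpow_const fun x hx => Or.inl (hgpK x hx).ne'
  have hdψ0 : ∀ x ∉ K, fderiv ℝ (fun y => ‖φ y‖ ^ q) x = 0 := fun x hx =>
    image_eq_zero_of_notMem_tsupport fun h => hx (hψts (tsupport_fderiv_subset ℝ
      (f := fun y => ‖φ y‖ ^ q) h))
  have hψ0 : ∀ x ∉ K, ‖φ x‖ ^ q = 0 := fun x hx => by
    rw [hφ0 x hx, norm_zero, Real.zero_rpow hq0.ne']
  have I1 : Integrable fun x => fderiv ℝ (fun y => g y ^ (1 - q)) x e * ‖φ x‖ ^ q := by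
    refine integrable_of_continuousOn_compact hKc ?_ fun x hx => by rw [hψ0 x hx, mul_zero]
    have : ContinuousOn (fun x => (1 - q) * g x ^ (1 - q - 1) * fderiv ℝ g x e * ‖φ x‖ ^ q) K :=
      ((continuousOn_const.mul (cgr _)).mul hgdc).mul cψ.continuousOn
    refine this.congr fun x hx => ?_
    dsimp only
    rw [(hfd x (hsub hx)).fderiv]
    simp
  have I2 : Integrable fun x => g x ^ (1 - q) * fderiv ℝ (fun y => ‖φ y‖ ^ q) x e :=
    integrable_of_continuousOn_compact hKc ((cgr _).mul cdψ.continuousOn)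
      fun x hx => by rw [hdψ0 x hx, zero_apply, mul_zero]
  have I3 : Integrable fun x => g x ^ (1 - q) * ‖φ x‖ ^ q :=
    integrable_of_continuousOn_compact hKc ((cgr _).mul cψ.continuousOn)
      fun x hx => by rw [hψ0 x hx, mul_zero]
  -- The derivative of `g ^ (1 - q)` along `e` is at most `-c (q - 1) g ^ (-q)`, so moving it onto
  -- `|φ| ^ q` produces the Hardy integral. Differentiability of the power of `g` is required only
  -- on the support of `|φ| ^ q`.
  have key := integral_mul_fderiv_eq_neg_fderiv_mul_of_integrable (μ := volume) I1 I2 I3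
    (fun x hx => (hfd x (hsub (hψts hx))).differentiableAt)
    (fun x _ => hψ.differentiable one_ne_zero x)
  have I4 : Integrable fun x => (‖φ x‖ / g x) ^ q := by
    refine integrable_of_continuousOn_compact hKc ?_ fun x hx => by
      rw [hφ0 x hx, norm_zero, zero_div, Real.zero_rpow hq0.ne']
    exact (cφ.norm.continuousOn.div hgK fun x hx => (hgpK x hx).ne').rpow_const
      fun x _ => Or.inr hq0.le
  have I5 : Integrable fun x => ‖gradient φ x‖ ^ q := by
    have : Continuous fun x => ‖gradient φ x‖ ^ q :=
      (continuous_gradient hφ1).norm.rpow_const fun _ => Or.inr hq0.le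
    refine this.integrable_of_hasCompactSupport ?_
    exact (hasCompactSupport_gradient hcs).comp_left (g := fun v => ‖v‖ ^ q)
      (by simp [Real.zero_rpow hq0.ne'])
  refine ⟨I4, ?_⟩
  have L1 : c * (q - 1) * ∫ x, (‖φ x‖ / g x) ^ q
      ≤ - ∫ x, fderiv ℝ (fun y => g y ^ (1 - q)) x e * ‖φ x‖ ^ q := by
    rw [← integral_const_mul, ← integral_neg]
    refine integral_mono (I4.const_mul _) I1.neg fun x => ?_
    by_cases hx : x ∈ K
    · have hgx := hgpK x hx
      rw [(hfd x (hsub hx)).fderiv, Real.div_rpow (norm_nonneg _) hgx.le,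
        show 1 - q - 1 = -q by ring, Real.rpow_neg hgx.le, smul_apply,
        smul_eq_mul]
      have h1 := hge x (hsub hx)
      have h2 : 0 ≤ (q - 1) * ((g x ^ q)⁻¹ * ‖φ x‖ ^ q) := by positivity
      have h3 := mul_le_mul_of_nonneg_right h1 h2
      rw [div_eq_mul_inv]
      linarith
    · simp only [hφ0 x hx, norm_zero, zero_div, Real.zero_rpow hq0.ne',
        mul_zero, neg_zero, le_refl]
  have L2 : ∫ x, g x ^ (1 - q) * fderiv ℝ (fun y => ‖φ y‖ ^ q) x e
      ≤ (∫ x, q * s * (‖φ x‖ / g x) ^ q) + ∫ x, q * s ^ (1 - q) * ‖gradient φ x‖ ^ q := by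
    rw [← integral_add (I4.const_mul _) (I5.const_mul _)]
    refine integral_mono I2 ((I4.const_mul _).add (I5.const_mul _)) fun x => ?_
    by_cases hx : x ∈ K
    · have hgx := hgpK x hx
      have h1 : fderiv ℝ (fun y => ‖φ y‖ ^ q) x e ≤ q * ‖φ x‖ ^ (q - 1) * ‖gradient φ x‖ := by
        refine (le_abs_self _).trans
          (((fderiv ℝ (fun y => ‖φ y‖ ^ q) x).le_opNorm e).trans ?_)
        have h2 := norm_fderiv_norm_rpow_le (x := x) (hφ1.differentiable one_ne_zero) hq
        rw [norm_gradient]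
        have h3 : ‖fderiv ℝ (fun y => ‖φ y‖ ^ q) x‖ * ‖e‖
            ≤ ‖fderiv ℝ (fun y => ‖φ y‖ ^ q) x‖ * 1 := by gcongr
        linarith
      have h2 := rpow_mul_le_young hq hspos (X := ‖φ x‖ / g x) (by positivity)
        (norm_nonneg (gradient φ x))
      have h3 : (‖φ x‖ / g x) ^ (q - 1) = g x ^ (1 - q) * ‖φ x‖ ^ (q - 1) := by
        rw [Real.div_rpow (norm_nonneg _) hgx.le, show 1 - q = -(q - 1) by ring,
          Real.rpow_neg hgx.le, div_eq_mul_inv, mul_comm]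
      rw [h3] at h2
      have h4 := mul_le_mul_of_nonneg_left h1 (by positivity : 0 ≤ g x ^ (1 - q))
      have h5 := mul_le_mul_of_nonneg_left h2 hq0.le
      dsimp only
      linarith
    · have hx0 : gradient φ x = 0 := by
        simp only [gradient]
        rw [show fderiv ℝ φ x = 0 from image_eq_zero_of_notMem_tsupport fun h =>
          hx (tsupport_fderiv_subset ℝ h), map_zero]
      rw [hdψ0 x hx]
      simp [hφ0 x hx, hx0, Real.zero_rpow hq0.ne']
  rw [integral_const_mul, integral_const_mul] at L2
  rw [key] at L2
  have hqs : q * s = c * (q - 1) / 2 := by rw [hs]; field_simp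
  rw [hqs] at L2
  rw [div_mul_eq_mul_div, le_div_iff₀ (by positivity)]
  linarith

end Hardy

/-! ### Poincaré's inequality and Hardy's inequality at a boundary point -/

section Poincare

variable {n : ℕ} {Ω : Set (Euc n)} {p : ℝ≥0∞} [Fact (1 ≤ p)]

lemma IsTestFunction.gradient_eq_zero_of_notMem {φ : Euc n → ℝ} (hφ : IsTestFunction Ω φ)
    {x : Euc n} (hx : x ∉ Ω) : gradient φ x = 0 := by
  simp only [gradient]
  rw [hφ.fderiv_eq_zero_of_notMem hx, map_zero]

lemma setIntegral_norm_gradient_rpow {φ : Euc n → ℝ} (hφ : IsTestFunction Ω φ) {q : ℝ}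
    (hq : 0 < q) : ∫ x, ‖gradient φ x‖ ^ q = ∫ x in Ω, ‖gradient φ x‖ ^ q :=
  (setIntegral_eq_integral_of_forall_compl_eq_zero fun x hx => by
    simp [hφ.gradient_eq_zero_of_notMem hx, Real.zero_rpow hq.ne']).symm

lemma IsTestFunction.integrable_norm_gradient_rpow {φ : Euc n → ℝ} (hφ : IsTestFunction Ω φ)
    {q : ℝ} (hq : 0 < q) : Integrable fun x => ‖gradient φ x‖ ^ q :=
  (((continuous_gradient (hφ.contDiff.of_le (by simp))).norm.rpow_const
    fun _ => Or.inr hq.le)).integrable_of_hasCompactSupport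
    ((hasCompactSupport_gradient hφ.hasCompactSupport).comp_left (g := fun v => ‖v‖ ^ q)
      (by simp [Real.zero_rpow hq.ne']))

lemma IsTestFunction.integrable_norm_rpow {φ : Euc n → ℝ} (hφ : IsTestFunction Ω φ)
    {q : ℝ} (hq : 0 < q) : Integrable fun x => ‖φ x‖ ^ q :=
  ((hφ.contDiff.continuous.norm.rpow_const
    fun _ => Or.inr hq.le)).integrable_of_hasCompactSupport
    (hφ.hasCompactSupport.comp_left (g := fun v => ‖v‖ ^ q) (by simp [Real.zero_rpow hq.ne']))

/-- The Poincaré inequality for test functions in a bounded set. -/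
lemma exists_poincare_test (hn : 2 ≤ n) (hΩb : Bornology.IsBounded Ω) {q : ℝ} (hq : 1 < q) :
    ∃ C : ℝ, 0 ≤ C ∧ ∀ φ : Euc n → ℝ, IsTestFunction Ω φ →
      ∫ x, ‖φ x‖ ^ q ≤ C * ∫ x, ‖gradient φ x‖ ^ q := by
  have hq0 : 0 < q := by linarith
  obtain ⟨C, hC, hH⟩ := exists_hardy_const (n := n) hq one_pos
  obtain ⟨D, hD, hΩD⟩ := hΩb.subset_ball_lt 0 0
  let e : Euc n := EuclideanSpace.single ⟨0, by omega⟩ 1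
  have he : ‖e‖ = 1 := by simp [e]
  -- An affine weight with unit slope along `e` and values between `D` and `3 D` on `Ω`: Hardy's
  -- inequality for it is Poincaré's inequality.
  let g : Euc n → ℝ := fun x => ⟪e, x⟫ + 2 * D
  have hgc : ContDiff ℝ ∞ g := (contDiff_const.inner ℝ contDiff_id).add contDiff_const
  have hgd : ∀ x, HasFDerivAt g (innerSL ℝ e) x := fun x =>
    ((innerSL ℝ e).hasFDerivAt).add_const _
  have hgΩ : ∀ x ∈ Ω, D < g x ∧ g x < 3 * D := by
    intro x hx
    have h1 : ‖x‖ < D := by simpa using hΩD hx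
    have h2 := abs_real_inner_le_norm e x
    rw [he, one_mul, abs_le] at h2
    constructor <;> simp only [g] <;> linarith
  refine ⟨(3 * D) ^ q * C, by positivity, fun φ hφ => ?_⟩
  obtain ⟨hI, hle⟩ := hH {x | D < g x} g φ e (isOpen_lt continuous_const hgc.continuous)
    (hgc.of_le (by simp)).contDiffOn (fun x (hx : D < g x) => hD.trans hx)
    (fun x _ => by rw [(hgd x).fderiv, innerSL_apply_apply, real_inner_self_eq_norm_sq, he]; norm_num)
    he.le hφ.contDiff hφ.hasCompactSupport (fun x hx => (hgΩ x (hφ.tsupport_subset hx)).1)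
  have h1 : ∫ x, ‖φ x‖ ^ q ≤ ∫ x, (3 * D) ^ q * (‖φ x‖ / g x) ^ q := by
    refine integral_mono (hφ.integrable_norm_rpow hq0) (hI.const_mul _) fun x => ?_
    by_cases hx : x ∈ Ω
    · obtain ⟨h1, h2⟩ := hgΩ x hx
      have hgx : 0 < g x := hD.trans h1
      dsimp only
      rw [← Real.mul_rpow (by positivity) (by positivity)]
      refine Real.rpow_le_rpow (norm_nonneg _) ?_ hq0.le
      rw [← mul_div_assoc, le_div_iff₀ hgx, mul_comm]
      gcongr
    · simp [hφ.eq_zero_of_notMem hx, Real.zero_rpow hq0.ne']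
  rw [integral_const_mul] at h1
  rw [mul_assoc]
  exact h1.trans (mul_le_mul_of_nonneg_left hle (by positivity))

/-- The Poincaré inequality on `W^{1,p}_0(Ω)`. -/
lemma exists_poincare (hn : 2 ≤ n) (hΩb : Bornology.IsBounded Ω) (hp : 1 < p) (hp' : p ≠ ⊤) :
    ∃ C : ℝ, 0 ≤ C ∧ ∀ w ∈ W10 Ω p, ‖w.1.1‖ ≤ C * ‖grad w‖ := by
  have hq := one_lt_toReal hp hp'
  have hq0 : 0 < p.toReal := by linarith
  obtain ⟨C, hC, hP⟩ := exists_poincare_test hn hΩb hq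
  refine ⟨C ^ (p.toReal⁻¹), by positivity, fun w hw => ?_⟩
  have hcl : IsClosed {w : W1 Ω p | ‖w.1.1‖ ≤ C ^ (p.toReal⁻¹) * ‖grad w‖} :=
    isClosed_le continuous_fst_W1.norm (continuous_const.mul continuous_grad.norm)
  refine closure_minimal ?_ hcl hw
  rintro w ⟨φ, hφ, h1, h2⟩
  have e1 : ‖w.1.1‖ ^ p.toReal = ∫ x, ‖φ x‖ ^ p.toReal := by
    rw [Lp_norm_rpow_eq_integral hp hp']
    refine (integral_congr_ae ?_).trans (setIntegral_eq_integral_of_forall_compl_eq_zero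
      (s := Ω) fun x hx => ?_)
    · filter_upwards [h1] with x hx
      rw [hx]
    · simp [hφ.eq_zero_of_notMem hx, Real.zero_rpow hq0.ne']
  have e2 : ‖grad w‖ ^ p.toReal = ∫ x, ‖gradient φ x‖ ^ p.toReal := by
    rw [Lp_norm_rpow_eq_integral hp hp', setIntegral_norm_gradient_rpow hφ hq0]
    refine integral_congr_ae ?_
    filter_upwards [h2] with x hx
    rw [hx]
  have h3 := hP φ hφ
  rw [← e1, ← e2] at h3
  change ‖w.1.1‖ ≤ C ^ (p.toReal⁻¹) * ‖grad w‖
  rw [← Real.rpow_le_rpow_iff (norm_nonneg _) (by positivity) hq0,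
    Real.mul_rpow (by positivity) (norm_nonneg _), ← Real.rpow_mul hC, inv_mul_cancel₀ hq0.ne',
    Real.rpow_one]
  exact h3

/-- Hardy's inequality near a boundary point at which `Ω` lies in an open cone, for test
functions. -/
lemma exists_boundary_hardy_test (hn : 2 ≤ n) (hΩb : Bornology.IsBounded Ω) {q : ℝ}
    (hq : 1 < q) {x₀ e : Euc n} (hx₀ : x₀ ∉ Ω) (he : ‖e‖ = 1) {R : ℝ} (hR : 0 < R)
    (hcone : ∀ x ∈ Ω, ‖x - x₀‖ ≤ 2 * R → -(1 / 4) * ‖x - x₀‖ ≤ ⟪e, x - x₀⟫) :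
    ∃ C : ℝ, 0 ≤ C ∧ ∀ φ : Euc n → ℝ, IsTestFunction Ω φ →
      Integrable (fun x => (Metric.ball x₀ R).indicator (fun x => (‖x - x₀‖⁻¹) ^ q) x
        * ‖φ x‖ ^ q) ∧
      ∫ x, (Metric.ball x₀ R).indicator (fun x => (‖x - x₀‖⁻¹) ^ q) x * ‖φ x‖ ^ q
        ≤ C * ∫ x, ‖gradient φ x‖ ^ q := by
  have hq0 : 0 < q := by linarith
  obtain ⟨C, hC, hH⟩ := exists_hardy_const (n := n) hq (c := 1 / 2) (by norm_num)
  obtain ⟨C', hC', hP⟩ := exists_poincare_test hn hΩb hq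
  -- The cone condition is known only within distance `2 R` of `x₀`. The extra term `φ ∇χ` is paid
  -- for by Poincaré's inequality.
  let χ : ContDiffBump x₀ := ⟨R, 2 * R, hR, by linarith⟩
  have hχ : IsMultiplier (χ : Euc n → ℝ) :=
    IsMultiplier.of_hasCompactSupport χ.contDiff χ.hasCompactSupport
  obtain ⟨B, hB⟩ := hχ.bdd_gradient
  have hB0 : 0 ≤ B := (norm_nonneg _).trans (hB x₀)
  -- The cone condition gives `g ≥ ‖x - x₀‖ / 4` on `Ω` near `x₀`, the slope of `g` along `e` is at
  -- least `1 - 1 / 2`, and `g ≤ (3 / 2) ‖x - x₀‖`. So the weight `1 / g` dominates a multiple of `1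
  -- / ‖x - x₀‖`, for every exponent, including `q = n`.
  let g : Euc n → ℝ := fun x => ⟪e, x - x₀⟫ + 1 / 2 * ‖x - x₀‖
  let U : Set (Euc n) := {x | x ≠ x₀ ∧ 0 < g x}
  have hgc : Continuous g := by fun_prop
  have hU : IsOpen U := isOpen_ne.inter (isOpen_lt continuous_const hgc)
  have hgU : ContDiffOn ℝ 1 g U := by
    intro x hx
    refine ContDiffAt.contDiffWithinAt (ContDiffAt.add ?_ (contDiffAt_const.mul ?_))
    · exact contDiffAt_const.inner ℝ (contDiffAt_id.sub contDiffAt_const)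
    · exact (contDiffAt_id.sub contDiffAt_const).norm ℝ (sub_ne_zero.2 hx.1)
  have hgd : ∀ x ∈ U, (1 / 2 : ℝ) ≤ fderiv ℝ g x e := by
    intro x hx
    have hx0 : x - x₀ ≠ 0 := sub_ne_zero.2 hx.1
    have h1 : HasFDerivAt (fun y => ⟪e, y - x₀⟫) (innerSL ℝ e) x :=
      (innerSL ℝ e).hasFDerivAt.comp x ((hasFDerivAt_id x).sub_const x₀)
    have hd : DifferentiableAt ℝ (fun y : Euc n => ‖y - x₀‖) x :=
      (differentiableAt_id.sub_const x₀).norm ℝ hx0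
    have h2 : |fderiv ℝ (fun y : Euc n => ‖y - x₀‖) x e| ≤ 1 := by
      have hl : LipschitzWith 1 (fun y : Euc n => ‖y - x₀‖) :=
        LipschitzWith.of_dist_le_mul fun y z => by
          have := abs_norm_sub_norm_le (y - x₀) (z - x₀)
          rw [sub_sub_sub_cancel_right] at this
          simpa [Real.dist_eq, dist_eq_norm] using this
      have h3 := norm_fderiv_le_of_lipschitz ℝ hl (x₀ := x)
      have h4 := (fderiv ℝ (fun y : Euc n => ‖y - x₀‖) x).le_opNorm e
      rw [he, mul_one] at h4
      exact h4.trans (by simpa using h3)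
    have h3 := (h1.add (hd.hasFDerivAt.const_mul (1 / 2))).fderiv
    change fderiv ℝ g x = _ at h3
    rw [h3]
    simp only [add_apply, smul_apply, smul_eq_mul, innerSL_apply_apply,
      real_inner_self_eq_norm_sq, he]
    have := (abs_le.1 h2).1
    linarith
  refine ⟨(3 / 2) ^ q * C * (2 ^ q * (1 + B ^ q * C')), by positivity, fun φ hφ => ?_⟩
  have hψ := hχ.mul_isTestFunction hφ
  have hts : tsupport (fun x => χ x * φ x) ⊆ U := by
    intro x hx
    have h1 : x ∈ Ω := hψ.tsupport_subset hx
    have h2 : x ∈ tsupport χ := tsupport_mul_subset_left hx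
    rw [χ.tsupport_eq, mem_closedBall_iff_norm] at h2
    have hne : x ≠ x₀ := fun h => hx₀ (h ▸ h1)
    have h3 := hcone x h1 h2
    have h4 : 0 < ‖x - x₀‖ := norm_pos_iff.2 (sub_ne_zero.2 hne)
    exact ⟨hne, by simp only [g]; linarith⟩
  obtain ⟨hI, hle⟩ := hH U g _ e hU hgU (fun x hx => hx.2) hgd he.le hψ.contDiff
    hψ.hasCompactSupport hts
  have hpt : ∀ x, (Metric.ball x₀ R).indicator (fun x => (‖x - x₀‖⁻¹) ^ q) x * ‖φ x‖ ^ q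
      ≤ (3 / 2) ^ q * (‖χ x * φ x‖ / g x) ^ q := by
    intro x
    by_cases hxt : x ∈ tsupport (fun x => χ x * φ x)
    · have hxU := hts hxt
      have hgx := hxU.2
      by_cases hxB : x ∈ Metric.ball x₀ R
      · have hχ1 : χ x = 1 := χ.one_of_mem_closedBall (Metric.ball_subset_closedBall hxB)
        have h4 : 0 < ‖x - x₀‖ := norm_pos_iff.2 (sub_ne_zero.2 hxU.1)
        rw [Set.indicator_of_mem hxB, hχ1, one_mul, ← Real.mul_rpow (by positivity)
          (by positivity), ← Real.mul_rpow (by positivity) (by positivity)]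
        refine Real.rpow_le_rpow (by positivity) ?_ hq0.le
        have h5 : g x ≤ 3 / 2 * ‖x - x₀‖ := by
          have := real_inner_le_norm e (x - x₀)
          rw [he, one_mul] at this
          simp only [g]; linarith
        rw [← mul_div_assoc, le_div_iff₀ hgx, inv_mul_eq_div, div_mul_eq_mul_div,
          div_le_iff₀ h4]
        nlinarith [norm_nonneg (φ x)]
      · rw [Set.indicator_of_notMem hxB, zero_mul]
        positivity
    · have h0 : χ x * φ x = 0 := 
        image_eq_zero_of_notMem_tsupport (f := fun x => χ x * φ x) hxt
      rw [h0, norm_zero, zero_div, Real.zero_rpow hq0.ne', mul_zero]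
      by_cases hxB : x ∈ Metric.ball x₀ R
      · rw [χ.one_of_mem_closedBall (Metric.ball_subset_closedBall hxB), one_mul] at h0
        simp [h0, Real.zero_rpow hq0.ne']
      · rw [Set.indicator_of_notMem hxB, zero_mul]
  have hnn : ∀ x, 0 ≤ (Metric.ball x₀ R).indicator (fun x => (‖x - x₀‖⁻¹) ^ q) x * ‖φ x‖ ^ q :=
    fun x => mul_nonneg (Set.indicator_nonneg (fun x _ => by positivity) x) (by positivity)
  have hmeas : Measurable fun x =>
      (Metric.ball x₀ R).indicator (fun x => (‖x - x₀‖⁻¹) ^ q) x * ‖φ x‖ ^ q := by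
    have : Measurable φ := hφ.contDiff.continuous.measurable
    refine Measurable.mul (Measurable.indicator (by fun_prop) Metric.isOpen_ball.measurableSet)
      (by fun_prop)
  have hInt := (hI.const_mul ((3 / 2) ^ q)).mono' hmeas.aestronglyMeasurable
    (Eventually.of_forall fun x => by rw [Real.norm_of_nonneg (hnn x)]; exact hpt x)
  refine ⟨hInt, (integral_mono hInt (hI.const_mul _) hpt).trans ?_⟩
  rw [integral_const_mul]
  have h1 : ∫ x, ‖gradient (fun x => χ x * φ x) x‖ ^ q
      ≤ 2 ^ q * ((∫ x, ‖gradient φ x‖ ^ q) + B ^ q * ∫ x, ‖φ x‖ ^ q) := by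
    have i1 := hφ.integrable_norm_gradient_rpow hq0
    have i2 := (hφ.integrable_norm_rpow hq0).const_mul (B ^ q)
    rw [← integral_const_mul (B ^ q), ← integral_add i1 i2, ← integral_const_mul]
    refine integral_mono (hψ.integrable_norm_gradient_rpow hq0) ((i1.add i2).const_mul _)
      fun x => ?_
    dsimp only
    rw [gradient_mul (hχ.contDiff.differentiable (by simp) x)
      (hφ.contDiff.differentiable (by simp) x)]
    refine (norm_add_rpow_le hq _ _).trans ?_
    rw [← Real.mul_rpow hB0 (norm_nonneg _), norm_smul, norm_smul, mul_comm ‖φ x‖]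
    gcongr
    · rw [Real.norm_of_nonneg χ.nonneg]
      exact mul_le_of_le_one_left (norm_nonneg _) χ.le_one
    · exact hB x
  have h2 := hP φ hφ
  have h3 : ∫ x, ‖gradient (fun x => χ x * φ x) x‖ ^ q
      ≤ 2 ^ q * (1 + B ^ q * C') * ∫ x, ‖gradient φ x‖ ^ q := by
    refine h1.trans ?_
    rw [mul_assoc]
    have := mul_le_mul_of_nonneg_left h2 (by positivity : 0 ≤ B ^ q)
    refine mul_le_mul_of_nonneg_left ?_ (by positivity)
    linarith
  have h4 := mul_le_mul_of_nonneg_left h3 hC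
  have h5 := mul_le_mul_of_nonneg_left (hle.trans h4) (by positivity : (0 : ℝ) ≤ (3 / 2) ^ q)
  linarith

/-- Hardy's inequality near a boundary point at which `Ω` lies in an open cone. -/
lemma exists_boundary_hardy (hn : 2 ≤ n) (hΩb : Bornology.IsBounded Ω) (hp : 1 < p) (hp' : p ≠ ⊤)
    {x₀ e : Euc n} (hx₀ : x₀ ∉ Ω) (he : ‖e‖ = 1) {R : ℝ} (hR : 0 < R)
    (hcone : ∀ x ∈ Ω, ‖x - x₀‖ ≤ 2 * R → -(1 / 4) * ‖x - x₀‖ ≤ ⟪e, x - x₀⟫) :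
    ∃ C : ℝ, 0 ≤ C ∧ ∀ w ∈ W10 Ω p,
      Integrable (fun x => (Metric.ball x₀ R).indicator (fun x => (‖x - x₀‖⁻¹) ^ p.toReal) x
        * ‖w.1.1 x‖ ^ p.toReal) (volume.restrict Ω) ∧
      ∫ x in Ω, (Metric.ball x₀ R).indicator (fun x => (‖x - x₀‖⁻¹) ^ p.toReal) x
        * ‖w.1.1 x‖ ^ p.toReal ≤ C * ‖grad w‖ ^ p.toReal := by
  have hq := one_lt_toReal hp hp'
  have hq0 : 0 < p.toReal := by linarith
  obtain ⟨C, hC, hH⟩ := exists_boundary_hardy_test hn hΩb hq hx₀ he hR hcone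
  refine ⟨C, hC, fun w hw => ?_⟩
  obtain ⟨W, hW, hWw⟩ := exists_seq_testSubspace hw
  have hmeas : Measurable fun x : Euc n =>
      (Metric.ball x₀ R).indicator (fun x => (‖x - x₀‖⁻¹) ^ p.toReal) x :=
    Measurable.indicator (by fun_prop) Metric.isOpen_ball.measurableSet
  have hlim : Tendsto (fun k => C * ‖grad (W k)‖ ^ p.toReal) atTop
      (𝓝 (C * ‖grad w‖ ^ p.toReal)) :=
    ((((continuous_grad.norm.tendsto w).comp hWw).rpow_const (Or.inr hq0.le))).const_mul C
  have hk : ∀ k, Integrable (fun x =>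
      (Metric.ball x₀ R).indicator (fun x => (‖x - x₀‖⁻¹) ^ p.toReal) x
        * ‖(W k).1.1 x‖ ^ p.toReal) (volume.restrict Ω) ∧
      ∫ x in Ω, (Metric.ball x₀ R).indicator (fun x => (‖x - x₀‖⁻¹) ^ p.toReal) x
        * ‖(W k).1.1 x‖ ^ p.toReal ≤ C * ‖grad (W k)‖ ^ p.toReal := by
    intro k
    obtain ⟨φ, hφ, h1, h2⟩ := hW k
    obtain ⟨hI, hle⟩ := hH φ hφ
    have hae : (fun x => (Metric.ball x₀ R).indicator (fun x => (‖x - x₀‖⁻¹) ^ p.toReal) x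
        * ‖φ x‖ ^ p.toReal) =ᵐ[volume.restrict Ω] (fun x =>
      (Metric.ball x₀ R).indicator (fun x => (‖x - x₀‖⁻¹) ^ p.toReal) x
        * ‖(W k).1.1 x‖ ^ p.toReal) := by
      filter_upwards [h1] with x hx
      rw [hx]
    refine ⟨(hI.restrict (s := Ω)).congr hae, ?_⟩
    rw [← integral_congr_ae hae, setIntegral_eq_integral_of_forall_compl_eq_zero fun x hx => by
      simp [hφ.eq_zero_of_notMem hx, Real.zero_rpow hq0.ne']]
    rw [setIntegral_norm_gradient_rpow hφ hq0] at hle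
    rw [Lp_norm_rpow_eq_integral hp hp']
    refine hle.trans_eq ?_
    congr 1
    refine integral_congr_ae ?_
    filter_upwards [h2] with x hx
    rw [hx]
  exact integral_mul_norm_rpow_le_of_tendsto hp hp' ((continuous_fst_W1.tendsto w).comp hWw)
    hmeas.aestronglyMeasurable (Eventually.of_forall fun x =>
      Set.indicator_nonneg (fun x _ => by positivity) x) hlim (fun k => (hk k).1)
    (fun k => (hk k).2)

end Poincare

end PLap

namespace PLap

/-! ### Well-posedness of the Dirichlet problem -/

section Abstract

variable {α E : Type*} [MeasurableSpace α] {μ : Measure α} [NormedAddCommGroup E]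
  [InnerProductSpace ℝ E]

lemma integral_uniform_convexity_combination {f g h : α → ℝ} (hf : Integrable f μ)
    (hg : Integrable g μ) (hh : Integrable h μ) (ε K : ℝ) :
    Integrable (fun x => ε * (f x + g x) + K * ((f x + g x) / 2 - h x)) μ ∧
    ∫ x, (ε * (f x + g x) + K * ((f x + g x) / 2 - h x)) ∂μ
      = ε * ((∫ x, f x ∂μ) + ∫ x, g x ∂μ)
        + K * (((∫ x, f x ∂μ) + ∫ x, g x ∂μ) / 2 - ∫ x, h x ∂μ) := by
  have hfg : Integrable (fun x => f x + g x) μ := hf.add hg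
  have h1 : Integrable (fun x => (f x + g x) / 2 - h x) μ := (hfg.div_const 2).sub hh
  refine ⟨(hfg.const_mul ε).add (h1.const_mul K), ?_⟩
  rw [integral_add (hfg.const_mul ε) (h1.const_mul K), integral_const_mul, integral_const_mul,
    integral_sub (hfg.div_const 2) hh, integral_div, integral_add hf hg]

/-- Dominated convergence: the flux is continuous even where `G` vanishes, and Young's inequality
bounds the integrand uniformly over step sizes at most one. It carries a sign found at `u + s φ`
back to `u`. -/
lemma tendsto_integral_flux {q : ℝ} (hq : 1 < q) {a : α → ℝ} {M : ℝ}
    (ha : AEStronglyMeasurable a μ) (haM : ∀ᵐ x ∂μ, |a x| ≤ M) {G H : α → E}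
    (hG : AEStronglyMeasurable G μ) (hH : AEStronglyMeasurable H μ)
    (iG : Integrable (fun x => ‖G x‖ ^ q) μ) (iH : Integrable (fun x => ‖H x‖ ^ q) μ) :
    Tendsto (fun k : ℕ => ∫ x, a x * ‖G x + (1 / ((k : ℝ) + 1)) • H x‖ ^ (q - 2)
      * ⟪G x + (1 / ((k : ℝ) + 1)) • H x, H x⟫ ∂μ) atTop
      (𝓝 (∫ x, a x * ‖G x‖ ^ (q - 2) * ⟪G x, H x⟫ ∂μ)) := by
  have hsmall : Tendsto (fun k : ℕ => 1 / ((k : ℝ) + 1)) atTop (𝓝 0) :=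
    tendsto_one_div_add_atTop_nhds_zero_nat
  have hc := continuous_norm_rpow_mul_inner (E := E) hq
  refine tendsto_integral_of_dominated_convergence
    (fun x => M * (2 ^ q * (‖G x‖ ^ q + ‖H x‖ ^ q) + ‖H x‖ ^ q)) ?_
    ((((iG.add iH).const_mul _).add iH).const_mul M) ?_ ?_
  · intro k
    simp_rw [mul_assoc]
    exact ha.mul (hc.comp_aestronglyMeasurable ((hG.add (hH.const_smul _)).prodMk hH))
  · intro k
    filter_upwards [haM] with x hx
    rw [mul_assoc, norm_mul]
    have hs1 : 1 / ((k : ℝ) + 1) ≤ 1 := by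
      rw [div_le_one (by positivity)]
      have : (0 : ℝ) ≤ k := Nat.cast_nonneg k
      linarith
    refine mul_le_mul hx ?_ (norm_nonneg _) ((abs_nonneg _).trans hx)
    refine (abs_norm_rpow_mul_inner_le hq _ _).trans ?_
    refine (rpow_mul_le_young hq one_pos (norm_nonneg _) (norm_nonneg _)).trans ?_
    rw [one_mul, Real.one_rpow, one_mul]
    have h5 := norm_add_rpow_le hq (G x) ((1 / ((k : ℝ) + 1)) • H x)
    have h6 : ‖(1 / ((k : ℝ) + 1)) • H x‖ ^ q ≤ ‖H x‖ ^ q := by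
      refine Real.rpow_le_rpow (norm_nonneg _) ?_ (by linarith)
      rw [norm_smul, Real.norm_of_nonneg (by positivity)]
      exact mul_le_of_le_one_left (norm_nonneg _) hs1
    have h7 : (2 : ℝ) ^ q * (‖G x‖ ^ q + ‖(1 / ((k : ℝ) + 1)) • H x‖ ^ q)
        ≤ 2 ^ q * (‖G x‖ ^ q + ‖H x‖ ^ q) := by gcongr
    linarith
  · refine Eventually.of_forall fun x => ?_
    simp_rw [mul_assoc]
    refine Tendsto.const_mul _ ?_
    have ht : Tendsto (fun k : ℕ => (G x + (1 / ((k : ℝ) + 1)) • H x, H x))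
        atTop (𝓝 (G x, H x)) := by
      refine Tendsto.prodMk_nhds ?_ tendsto_const_nhds
      simpa using (hsmall.smul_const (H x)).const_add (G x)
    have h9 := (hc.tendsto (G x, H x)).comp ht
    simp only [Function.comp_def] at h9
    exact h9

/-- Here `e` stands for the energies of a minimizing sequence, `E₀` for their limit and `d` for the
distances of gradients. First `ε` makes the first term at most half of `m δ ^ q`; this fixes `K`;
then `N` makes the convexity defect term at most a quarter. -/
lemma exists_forall_lt_of_uniform_convexity {e : ℕ → ℝ} {E₀ m q : ℝ} {d : ℕ → ℕ → ℝ}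
    (hq : 0 < q) (hm : 0 < m) (hE0 : 0 ≤ E₀) (hlim : Tendsto e atTop (𝓝 E₀))
    (hd : ∀ k l, 0 ≤ d k l)
    (hpair : ∀ ε > 0, ∃ K, 0 ≤ K ∧ ∀ k l, m * d k l ^ q
      ≤ ε * (e k + e l) + K * ((e k + e l) / 2 - E₀)) {δ : ℝ} (hδ : 0 < δ) :
    ∃ N, ∀ k ≥ N, d k N < δ := by
  have hδq : 0 < m * δ ^ q := by positivity
  set ε : ℝ := m * δ ^ q / (4 * (E₀ + 1)) with hε
  have hεpos : 0 < ε := by positivity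
  obtain ⟨K, hK, hKle⟩ := hpair ε hεpos
  set η : ℝ := min 1 (m * δ ^ q / (4 * (K + 1))) with hη
  have hηpos : 0 < η := by positivity
  obtain ⟨N, hN⟩ := eventually_atTop.1
    (hlim.eventually (gt_mem_nhds (lt_add_of_pos_right E₀ hηpos)))
  refine ⟨N, fun k hk => ?_⟩
  have h1 := hKle k N
  have h2 := hN k hk
  have h3 := hN N le_rfl
  have hη1 : η ≤ 1 := min_le_left _ _
  have hη2 : η ≤ m * δ ^ q / (4 * (K + 1)) := min_le_right _ _
  have h4 : ε * (e k + e N) ≤ m * δ ^ q / 2 := by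
    have : ε * (e k + e N) ≤ ε * (2 * (E₀ + 1)) := by
      refine mul_le_mul_of_nonneg_left ?_ hεpos.le
      linarith
    refine this.trans_eq ?_
    rw [hε]
    field_simp
    norm_num
  have h5 : K * ((e k + e N) / 2 - E₀) ≤ m * δ ^ q / 4 := by
    have e1 : K * ((e k + e N) / 2 - E₀) ≤ K * η :=
      mul_le_mul_of_nonneg_left (by linarith) hK
    rw [le_div_iff₀ (by positivity)] at hη2
    linarith
  have h6 : m * d k N ^ q < m * δ ^ q := by linarith
  exact (Real.rpow_lt_rpow_iff (hd _ _) hδ.le hq).1 (lt_of_mul_lt_mul_left h6 hm.le)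

/-- `A` and `B` are the energies at `u + s φ` and at `u`; `Q` and `P` are the pairings of `u + s φ`
with `u` and with `φ`. -/
lemma nonneg_of_convexity_bound {q s P Q A B : ℝ} (hq : 1 < q) (hs : 0 < s)
    (h : q * Q ≤ (q - 1) * A + B) (hA : A = Q + s * P) (hB : B ≤ A) : 0 ≤ P := by
  have h5 : 0 ≤ q * s * P := by
    have : q * Q = q * A - q * s * P := by rw [hA]; ring
    linarith
  exact nonneg_of_mul_nonneg_right h5 (by positivity)

end Abstract

/-! ### The direct method and the Dirichlet-to-Neumann map -/

section Dirichlet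

variable {n : ℕ} {Ω : Set (Euc n)} {p : ℝ≥0∞} [Fact (1 ≤ p)] {γ : Euc n → ℝ} {m M : ℝ}

lemma IsElliptic.energy_nonneg (h : IsElliptic Ω γ m M) (u : W1 Ω p) : 0 ≤ energy γ u := by
  refine integral_nonneg_of_ae ?_
  filter_upwards [h.ae_mem] with x hx
  have := h.pos.le.trans (h.lower x hx)
  simp only [Pi.zero_apply]
  positivity

-- Using convexity at `u + s φ` instead of at `u` gives the first-order condition without
-- differentiating the energy.
set_option maxHeartbeats 1000000 in
lemma IsElliptic.pairing_nonneg_of_energy_le (h : IsElliptic Ω γ m M) (hp : 1 < p)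
    (hp' : p ≠ ⊤) {u φ : W1 Ω p} {s : ℝ} (hs : 0 < s)
    (hu : energy γ u ≤ energy γ (u + s • φ)) : 0 ≤ pairing γ (u + s • φ) φ := by
  have h4 := (pairing_self hp hp' γ (u + s • φ)).symm.trans
    ((h.pairing_add hp hp' (u + s • φ) u (s • φ)).trans
      (congrArg (pairing γ (u + s • φ) u + ·) (pairing_smul γ (u + s • φ) φ s)))
  exact nonneg_of_convexity_bound (one_lt_toReal hp hp') hs
    (h.mul_pairing_le hp hp' (u + s • φ) u) h4 hu

/-- Minimizers of the energy are weak solutions. -/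
lemma IsElliptic.isWeakSolution_of_forall_energy_le (h : IsElliptic Ω γ m M) (hp : 1 < p)
    (hp' : p ≠ ⊤) {u : W1 Ω p} (hu : ∀ φ ∈ W10 Ω p, energy γ u ≤ energy γ (u + φ)) :
    IsWeakSolution γ u := by
  have hq := one_lt_toReal hp hp'
  have key : ∀ φ ∈ W10 Ω p, 0 ≤ pairing γ u φ := by
    intro φ hφ
    have h1 : ∀ k : ℕ, 0 ≤ pairing γ (u + (1 / ((k : ℝ) + 1)) • φ) φ := fun k =>
      h.pairing_nonneg_of_energy_le hp hp' (by positivity)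
        (hu _ (Submodule.smul_mem _ (1 / ((k : ℝ) + 1)) hφ))
    have hlim : Tendsto (fun k : ℕ => pairing γ (u + (1 / ((k : ℝ) + 1)) • φ) φ) atTop
        (𝓝 (pairing γ u φ)) := by
      refine (tendsto_integral_flux hq h.aestronglyMeasurable h.ae_abs_le
        (Lp.aestronglyMeasurable (grad u)) (Lp.aestronglyMeasurable (grad φ))
        (Lp_integrable_norm_rpow hp hp' _) (Lp_integrable_norm_rpow hp hp' _)).congr fun k => ?_
      refine integral_congr_ae ?_
      filter_upwards [grad_add_ae u ((1 / ((k : ℝ) + 1)) • φ),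
        grad_smul_ae (1 / ((k : ℝ) + 1)) φ] with x hx hx'
      rw [hx, hx']
    exact ge_of_tendsto' hlim h1
  intro φ hφ
  refine le_antisymm ?_ (key φ hφ)
  have h1 := key _ (Submodule.smul_mem _ (-1) hφ)
  rw [pairing_smul] at h1
  linarith

/-- Minimizing sequences with fixed boundary values have Cauchy gradients. -/
lemma IsElliptic.cauchySeq_grad (h : IsElliptic Ω γ m M) (hp : 1 < p) (hp' : p ≠ ⊤)
    {V : ℕ → W1 Ω p} {E₀ : ℝ} (hlim : Tendsto (fun k => energy γ (V k)) atTop (𝓝 E₀))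
    (hmid : ∀ k l, E₀ ≤ energy γ ((1 / 2 : ℝ) • (V k + V l))) :
    CauchySeq fun k => grad (V k) := by
  have hq := one_lt_toReal hp hp'
  have hq0 : 0 < p.toReal := by linarith
  have hm := h.pos
  have hE0 : 0 ≤ E₀ := ge_of_tendsto' hlim fun k => h.energy_nonneg _
  have hpair : ∀ ε > 0, ∃ K, 0 ≤ K ∧ ∀ k l, m * ‖grad (V k) - grad (V l)‖ ^ p.toReal
      ≤ ε * (energy γ (V k) + energy γ (V l))
        + K * ((energy γ (V k) + energy γ (V l)) / 2 - E₀) := by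
    intro ε hε
    obtain ⟨K, hK, hKle⟩ := exists_norm_sub_rpow_le (E := Euc n) hq hε
    refine ⟨K, hK, fun k l => ?_⟩
    have i1 := h.integrable_energy hp hp' (V k)
    have i2 := h.integrable_energy hp hp' (V l)
    have i3 := h.integrable_energy hp hp' ((1 / 2 : ℝ) • (V k + V l))
    have h1 := (h.energy_mono hp hp' (V k - V l)).1
    rw [grad_sub] at h1
    have h2 : energy γ (V k - V l) ≤ ε * (energy γ (V k) + energy γ (V l))
        + K * ((energy γ (V k) + energy γ (V l)) / 2
          - energy γ ((1 / 2 : ℝ) • (V k + V l))) := by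
      unfold energy
      obtain ⟨i4, e4⟩ := integral_uniform_convexity_combination i1 i2 i3 ε K
      rw [← e4]
      refine integral_mono_ae (h.integrable_energy hp hp' _) i4 ?_
      filter_upwards [h.ae_mem, grad_sub_ae (V k) (V l), grad_smul_ae (1 / 2 : ℝ) (V k + V l),
        grad_add_ae (V k) (V l)] with x hx h3 h4 h5
      have h6 := mul_le_mul_of_nonneg_left (hKle (grad (V k) x) (grad (V l) x))
        (hm.le.trans (h.lower x hx))
      rw [h3, h4, h5]
      linarith
    have h3 := mul_le_mul_of_nonneg_left (hmid k l) hK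
    linarith
  rw [Metric.cauchySeq_iff']
  intro δ hδ
  simp only [dist_eq_norm]
  exact exists_forall_lt_of_uniform_convexity hq0 hm hE0 hlim (fun k l => norm_nonneg _) hpair hδ

/-- Solvability of the Dirichlet problem. -/
lemma IsElliptic.exists_isWeakSolution (h : IsElliptic Ω γ m M) (hn : 2 ≤ n)
    (hΩb : Bornology.IsBounded Ω) (hp : 1 < p) (hp' : p ≠ ⊤) (v : W1 Ω p) :
    ∃ u : W1 Ω p, IsWeakSolution γ u ∧ u - v ∈ W10 Ω p := by
  obtain ⟨C, hC, hP⟩ := exists_poincare (p := p) hn hΩb hp hp'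
  let S : Set ℝ := (fun w : W1 Ω p => energy γ (v + w)) '' (W10 Ω p)
  have hSb : BddBelow S := ⟨0, by rintro _ ⟨w, _, rfl⟩; exact h.energy_nonneg _⟩
  have hSn : S.Nonempty := ⟨_, 0, (W10 Ω p).zero_mem, rfl⟩
  obtain ⟨s, -, hs, hsS⟩ := exists_seq_tendsto_sInf hSn hSb
  choose w hw hws using hsS
  have hinf : ∀ z ∈ W10 Ω p, sInf S ≤ energy γ (v + z) := fun z hz => csInf_le hSb ⟨z, hz, rfl⟩
  have hcg : CauchySeq fun k => grad (v + w k) := by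
    refine h.cauchySeq_grad hp hp' (E₀ := sInf S) ?_ ?_
    · exact hs.congr fun k => (hws k).symm
    · intro k l
      have : (1 / 2 : ℝ) • (v + w k + (v + w l)) = v + (1 / 2 : ℝ) • (w k + w l) := by module
      rw [this]
      exact hinf _ (Submodule.smul_mem _ _ (Submodule.add_mem _ (hw k) (hw l)))
  -- The differences lie in `W10 Ω p`, so Poincaré's inequality upgrades Cauchy gradients to a
  -- Cauchy sequence in the Sobolev norm.
  have hcw : CauchySeq w := by
    rw [Metric.cauchySeq_iff'] at hcg ⊢
    intro ε hε
    obtain ⟨N, hN⟩ := hcg (ε / (C + 1)) (by positivity)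
    refine ⟨N, fun k hk => ?_⟩
    have h1 := hN k hk
    rw [dist_eq_norm, ← grad_sub, add_sub_add_left_eq_sub, lt_div_iff₀ (by positivity)] at h1
    have h2 := hP _ (Submodule.sub_mem _ (hw k) (hw N))
    rw [dist_eq_norm]
    change max ‖(w k - w N).1.1‖ ‖grad (w k - w N)‖ < ε
    have h3 := norm_nonneg (grad (w k - w N))
    refine max_lt ?_ ?_ <;> nlinarith
  obtain ⟨w₀, hw₀⟩ := cauchySeq_tendsto_of_complete hcw
  have hw₀m : w₀ ∈ W10 Ω p :=
    (Submodule.isClosed_topologicalClosure _).mem_of_tendsto hw₀ (Eventually.of_forall hw)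
  have hle : energy γ (v + w₀) ≤ sInf S := by
    have ht : Tendsto (fun k => grad (v + w k)) atTop (𝓝 (grad (v + w₀))) :=
      (continuous_grad.tendsto _).comp (hw₀.const_add v)
    refine (integral_mul_norm_rpow_le_of_tendsto hp hp' ht h.aestronglyMeasurable ?_ hs
      (fun k => h.integrable_energy hp hp' _) (fun k => (hws k).le)).2
    filter_upwards [h.ae_mem] with x hx
    exact h.pos.le.trans (h.lower x hx)
  refine ⟨v + w₀, h.isWeakSolution_of_forall_energy_le hp hp' fun φ hφ => ?_, by simpa⟩
  rw [add_assoc]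
  exact hle.trans (hinf _ (Submodule.add_mem _ hw₀m hφ))

lemma continuous_of_forall_norm_le_one {V : Type*} [NormedAddCommGroup V] [NormedSpace ℝ V]
    (f : V →ₗ[ℝ] ℝ) {C : ℝ} (hf : ∀ v, ‖v‖ ≤ 1 → |f v| ≤ C) : Continuous f := by
  refine AddMonoidHomClass.continuous_of_bound f C fun v => ?_
  rcases eq_or_ne v 0 with rfl | hv
  · simp
  have hv' : 0 < ‖v‖ := norm_pos_iff.2 hv
  have h1 := hf (‖v‖⁻¹ • v) (by rw [norm_smul, norm_inv, norm_norm, inv_mul_cancel₀ hv'.ne'])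
  rw [map_smul, smul_eq_mul, abs_mul, abs_of_pos (by positivity), inv_mul_le_iff₀ hv'] at h1
  rw [Real.norm_eq_abs]
  linarith

/-- A weak solution has a boundary current. -/
lemma IsElliptic.exists_isBoundaryCurrent (h : IsElliptic Ω γ m M) (hp : 1 < p) (hp' : p ≠ ⊤)
    {u : W1 Ω p} (hu : IsWeakSolution γ u) :
    ∃ ℓ, IsBoundaryCurrent γ (trace Ω p u) ℓ := by
  have hq := one_lt_toReal hp hp'
  let f : W1 Ω p →ₗ[ℝ] ℝ :=
    { toFun := pairing γ u
      map_add' := h.pairing_add hp hp' u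
      map_smul' := fun c v => pairing_smul γ u v c }
  have hcont : Continuous f := by
    refine continuous_of_forall_norm_le_one f
      (C := ((p.toReal - 1) * energy γ u + |M|) / p.toReal) fun v hv => ?_
    rw [le_div_iff₀ (by linarith), mul_comm]
    refine (h.abs_pairing_le hp hp' u v).trans ?_
    have h1 := (h.energy_mono hp hp' v).2
    have h2 : ‖grad v‖ ≤ 1 := (norm_snd_le v.1).trans hv
    have h3 : ‖grad v‖ ^ p.toReal ≤ 1 := Real.rpow_le_one (norm_nonneg _) h2 (by linarith)
    have h4 : M * ‖grad v‖ ^ p.toReal ≤ |M| * 1 :=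
      mul_le_mul (le_abs_self M) h3 (by positivity) (abs_nonneg M)
    linarith
  let F : W1 Ω p →L[ℝ] ℝ := ⟨f, hcont⟩
  exact ⟨(W10 Ω p).liftQL F fun φ hφ => hu φ hφ, u, hu, rfl, fun g => rfl⟩

/-- The defining property of the Dirichlet-to-Neumann map. -/
lemma IsElliptic.isBoundaryCurrent_dnMap (h : IsElliptic Ω γ m M) (hn : 2 ≤ n)
    (hΩb : Bornology.IsBounded Ω) (hp : 1 < p) (hp' : p ≠ ⊤) (v : W1 Ω p) :
    IsBoundaryCurrent γ (trace Ω p v) (dnMap Ω p γ (trace Ω p v)) := by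
  obtain ⟨u, hu, huv⟩ := h.exists_isWeakSolution hn hΩb hp hp' v
  have ht : trace Ω p u = trace Ω p v := (Submodule.Quotient.eq _).2 huv
  have hex : ∃ ℓ, IsBoundaryCurrent γ (trace Ω p v) ℓ :=
    ht ▸ h.exists_isBoundaryCurrent hp hp' hu
  rw [dnMap, dif_pos hex]
  exact hex.choose_spec

/-- Equality of the Dirichlet-to-Neumann maps implies that the energies of a `γ₁`-solution
compare. -/
lemma exists_isWeakSolution_of_dnMap_eq {γ₁ γ₂ : Euc n → ℝ} {m₁ M₁ m₂ M₂ : ℝ}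
    (h₁ : IsElliptic Ω γ₁ m₁ M₁) (h₂ : IsElliptic Ω γ₂ m₂ M₂) (hn : 2 ≤ n)
    (hΩb : Bornology.IsBounded Ω) (hp : 1 < p) (hp' : p ≠ ⊤)
    (hΛ : dnMap Ω p γ₁ = dnMap Ω p γ₂) (v : W1 Ω p) :
    ∃ u : W1 Ω p, IsWeakSolution γ₁ u ∧ u - v ∈ W10 Ω p ∧ energy γ₁ u ≤ energy γ₂ u := by
  obtain ⟨u₁, hu₁, ht₁, hℓ₁⟩ := h₁.isBoundaryCurrent_dnMap hn hΩb hp hp' v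
  obtain ⟨u₂, hu₂, ht₂, hℓ₂⟩ := h₂.isBoundaryCurrent_dnMap hn hΩb hp hp' v
  -- A solution's energy is its current paired with its own boundary value, hence `u₁` and `u₂` have
  -- equal energies; minimality of `u₂` for `γ₂` finishes.
  have e1 : energy γ₁ u₁ = dnMap Ω p γ₁ (trace Ω p v) (trace Ω p v) := by
    rw [← pairing_self hp hp', ← hℓ₁, ht₁]
  have e2 : energy γ₂ u₂ = dnMap Ω p γ₂ (trace Ω p v) (trace Ω p v) := by
    rw [← pairing_self hp hp', ← hℓ₂, ht₂]
  refine ⟨u₁, hu₁, (Submodule.Quotient.eq _).1 ht₁, ?_⟩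
  rw [e1, hΛ, ← e2]
  exact h₂.energy_le_of_isWeakSolution hp hp' hu₂
    ((Submodule.Quotient.eq _).1 (ht₁.trans ht₂.symm))

end Dirichlet

end PLap

namespace PLap

/-! ### The geometry of `Ω` near a boundary point -/

section Geometry

variable {n : ℕ} {Ω : Set (Euc n)}

/-- The complement of the line through `e` has dimension at least `n - 1 ≥ 1`. With `e` the inner
normal, `τ` is the tangential slope of the boundary data. -/
lemma exists_unit_orthogonal (hn : 2 ≤ n) (e : Euc n) : ∃ τ : Euc n, ‖τ‖ = 1 ∧ ⟪e, τ⟫ = 0 := by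
  have h1 := Submodule.finrank_add_finrank_orthogonal (ℝ ∙ e)
  rw [finrank_euclideanSpace_fin] at h1
  have h2 : Module.finrank ℝ (ℝ ∙ e) ≤ 1 := by
    simpa using finrank_span_le_card (R := ℝ) ({e} : Set (Euc n))
  have h3 : 0 < Module.finrank ℝ (ℝ ∙ e)ᗮ := by omega
  have : Nontrivial (ℝ ∙ e)ᗮ := Module.finrank_pos_iff.1 h3
  obtain ⟨v, hv⟩ := exists_ne (0 : (ℝ ∙ e)ᗮ)
  have hv0 : (v : Euc n) ≠ 0 := fun h => hv (Subtype.ext h)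
  have hev : ⟪e, (v : Euc n)⟫ = 0 := Submodule.mem_orthogonal_singleton_iff_inner_right.1 v.2
  refine ⟨‖(v : Euc n)‖⁻¹ • (v : Euc n), ?_, by rw [inner_smul_right, hev, mul_zero]⟩
  rw [norm_smul, norm_inv, norm_norm, inv_mul_cancel₀ (norm_ne_zero_iff.2 hv0)]

/-- Near a boundary point `x₀`, `Ω` is close to a half-space with inner normal `e`. -/
lemma HasC1Boundary.exists_normal (hΩ : IsOpen Ω) (hΩc : HasC1Boundary Ω) {x₀ : Euc n}
    (hx₀ : x₀ ∈ frontier Ω) :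
    ∃ e : Euc n, ‖e‖ = 1 ∧
      (∀ κ > 0, ∃ R > 0, ∀ x ∈ Ω, ‖x - x₀‖ ≤ R → -κ * ‖x - x₀‖ ≤ ⟪e, x - x₀⟫) ∧
      (∀ κ > 0, ∃ R > 0, ∀ x, ‖x - x₀‖ ≤ R → κ * ‖x - x₀‖ < ⟪e, x - x₀⟫ → x ∈ Ω) := by
  obtain ⟨U, ρ, hU, hxU, hρ, hdρ, hΩU⟩ := hΩc x₀ hx₀
  have hρc : ContinuousAt ρ x₀ := (hρ.contDiffAt (hU.mem_nhds hxU)).continuousAt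
  have hρd : HasFDerivAt ρ (fderiv ℝ ρ x₀) x₀ :=
    ((hρ.contDiffAt (hU.mem_nhds hxU)).differentiableAt one_ne_zero).hasFDerivAt
  have hmem : ∀ y ∈ U, (y ∈ Ω ↔ 0 < ρ y) := fun y hy =>
    ⟨fun h => ((Set.ext_iff.1 hΩU y).1 ⟨h, hy⟩).2, fun h => ((Set.ext_iff.1 hΩU y).2 ⟨hy, h⟩).1⟩
  have hx₀Ω : x₀ ∉ Ω := by
    rw [hΩ.frontier_eq] at hx₀
    exact hx₀.2
  -- A positive value would put `x₀` in `Ω`; a negative one would keep `Ω` away from `x₀`.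
  have hρ0 : ρ x₀ = 0 := by
    refine le_antisymm (not_lt.1 fun h => hx₀Ω ((hmem _ hxU).2 h)) (not_lt.1 fun h => ?_)
    have h1 : ∀ᶠ y in 𝓝 x₀, ρ y < 0 ∧ y ∈ U :=
      (hρc.eventually (gt_mem_nhds h)).and (hU.mem_nhds hxU)
    obtain ⟨y, hy, hyΩ⟩ := mem_closure_iff_nhds.1 (frontier_subset_closure hx₀) _ h1
    exact absurd ((hmem y hy.2).1 hyΩ) (not_lt.2 hy.1.le)
  set ν : Euc n := gradient ρ x₀ with hν
  have hν0 : 0 < ‖ν‖ := by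
    rw [hν, norm_gradient]
    exact norm_pos_iff.2 (hdρ x₀ hxU)
  -- First-order Taylor expansion, with the error measured in units of `‖ν‖` so that normalizing the
  -- gradient leaves exactly `κ`.
  have hest : ∀ κ > 0, ∃ R > 0, ∀ x, ‖x - x₀‖ ≤ R →
      x ∈ U ∧ |ρ x - ⟪ν, x - x₀⟫| ≤ κ * ‖ν‖ * ‖x - x₀‖ := by
    intro κ hκ
    have h1 := (hasFDerivAt_iff_isLittleO.1 hρd).def (by positivity : 0 < κ * ‖ν‖)
    obtain ⟨R, hR, hRs⟩ := Metric.eventually_nhds_iff_ball.1 (h1.and (hU.mem_nhds hxU))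
    refine ⟨R / 2, by positivity, fun x hx => ?_⟩
    obtain ⟨h2, h3⟩ := hRs x (by rw [mem_ball_iff_norm]; linarith)
    rw [hρ0, sub_zero, Real.norm_eq_abs] at h2
    rw [hν, inner_gradient_left]
    exact ⟨h3, h2⟩
  have hinner : ∀ y : Euc n, ⟪‖ν‖⁻¹ • ν, y⟫ = ‖ν‖⁻¹ * ⟪ν, y⟫ := fun y => by
    rw [real_inner_smul_left]
  refine ⟨‖ν‖⁻¹ • ν, by rw [norm_smul, norm_inv, norm_norm, inv_mul_cancel₀ hν0.ne'], ?_, ?_⟩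
  · intro κ hκ
    obtain ⟨R, hR, h⟩ := hest κ hκ
    refine ⟨R, hR, fun x hx hxR => ?_⟩
    obtain ⟨hxU, h1⟩ := h x hxR
    have h2 := (hmem x hxU).1 hx
    have h3 := (abs_le.1 h1).2
    rw [hinner, le_inv_mul_iff₀ hν0]
    linarith
  · intro κ hκ
    obtain ⟨R, hR, h⟩ := hest κ hκ
    refine ⟨R, hR, fun x hxR hx => ?_⟩
    obtain ⟨hxU, h1⟩ := h x hxR
    rw [hinner, lt_inv_mul_iff₀ hν0] at hx
    have h3 := (abs_le.1 h1).1
    refine (hmem x hxU).2 ?_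
    linarith

/-- The blow-ups of `Ω` at `x₀` converge to the half-space. -/
lemma eventually_add_smul_mem {x₀ e : Euc n}
    (h : ∀ κ > 0, ∃ R > 0, ∀ x, ‖x - x₀‖ ≤ R → κ * ‖x - x₀‖ < ⟪e, x - x₀⟫ → x ∈ Ω)
    {y : Euc n} (hy : 0 < ⟪e, y⟫) : ∀ᶠ δ : ℝ in 𝓝[>] 0, x₀ + δ • y ∈ Ω := by
  obtain ⟨R, hR, hΩ⟩ := h (⟪e, y⟫ / (2 * (‖y‖ + 1))) (by positivity)
  have h1 : ∀ᶠ δ : ℝ in 𝓝[>] 0, δ < R / (‖y‖ + 1) :=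
    nhdsWithin_le_nhds (gt_mem_nhds (by positivity))
  filter_upwards [h1, self_mem_nhdsWithin] with δ hδ hδ0
  rw [Set.mem_Ioi] at hδ0
  rw [lt_div_iff₀ (by positivity)] at hδ
  have hnorm : ‖δ • y‖ = δ * ‖y‖ := by rw [norm_smul, Real.norm_of_nonneg hδ0.le]
  refine hΩ _ ?_ ?_
  · rw [add_sub_cancel_left, hnorm]
    nlinarith
  · rw [add_sub_cancel_left, hnorm, inner_smul_right, div_mul_eq_mul_div, div_lt_iff₀
      (by positivity)]
    have : 0 < δ * ⟪e, y⟫ := by positivity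
    nlinarith [norm_nonneg y]

lemma eventually_add_smul_notMem {x₀ e : Euc n}
    (h : ∀ κ > 0, ∃ R > 0, ∀ x ∈ Ω, ‖x - x₀‖ ≤ R → -κ * ‖x - x₀‖ ≤ ⟪e, x - x₀⟫)
    {y : Euc n} (hy : ⟪e, y⟫ < 0) : ∀ᶠ δ : ℝ in 𝓝[>] 0, x₀ + δ • y ∉ Ω := by
  have hy' : 0 < -⟪e, y⟫ := by linarith
  obtain ⟨R, hR, hΩ⟩ := h (-⟪e, y⟫ / (2 * (‖y‖ + 1))) (by positivity)
  have h1 : ∀ᶠ δ : ℝ in 𝓝[>] 0, δ < R / (‖y‖ + 1) :=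
    nhdsWithin_le_nhds (gt_mem_nhds (by positivity))
  filter_upwards [h1, self_mem_nhdsWithin] with δ hδ hδ0 hmem
  rw [Set.mem_Ioi] at hδ0
  rw [lt_div_iff₀ (by positivity)] at hδ
  have hnorm : ‖δ • y‖ = δ * ‖y‖ := by rw [norm_smul, Real.norm_of_nonneg hδ0.le]
  have h2 := hΩ _ hmem (by rw [add_sub_cancel_left, hnorm]; nlinarith)
  rw [add_sub_cancel_left, hnorm, inner_smul_right, neg_mul, div_mul_eq_mul_div, neg_le,
    le_div_iff₀ (by positivity)] at h2
  have : 0 < δ * -⟪e, y⟫ := by positivity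
  nlinarith [norm_nonneg y]

/-- Nothing is claimed about the blow-ups on the limiting hyperplane; being a proper subspace, it is
null. -/
lemma ae_inner_ne_zero {e : Euc n} (he : ‖e‖ = 1) : ∀ᵐ y : Euc n, ⟪e, y⟫ ≠ 0 := by
  have h := Measure.addHaar_submodule (volume : Measure (Euc n)) (ℝ ∙ e)ᗮ (fun htop => by
    have : e ∈ (ℝ ∙ e)ᗮ := htop ▸ Submodule.mem_top
    rw [Submodule.mem_orthogonal_singleton_iff_inner_right, real_inner_self_eq_norm_sq, he] at this
    norm_num at this)
  refine measure_mono_null (fun y hy => ?_) h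
  have hy' : ⟪e, y⟫ = 0 := by simpa using hy
  exact Submodule.mem_orthogonal_singleton_iff_inner_right.2 hy'

/-- Dominated convergence for the blow-ups of `Ω`. -/
lemma tendsto_integral_blowup {x₀ e : Euc n} (hΩ : IsOpen Ω) (he : ‖e‖ = 1)
    (h1 : ∀ κ > 0, ∃ R > 0, ∀ x ∈ Ω, ‖x - x₀‖ ≤ R → -κ * ‖x - x₀‖ ≤ ⟪e, x - x₀⟫)
    (h2 : ∀ κ > 0, ∃ R > 0, ∀ x, ‖x - x₀‖ ≤ R → κ * ‖x - x₀‖ < ⟪e, x - x₀⟫ → x ∈ Ω)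
    {f : Euc n → ℝ} (hf : Integrable f) :
    Tendsto (fun δ : ℝ => ∫ y, Ω.indicator (fun _ => f y) (x₀ + δ • y)) (𝓝[>] 0)
      (𝓝 (∫ y, {y | 0 < ⟪e, y⟫}.indicator f y)) := by
  refine tendsto_integral_filter_of_dominated_convergence (fun y => ‖f y‖) ?_ ?_ hf.norm ?_
  · refine Eventually.of_forall fun δ => ?_
    have : (fun y => Ω.indicator (fun _ => f y) (x₀ + δ • y))
        = ((fun y => x₀ + δ • y) ⁻¹' Ω).indicator f := rfl
    rw [this]
    exact hf.aestronglyMeasurable.indicator (hΩ.preimage (by fun_prop)).measurableSet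
  · refine Eventually.of_forall fun δ => Eventually.of_forall fun y => ?_
    exact norm_indicator_le_norm_self (fun _ => f y) (x₀ + δ • y)
  · filter_upwards [ae_inner_ne_zero he] with y hy
    refine tendsto_const_nhds.congr' ?_
    rcases lt_or_gt_of_ne hy with hy | hy
    · filter_upwards [eventually_add_smul_notMem h1 hy] with δ hδ
      rw [Set.indicator_of_notMem hδ, Set.indicator_of_notMem]
      exact not_lt.2 hy.le
    · filter_upwards [eventually_add_smul_mem h2 hy] with δ hδ
      rw [Set.indicator_of_mem hδ, Set.indicator_of_mem]
      exact hy

/-- A smooth radial bump has nonzero mean normal derivative over the half-space. -/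
lemma exists_bump_halfspace {e : Euc n} (he : ‖e‖ = 1) :
    ∃ X : Euc n → ℝ, ContDiff ℝ ∞ X ∧ (∀ y, X y ≠ 0 → ‖y‖ < 2) ∧ HasCompactSupport X ∧
      ∫ y, {y | 0 < ⟪e, y⟫}.indicator (fun y => fderiv ℝ X y e) y < 0 := by
  -- A decreasing profile, one up to `s = 1` and zero from `s = 2` on. Composed with `‖y‖ ^ 2`, its
  -- derivative along `e` is nonpositive wherever `⟪e, y⟫ > 0`.
  let f : ℝ → ℝ := fun s => Real.smoothTransition (2 - s)
  have hf : ContDiff ℝ ∞ f := Real.smoothTransition.contDiff.comp (contDiff_const.sub contDiff_id)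
  have hfa : Antitone f := fun s t hst => Real.smoothTransition.monotone (by linarith)
  let X : Euc n → ℝ := fun y => f (‖y‖ ^ 2)
  have hX : ContDiff ℝ ∞ X := hf.comp (contDiff_norm_sq ℝ)
  have hXs : ∀ y, X y ≠ 0 → ‖y‖ < 2 := by
    intro y hy
    by_contra h
    refine hy (Real.smoothTransition.zero_of_nonpos ?_)
    nlinarith
  have hXc : HasCompactSupport X :=
    HasCompactSupport.intro (isCompact_closedBall (0 : Euc n) 2) fun y hy => by
      by_contra h
      exact hy (by simpa using (hXs y h).le)
  have hdX : ∀ y v, fderiv ℝ X y v = deriv f (‖y‖ ^ 2) * (2 * ⟪y, v⟫) := by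
    intro y v
    have h1 : HasFDerivAt (fun y : Euc n => ‖y‖ ^ 2) (2 • innerSL ℝ y) y :=
      (hasStrictFDerivAt_norm_sq y).hasFDerivAt
    have h2 : HasDerivAt f (deriv f (‖y‖ ^ 2)) (‖y‖ ^ 2) :=
      (hf.differentiable (by simp) _).hasDerivAt
    have h3 := (h2.comp_hasFDerivAt y h1).fderiv
    change fderiv ℝ X y = _ at h3
    rw [h3]
    simp
  refine ⟨X, hX, hXs, hXc, ?_⟩
  have hdf : Continuous (deriv f) := hf.continuous_deriv (by simp)
  -- The positive part replaces the indicator and makes the integrand continuous, so a single point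
  -- with `h ≠ 0` makes the integral positive. The mean value theorem on `[1, 2]` supplies it.
  let h : Euc n → ℝ := fun y => -deriv f (‖y‖ ^ 2) * (2 * max ⟪e, y⟫ 0)
  have hhc : Continuous h := by fun_prop
  have hhe : ∀ y, {y | 0 < ⟪e, y⟫}.indicator (fun y => fderiv ℝ X y e) y = - h y := by
    intro y
    by_cases hy : 0 < ⟪e, y⟫
    · rw [Set.indicator_of_mem (by exact hy), hdX, real_inner_comm]
      simp only [h, max_eq_left hy.le]
      ring
    · rw [Set.indicator_of_notMem (by exact hy)]
      simp only [h, max_eq_right (not_lt.1 hy)]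
      ring
  have hdf0 : ∀ s, 4 < s → deriv f s = 0 := by
    intro s hs
    have : f =ᶠ[𝓝 s] fun _ => 0 := by
      filter_upwards [lt_mem_nhds hs] with t ht
      exact Real.smoothTransition.zero_of_nonpos (by linarith)
    rw [this.deriv_eq, deriv_const]
  have hhs : HasCompactSupport h :=
    HasCompactSupport.intro (isCompact_closedBall (0 : Euc n) 2) fun y hy => by
      have hy' : 2 < ‖y‖ := by simpa using hy
      simp only [h]
      rw [hdf0 _ (by nlinarith)]
      simp
  have hh0 : 0 ≤ h := fun y =>
    mul_nonneg (neg_nonneg.2 hfa.deriv_nonpos) (mul_nonneg zero_le_two (le_max_right _ _))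
  obtain ⟨t, ht, htd⟩ := exists_deriv_eq_slope f (show (1 : ℝ) < 2 by norm_num)
    hf.continuous.continuousOn (hf.differentiable (by simp)).differentiableOn
  have hslope : deriv f t = -1 := by
    rw [htd]
    have e1 : f 2 = 0 := Real.smoothTransition.zero_of_nonpos (by norm_num)
    have e2 : f 1 = 1 := Real.smoothTransition.one_of_one_le (by norm_num)
    rw [e1, e2]
    norm_num
  have ht0 : 0 < t := by linarith [ht.1]
  have hne : h (Real.sqrt t • e) ≠ 0 := by
    have h1 : ‖Real.sqrt t • e‖ ^ 2 = t := by
      rw [norm_smul, he, mul_one, Real.norm_of_nonneg (Real.sqrt_nonneg t), Real.sq_sqrt ht0.le]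
    have h2 : ⟪e, Real.sqrt t • e⟫ = Real.sqrt t := by
      rw [inner_smul_right, real_inner_self_eq_norm_sq, he]
      norm_num
    simp only [h, h1, h2, hslope, max_eq_left (Real.sqrt_nonneg t)]
    have := Real.sqrt_pos.2 ht0
    positivity
  have hpos := hhc.integral_pos_of_hasCompactSupport_nonneg_nonzero (μ := volume) hhs hh0 hne
  simp_rw [hhe]
  rw [integral_neg]
  linarith

end Geometry

end PLap

namespace PLap

/-! ### Boundary data concentrating at a point -/

section Scaling

variable {n : ℕ}

lemma integral_rescale (x₀ : Euc n) {δ : ℝ} (hδ : 0 < δ) (g : Euc n → ℝ) :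
    ∫ x, g x = δ ^ n * ∫ y, g (x₀ + δ • y) := by
  have h1 := Measure.integral_comp_smul (volume : Measure (Euc n)) (fun y => g (x₀ + y)) δ
  rw [integral_add_left_eq_self, finrank_euclideanSpace_fin, abs_of_pos (by positivity),
    smul_eq_mul] at h1
  rw [h1, mul_inv_cancel_left₀ (by positivity)]

/-- The rescaling of `f` to scale `δ` around `x₀`. -/
noncomputable def rescale (x₀ : Euc n) (δ : ℝ) (f : Euc n → ℝ) : Euc n → ℝ := fun x => f (δ⁻¹ • (x - x₀))

lemma contDiff_rescale (x₀ : Euc n) (δ : ℝ) {f : Euc n → ℝ} (hf : ContDiff ℝ ∞ f) :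
    ContDiff ℝ ∞ (rescale x₀ δ f) :=
  hf.comp ((contDiff_id.sub contDiff_const).const_smul δ⁻¹)

lemma hasCompactSupport_rescale (x₀ : Euc n) {δ : ℝ} (hδ : 0 < δ) {f : Euc n → ℝ}
    (hf : HasCompactSupport f) : HasCompactSupport (rescale x₀ δ f) :=
  hf.comp_homeomorph ((Homeomorph.subRight x₀).trans
    (Homeomorph.smulOfNeZero δ⁻¹ (inv_ne_zero hδ.ne')))

lemma fderiv_rescale (x₀ : Euc n) (δ : ℝ) {f : Euc n → ℝ} (hf : ContDiff ℝ ∞ f) (x : Euc n) :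
    fderiv ℝ (rescale x₀ δ f) x = δ⁻¹ • fderiv ℝ f (δ⁻¹ • (x - x₀)) := by
  have h1 : HasFDerivAt (fun x : Euc n => δ⁻¹ • (x - x₀))
      (δ⁻¹ • ContinuousLinearMap.id ℝ (Euc n)) x :=
    ((hasFDerivAt_id x).sub_const x₀).const_smul δ⁻¹
  have h2 := ((hf.differentiable (by simp) (δ⁻¹ • (x - x₀))).hasFDerivAt.comp x h1).fderiv
  change fderiv ℝ (rescale x₀ δ f) x = _ at h2
  rw [h2]
  ext v
  simp

lemma gradient_rescale (x₀ : Euc n) (δ : ℝ) {f : Euc n → ℝ} (hf : ContDiff ℝ ∞ f) (x : Euc n) :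
    gradient (rescale x₀ δ f) x = δ⁻¹ • gradient f (δ⁻¹ • (x - x₀)) := by
  simp only [gradient]
  rw [fderiv_rescale x₀ δ hf, map_smul]

lemma inv_smul_add_smul_sub (x₀ : Euc n) {δ : ℝ} (hδ : 0 < δ) (y : Euc n) :
    δ⁻¹ • (x₀ + δ • y - x₀) = y := by
  rw [add_sub_cancel_left, smul_smul, inv_mul_cancel₀ hδ.ne', one_smul]

/-- `ψ` plays a derivative of a cutoff at scale `δ`. Young's inequality `δ |G| ≤ s + s ^ (1 - q) (δ
|G|) ^ q` on its support separates the volume of the ball from the energy; `s` is chosen later. -/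
lemma abs_integral_inner_mul_le {Ω : Set (Euc n)} {p : ℝ≥0∞} (hp : 1 < p) (hp' : p ≠ ⊤)
    {a x₀ : Euc n} (ha : ‖a‖ = 1) {ψ : Euc n → ℝ} {A δ s : ℝ} (hδ : 0 < δ) (hs : 0 < s)
    (hA : 0 ≤ A) (hψ : ∀ x, |ψ x| ≤ A * δ⁻¹) (hψ0 : ∀ x ∉ Metric.closedBall x₀ (2 * δ), ψ x = 0)
    (G : Lp (Euc n) p ((volume : Measure (Euc n)).restrict Ω)) :
    |∫ x in Ω, ⟪a, G x⟫ * ψ x| ≤ A * δ⁻¹ ^ 2 * (s * volume.real (Metric.closedBall x₀ (2 * δ))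
      + s ^ (1 - p.toReal) * δ ^ p.toReal * ‖G‖ ^ p.toReal) := by
  have hq := one_lt_toReal hp hp'
  set B := Metric.closedBall x₀ (2 * δ) with hB
  have hBm : MeasurableSet B := Metric.isClosed_closedBall.measurableSet
  have i1 : Integrable (B.indicator fun _ => s) ((volume : Measure (Euc n)).restrict Ω) := by
    refine ((integrable_indicator_iff hBm).2 ?_).restrict
    exact integrableOn_const Metric.isBounded_closedBall.measure_lt_top.ne
  have i2 := Lp_integrable_norm_rpow hp hp' G
  rw [Lp_norm_rpow_eq_integral hp hp', ← integral_const_mul]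
  have h1 : ∫ x in Ω, B.indicator (fun _ => s) x ≤ s * volume.real B := by
    refine (setIntegral_le_integral ((integrable_indicator_iff hBm).2 (integrableOn_const
      Metric.isBounded_closedBall.measure_lt_top.ne)) (Eventually.of_forall fun x =>
        Set.indicator_nonneg (fun _ _ => hs.le) x)).trans ?_
    rw [integral_indicator_const _ hBm, smul_eq_mul, mul_comm]
  have h2 : |∫ x in Ω, ⟪a, G x⟫ * ψ x| ≤ ∫ x in Ω, A * δ⁻¹ ^ 2 * (B.indicator (fun _ => s) x
      + s ^ (1 - p.toReal) * δ ^ p.toReal * ‖G x‖ ^ p.toReal) := by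
    rw [← Real.norm_eq_abs]
    refine norm_integral_le_of_norm_le ((i1.add (i2.const_mul _)).const_mul _)
      (Eventually.of_forall fun x => ?_)
    rw [Real.norm_eq_abs, abs_mul]
    by_cases hx : x ∈ B
    · rw [Set.indicator_of_mem hx]
      have h3 := abs_real_inner_le_norm a (G x)
      rw [ha, one_mul] at h3
      have h4 := rpow_mul_le_young hq hs zero_le_one
        (by positivity : 0 ≤ δ * ‖G x‖)
      rw [Real.one_rpow, Real.one_rpow, one_mul, mul_one, Real.mul_rpow hδ.le (norm_nonneg _)] at h4
      calc |⟪a, G x⟫| * |ψ x| ≤ ‖G x‖ * (A * δ⁻¹) :=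
            mul_le_mul h3 (hψ x) (abs_nonneg _) (norm_nonneg _)
        _ = A * δ⁻¹ ^ 2 * (δ * ‖G x‖) := by field_simp
        _ ≤ _ := by
            rw [mul_assoc (s ^ (1 - p.toReal))]
            exact mul_le_mul_of_nonneg_left h4 (by positivity)
    · rw [hψ0 x hx, abs_zero, mul_zero, Set.indicator_of_notMem hx]
      positivity
  refine h2.trans ?_
  rw [integral_const_mul]
  refine mul_le_mul_of_nonneg_left ?_ (by positivity)
  rw [integral_add i1 (i2.const_mul _)]
  linarith

end Scaling

/-! ### A linear functional of the gradient that sees only boundary values -/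

section Flux

variable {n : ℕ} {Ω : Set (Euc n)} {p : ℝ≥0∞} [Fact (1 ≤ p)]

/-- Integration by parts against the divergence-free field `(∂ₑχ) τ - (∂_τ χ) e`. -/
lemma exists_flux {χ : Euc n → ℝ} (hχ : ContDiff ℝ ∞ χ) (hc : HasCompactSupport χ)
    (e τ : Euc n) :
    ∃ Φ : Lp (Euc n) p ((volume : Measure (Euc n)).restrict Ω) →L[ℝ] ℝ,
      (∀ G, Φ G = (∫ x in Ω, ⟪τ, G x⟫ * fderiv ℝ χ x e) - ∫ x in Ω, ⟪e, G x⟫ * fderiv ℝ χ x τ) ∧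
      ∀ w ∈ W10 Ω p, Φ (grad w) = 0 := by
  have hcd : ∀ v, Continuous fun x => fderiv ℝ χ x v := fun v =>
    (hχ.continuous_fderiv (by simp)).clm_apply continuous_const
  obtain ⟨T₁, hT₁⟩ := exists_integral_Lp_mul (p := p) (μ := (volume : Measure (Euc n)).restrict Ω)
    (innerSL ℝ τ) (hcd e) (hc.fderiv_apply ℝ e)
  obtain ⟨T₂, hT₂⟩ := exists_integral_Lp_mul (p := p) (μ := (volume : Measure (Euc n)).restrict Ω)
    (innerSL ℝ e) (hcd τ) (hc.fderiv_apply ℝ τ)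
  have hΦ : ∀ G, (T₁ - T₂) G
      = (∫ x in Ω, ⟪τ, G x⟫ * fderiv ℝ χ x e) - ∫ x in Ω, ⟪e, G x⟫ * fderiv ℝ χ x τ := by
    intro G
    rw [sub_apply, hT₁, hT₂]
    rfl
  refine ⟨T₁ - T₂, hΦ, fun w hw => ?_⟩
  have hcl : IsClosed {w : W1 Ω p | (T₁ - T₂) (grad w) = 0} :=
    isClosed_eq ((T₁ - T₂).continuous.comp continuous_grad) continuous_const
  refine closure_minimal ?_ hcl hw
  rintro w ⟨φ, hφ, -, h2⟩
  have hφd : ∀ v, ContDiff ℝ ∞ fun x => fderiv ℝ φ x v := fun v =>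
    (hφ.contDiff.fderiv_right (m := ∞) (by simp)).clm_apply contDiff_const
  -- Integration by parts puts both derivatives on `φ`. The result is symmetric in `a` and `b`, so
  -- the two terms of `Φ` cancel.
  have key : ∀ a b : Euc n, ∫ x in Ω, ⟪a, grad w x⟫ * fderiv ℝ χ x b
      = - ∫ x, fderiv ℝ (fderiv ℝ φ) x b a * χ x := by
    intro a b
    have e1 : ∫ x in Ω, ⟪a, grad w x⟫ * fderiv ℝ χ x b
        = ∫ x, fderiv ℝ φ x a * fderiv ℝ χ x b := by
      refine (integral_congr_ae ?_).trans
        (setIntegral_eq_integral_of_forall_compl_eq_zero (s := Ω) fun x hx => ?_)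
      · filter_upwards [h2] with x hx
        rw [hx, real_inner_comm, inner_gradient_left]
      · rw [hφ.fderiv_eq_zero_of_notMem hx]
        simp
    rw [e1, integral_smul_fderiv_eq_neg hχ (hφd a) hc b]
    congr 2
    ext x
    rw [fderiv_clm_apply ((hφ.contDiff.fderiv_right (m := ∞) (by simp)).differentiable
      (by simp) x) (differentiableAt_const a)]
    simp
  change (T₁ - T₂) (grad w) = 0
  rw [hΦ, key, key, sub_eq_zero]
  congr 2
  ext x
  have hsymm : IsSymmSndFDerivAt ℝ φ x :=
    ((contDiff_infty.1 hφ.contDiff 2).contDiffAt (x := x)).isSymmSndFDerivAt (by simp)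
  rw [hsymm.eq]

end Flux

/-! ### Two-sided energy bounds for the concentrating data -/

section Bump

variable {n : ℕ} {Ω : Set (Euc n)} {p : ℝ≥0∞} [Fact (1 ≤ p)]

/-- A profile which is linear with slope `τ` near the origin. -/
lemma exists_linear_profile (τ : Euc n) :
    ∃ V : Euc n → ℝ, ContDiff ℝ ∞ V ∧ HasCompactSupport V ∧
      (∀ y, ‖y‖ ≤ 2 → gradient V y = τ) ∧ ∀ y, 4 < ‖y‖ → gradient V y = 0 := by
  -- The inner radius exceeds `2`, so `V` is linear on the support of the flux bump; the outer
  -- radius is below `5`, where the logarithmic cutoff may start.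
  let ψ : ContDiffBump (0 : Euc n) := ⟨3, 4, by norm_num, by norm_num⟩
  let V : Euc n → ℝ := fun y => ψ y * ⟪τ, y⟫
  have hV : ContDiff ℝ ∞ V := ψ.contDiff.mul (contDiff_const.inner ℝ contDiff_id)
  refine ⟨V, hV, ψ.hasCompactSupport.mul_right, fun y hy => ?_, fun y hy => ?_⟩
  · have h1 : V =ᶠ[𝓝 y] fun z => ⟪τ, z⟫ := by
      have : Metric.ball (0 : Euc n) 3 ∈ 𝓝 y :=
        Metric.isOpen_ball.mem_nhds (by simp only [mem_ball_zero_iff]; linarith)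
      filter_upwards [this] with z hz
      simp only [V]
      rw [ψ.one_of_mem_closedBall (Metric.ball_subset_closedBall hz), one_mul]
    have h2 : HasGradientAt (fun z => ⟪τ, z⟫) τ y := by
      rw [hasGradientAt_iff_hasFDerivAt]
      exact (innerSL ℝ τ).hasFDerivAt
    rw [h1.gradient_eq, h2.gradient]
  · have h1 : V =ᶠ[𝓝 y] fun _ => 0 := by
      have : (Metric.closedBall (0 : Euc n) 4)ᶜ ∈ 𝓝 y :=
        Metric.isClosed_closedBall.isOpen_compl.mem_nhds (by simpa using hy)
      filter_upwards [this] with z hz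
      have hz' : 4 ≤ dist z 0 := by
        have : ¬ ‖z‖ ≤ 4 := by simpa using hz
        rw [dist_zero_right]
        exact (not_le.1 this).le
      simp only [V]
      rw [ψ.zero_of_le_dist hz', zero_mul]
    rw [h1.gradient_eq, gradient_fun_const]

/-- The energy of the rescaled profiles, from above. -/
lemma norm_grad_rescale_le (hp : 1 < p) (hp' : p ≠ ⊤) {V : Euc n → ℝ}
    (hV : ContDiff ℝ ∞ V) (hc : HasCompactSupport V) (x₀ : Euc n) {δ : ℝ} (hδ : 0 < δ)
    {v : W1 Ω p} (hv : grad v =ᵐ[volume.restrict Ω] gradient (rescale x₀ δ V)) :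
    ‖grad v‖ ^ p.toReal
      ≤ (∫ y, ‖gradient V y‖ ^ p.toReal) * (δ ^ n * (δ ^ p.toReal)⁻¹) := by
  have hq := one_lt_toReal hp hp'
  have hq0 : 0 < p.toReal := by linarith
  have htest : IsTestFunction Set.univ (rescale x₀ δ V) :=
    ⟨contDiff_rescale x₀ δ hV, hasCompactSupport_rescale x₀ hδ hc, Set.subset_univ _⟩
  have hi := htest.integrable_norm_gradient_rpow hq0
  rw [Lp_norm_rpow_eq_integral hp hp']
  calc ∫ x in Ω, ‖grad v x‖ ^ p.toReal
      = ∫ x in Ω, ‖gradient (rescale x₀ δ V) x‖ ^ p.toReal := by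
        refine integral_congr_ae ?_
        filter_upwards [hv] with x hx
        rw [hx]
    _ ≤ ∫ x, ‖gradient (rescale x₀ δ V) x‖ ^ p.toReal :=
        setIntegral_le_integral hi (Eventually.of_forall fun x => by positivity)
    _ = δ ^ n * ∫ y, (δ ^ p.toReal)⁻¹ * ‖gradient V y‖ ^ p.toReal := by
        rw [integral_rescale x₀ hδ]
        congr 2
        ext y
        rw [gradient_rescale x₀ δ hV, inv_smul_add_smul_sub x₀ hδ, norm_smul,
          Real.mul_rpow (norm_nonneg _) (norm_nonneg _), Real.norm_of_nonneg (by positivity),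
          Real.inv_rpow hδ.le]
    _ = _ := by
        rw [integral_const_mul]
        ring

/-- This `s` lets the volume term absorb at most half of `D c₁`, and the energy term must carry the
rest. The added ones keep the denominators positive when `A` or `b₀` vanishes. -/
lemma lower_bound_of_flux_bound {c₁ A b₀ q D N T : ℝ} (hc₁ : 0 < c₁) (hA : 0 ≤ A) (hb₀ : 0 ≤ b₀)
    (hD : 0 < D) (hT : 0 ≤ T)
    (h : ∀ s > 0, D * c₁ ≤ 2 * (A * (s * (D * b₀) + s ^ (1 - q) * T * N))) (hN : 0 ≤ N) :
    c₁ / (2 * (2 * A + 1) * (c₁ / (4 * A * b₀ + 1)) ^ (1 - q)) * D ≤ T * N := by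
  set s : ℝ := c₁ / (4 * A * b₀ + 1) with hs
  have hspos : 0 < s := by positivity
  have h1 := h s hspos
  have h2 : 4 * A * b₀ * s ≤ c₁ := by
    rw [hs, mul_div_assoc', div_le_iff₀ (by positivity)]
    nlinarith
  have h3 : 4 * A * b₀ * s * D ≤ c₁ * D := mul_le_mul_of_nonneg_right h2 hD.le
  have h4 : 0 ≤ s ^ (1 - q) * (T * N) := by positivity
  have hsq : 0 < s ^ (1 - q) := by positivity
  rw [div_mul_eq_mul_div, div_le_iff₀ (by positivity)]
  nlinarith

set_option maxHeartbeats 1000000 in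
/-- The energy of extensions of the rescaled profiles, from below. -/
lemma exists_lower_bound (hΩ : IsOpen Ω) (hp : 1 < p) (hp' : p ≠ ⊤)
    {x₀ e τ : Euc n} (he : ‖e‖ = 1) (hτ : ‖τ‖ = 1) (heτ : ⟪e, τ⟫ = 0)
    (h1 : ∀ κ > 0, ∃ R > 0, ∀ x ∈ Ω, ‖x - x₀‖ ≤ R → -κ * ‖x - x₀‖ ≤ ⟪e, x - x₀⟫)
    (h2 : ∀ κ > 0, ∃ R > 0, ∀ x, ‖x - x₀‖ ≤ R → κ * ‖x - x₀‖ < ⟪e, x - x₀⟫ → x ∈ Ω)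
    {V : Euc n → ℝ} (hV : ContDiff ℝ ∞ V) (hVτ : ∀ y, ‖y‖ ≤ 2 → gradient V y = τ) :
    ∃ c > 0, ∀ᶠ δ : ℝ in 𝓝[>] 0, ∀ u v : W1 Ω p,
      grad v =ᵐ[volume.restrict Ω] gradient (rescale x₀ δ V) → u - v ∈ W10 Ω p →
      c * (δ ^ n * (δ ^ p.toReal)⁻¹) ≤ ‖grad u‖ ^ p.toReal := by
  have hq := one_lt_toReal hp hp'
  obtain ⟨X, hX, hXs, hXc, hXneg⟩ := exists_bump_halfspace he
  set I₀ : ℝ := ∫ y, {y | 0 < ⟪e, y⟫}.indicator (fun y => fderiv ℝ X y e) y with hI₀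
  have hXd : ∀ v, Continuous fun y => fderiv ℝ X y v := fun v =>
    (hX.continuous_fderiv (by simp)).clm_apply continuous_const
  obtain ⟨A, hA⟩ := (hXc.fderiv ℝ).exists_bound_of_continuous (hX.continuous_fderiv (by simp))
  have hA0 : 0 ≤ A := (norm_nonneg _).trans (hA 0)
  have hts : ∀ y, fderiv ℝ X y ≠ 0 → ‖y‖ ≤ 2 := by
    intro y hy
    have h3 : y ∈ tsupport X := by
      by_contra h
      exact hy (image_eq_zero_of_notMem_tsupport fun h' => h (tsupport_fderiv_subset ℝ h'))
    have h4 : tsupport X ⊆ Metric.closedBall 0 2 :=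
      closure_minimal (fun z hz => by simpa using (hXs z hz).le) Metric.isClosed_closedBall
    simpa using h4 h3
  set b₀ : ℝ := volume.real (Metric.closedBall (0 : Euc n) 2) with hb₀
  refine ⟨-I₀ / 2 / (2 * (2 * A + 1) * (-I₀ / 2 / (4 * A * b₀ + 1)) ^ (1 - p.toReal)), ?_, ?_⟩
  · have : 0 < -I₀ / 2 := by linarith
    have : 0 ≤ b₀ := measureReal_nonneg
    positivity
  -- The limit `I₀` is negative, so for small `δ` the rescaled flux stays below `I₀ / 2`, whatever
  -- `u` and `v` are.
  have hev := (tendsto_integral_blowup hΩ he h1 h2 ((hXd e).integrable_of_hasCompactSupport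
    (hXc.fderiv_apply ℝ e))).eventually (gt_mem_nhds (show I₀ < I₀ / 2 by linarith))
  filter_upwards [hev, self_mem_nhdsWithin] with δ hδI hδ u v hv huv
  rw [Set.mem_Ioi] at hδ
  set χ := rescale x₀ δ X with hχ
  have hχd : ∀ x w, fderiv ℝ χ x w = δ⁻¹ * fderiv ℝ X (δ⁻¹ • (x - x₀)) w := fun x w => by
    rw [hχ, fderiv_rescale x₀ δ hX, smul_apply, smul_eq_mul]
  obtain ⟨Φ, hΦ, hΦ0⟩ := exists_flux (Ω := Ω) (p := p) (contDiff_rescale x₀ δ hX)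
    (hasCompactSupport_rescale x₀ hδ hXc) e τ
  have hΦuv : Φ (grad u) = Φ (grad v) := by
    have := hΦ0 _ huv
    rw [grad_sub, map_sub] at this
    linarith
  -- On the support of `∇χ` the gradient of `v` is exactly `δ⁻¹ τ`: the `τ` part of the flux gives
  -- the half-space integral, and the `e` part vanishes by orthogonality.
  have hgv : ∀ᵐ x ∂(volume.restrict Ω), fderiv ℝ X (δ⁻¹ • (x - x₀)) ≠ 0 →
      grad v x = δ⁻¹ • τ := by
    filter_upwards [hv] with x hx hne
    rw [hx, gradient_rescale x₀ δ hV, hVτ _ (hts _ hne)]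
  have e1 : ∫ x in Ω, ⟪τ, grad v x⟫ * fderiv ℝ χ x e
      = δ ^ n * (δ⁻¹ ^ 2 * ∫ y, Ω.indicator (fun _ => fderiv ℝ X y e) (x₀ + δ • y)) := by
    have e2 : ∫ x in Ω, ⟪τ, grad v x⟫ * fderiv ℝ χ x e
        = ∫ x in Ω, δ⁻¹ ^ 2 * fderiv ℝ X (δ⁻¹ • (x - x₀)) e := by
      refine integral_congr_ae ?_
      filter_upwards [hgv] with x hx
      rw [hχd]
      by_cases h0 : fderiv ℝ X (δ⁻¹ • (x - x₀)) = 0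
      · simp [h0]
      · rw [hx h0, inner_smul_right, real_inner_self_eq_norm_sq, hτ]
        ring
    rw [e2, integral_const_mul, ← integral_indicator hΩ.measurableSet, integral_rescale x₀ hδ,
      mul_left_comm]
    congr 3
    ext y
    by_cases hy : x₀ + δ • y ∈ Ω
    · rw [Set.indicator_of_mem hy, Set.indicator_of_mem hy, inv_smul_add_smul_sub x₀ hδ]
    · rw [Set.indicator_of_notMem hy, Set.indicator_of_notMem hy]
  have e3 : ∫ x in Ω, ⟪e, grad v x⟫ * fderiv ℝ χ x τ = 0 := by
    refine integral_eq_zero_of_ae ?_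
    filter_upwards [hgv] with x hx
    by_cases h0 : fderiv ℝ X (δ⁻¹ • (x - x₀)) = 0
    · rw [hχd, h0]
      simp
    · rw [hx h0, inner_smul_right, heτ]
      simp
  have hψ : ∀ w : Euc n, ‖w‖ = 1 → ∀ x, |fderiv ℝ χ x w| ≤ A * δ⁻¹ := by
    intro w hw x
    rw [hχd, abs_mul, abs_of_pos (by positivity), mul_comm]
    gcongr
    have := (fderiv ℝ X (δ⁻¹ • (x - x₀))).le_opNorm w
    rw [hw, mul_one] at this
    exact this.trans (hA _)
  have hψ0 : ∀ w : Euc n, ∀ x ∉ Metric.closedBall x₀ (2 * δ), fderiv ℝ χ x w = 0 := by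
    intro w x hx
    rw [hχd]
    by_cases h0 : fderiv ℝ X (δ⁻¹ • (x - x₀)) = 0
    · simp [h0]
    · have h3 := hts _ h0
      rw [norm_smul, Real.norm_of_nonneg (by positivity), inv_mul_le_iff₀ hδ] at h3
      exact absurd (mem_closedBall_iff_norm.2 (by linarith)) hx
  have hvol : volume.real (Metric.closedBall x₀ (2 * δ)) = δ ^ n * b₀ := by
    rw [hb₀, measureReal_def, measureReal_def, mul_comm 2 δ,
      Measure.addHaar_closedBall_mul _ _ hδ.le zero_le_two, finrank_euclideanSpace_fin,
      ENNReal.toReal_mul, ENNReal.toReal_ofReal (by positivity)]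
  have hδq : 0 < δ ^ p.toReal := by positivity
  have hlow := lower_bound_of_flux_bound (c₁ := -I₀ / 2) (A := A) (b₀ := b₀) (q := p.toReal)
    (D := δ ^ n) (N := ‖grad u‖ ^ p.toReal) (T := δ ^ p.toReal) (by linarith) hA0
    measureReal_nonneg (by positivity) hδq.le ?_ (by positivity)
  · rw [← mul_assoc, ← div_eq_mul_inv, div_le_iff₀ hδq, mul_comm (‖grad u‖ ^ p.toReal)]
    exact hlow
  intro s hs
  have b1 := abs_integral_inner_mul_le hp hp' hτ hδ hs hA0 (hψ e he) (hψ0 e)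
    (grad u)
  have b2 := abs_integral_inner_mul_le hp hp' he hδ hs hA0 (hψ τ hτ) (hψ0 τ)
    (grad u)
  rw [hΦ, hΦ, e1, e3] at hΦuv
  rw [hvol] at b1 b2
  generalize (∫ x in Ω, ⟪τ, grad u x⟫ * fderiv ℝ χ x e) = J₁ at *
  generalize (∫ x in Ω, ⟪e, grad u x⟫ * fderiv ℝ χ x τ) = J₂ at *
  have b3 := (abs_le.1 b1).1
  have b4 := (abs_le.1 b2).2
  have b5 : δ ^ n * (δ⁻¹ ^ 2 * (∫ y, Ω.indicator (fun _ => fderiv ℝ X y e) (x₀ + δ • y)))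
      ≤ δ ^ n * (δ⁻¹ ^ 2 * (I₀ / 2)) := by gcongr
  have hδ2 : 0 < δ⁻¹ ^ 2 := by positivity
  refine le_of_mul_le_mul_left ?_ hδ2
  linarith

end Bump

end PLap

namespace PLap

/-! ### Energy localization and boundary determination -/

section Cutoff

lemma exists_bound_deriv_smoothTransition :
    ∃ A : ℝ, 0 ≤ A ∧ ∀ s, |deriv Real.smoothTransition s| ≤ A := by
  have hc : Continuous (deriv Real.smoothTransition) :=
    (Real.smoothTransition.contDiff (n := 1)).continuous_deriv (by simp)
  have hs : HasCompactSupport (deriv Real.smoothTransition) := by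
    refine HasCompactSupport.intro (isCompact_Icc (a := (0 : ℝ)) (b := 1)) fun s hs => ?_
    rw [Set.mem_Icc, not_and_or, not_le, not_le] at hs
    rcases hs with hs | hs
    · have : Real.smoothTransition =ᶠ[𝓝 s] fun _ => 0 := by
        filter_upwards [gt_mem_nhds hs] with t ht
        exact Real.smoothTransition.zero_of_nonpos ht.le
      rw [this.deriv_eq, deriv_const]
    · have : Real.smoothTransition =ᶠ[𝓝 s] fun _ => 1 := by
        filter_upwards [lt_mem_nhds hs] with t ht
        exact Real.smoothTransition.one_of_one_le ht.le
      rw [this.deriv_eq, deriv_const]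
  obtain ⟨A, hA⟩ := hs.exists_bound_of_continuous hc
  exact ⟨A, (norm_nonneg _).trans (hA 0), hA⟩

/-- Logarithmic cutoff functions. -/
lemma exists_log_cutoff :
    ∃ A : ℝ, 0 ≤ A ∧ ∀ {n : ℕ} (x₀ : Euc n) (r δ L : ℝ), 0 < r → 0 < δ → 0 < L →
      26 * δ ^ 2 * Real.exp L ≤ r ^ 2 →
      ∃ θ : Euc n → ℝ, IsMultiplier θ ∧ (∀ x, 0 ≤ θ x) ∧ (∀ x, ‖x - x₀‖ ≤ 5 * δ → θ x = 0) ∧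
        (∀ x, r ≤ ‖x - x₀‖ → θ x = 1) ∧
        ∀ x, ‖gradient θ x‖ ≤ A / L * ‖x - x₀‖⁻¹ := by
  obtain ⟨A, hA0, hA⟩ := exists_bound_deriv_smoothTransition
  refine ⟨2 * A, by positivity, ?_⟩
  intro n x₀ r δ L hr hδ hL hrδ
  let N : Euc n → ℝ := fun x => ‖x - x₀‖ ^ 2 + δ ^ 2
  have hN : ∀ x, 0 < N x := fun x => by positivity
  have hNc : ContDiff ℝ ∞ N :=
    ((contDiff_norm_sq ℝ).comp (contDiff_id.sub contDiff_const)).add contDiff_const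
  -- For `‖x - x₀‖ ≤ 5 δ` one has `N ≤ 26 δ ^ 2`, so `ζ ≤ 0`; for `‖x - x₀‖ ≥ r` one has `N ≥ 26 δ ^
  -- 2 exp L`, so `ζ ≥ 1`. The summand `δ ^ 2` in `N` keeps the logarithm smooth at `x₀`.
  let ζ : Euc n → ℝ := fun x => (Real.log (N x) - Real.log (26 * δ ^ 2)) / L
  have hζc : ContDiff ℝ ∞ ζ :=
    ((hNc.log fun x => (hN x).ne').sub contDiff_const).div_const L
  let θ : Euc n → ℝ := fun x => Real.smoothTransition (ζ x)
  have hθc : ContDiff ℝ ∞ θ := Real.smoothTransition.contDiff.comp hζc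
  have hNd : ∀ x, HasFDerivAt N (2 • innerSL ℝ (x - x₀)) x := fun x => by
    have h1 := (hasStrictFDerivAt_norm_sq (x - x₀)).hasFDerivAt.comp x
      ((hasFDerivAt_id x).sub_const x₀)
    exact h1.add_const (δ ^ 2)
  have hgrad : ∀ x, ‖gradient θ x‖ ≤ A * (L⁻¹ * ((N x)⁻¹ * (2 * ‖x - x₀‖))) := by
    intro x
    have h1 : HasFDerivAt ζ (L⁻¹ • ((N x)⁻¹ • (2 • innerSL ℝ (x - x₀)))) x := by
      have h2 := ((hNd x).log (hN x).ne').sub_const (Real.log (26 * δ ^ 2))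
      have h3 := h2.const_mul L⁻¹
      refine h3.congr_of_eventuallyEq (Eventually.of_forall fun y => ?_)
      simp only [ζ]
      rw [div_eq_inv_mul]
    have h4 : HasDerivAt Real.smoothTransition (deriv Real.smoothTransition (ζ x)) (ζ x) :=
      ((Real.smoothTransition.contDiff (n := 1)).differentiable (by simp) _).hasDerivAt
    have h5 := (h4.comp_hasFDerivAt x h1).fderiv
    change fderiv ℝ θ x = _ at h5
    rw [norm_gradient, h5, norm_smul, norm_smul, norm_smul, Real.norm_of_nonneg
      (inv_nonneg.2 hL.le), Real.norm_of_nonneg (inv_nonneg.2 (hN x).le)]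
    have h6 : ‖2 • innerSL ℝ (x - x₀)‖ ≤ 2 * ‖x - x₀‖ := by
      rw [two_smul, two_mul]
      refine (norm_add_le _ _).trans_eq ?_
      rw [innerSL_apply_norm]
    have h7 := (hN x).le
    exact mul_le_mul (hA _) (by gcongr) (by positivity) hA0
  refine ⟨θ, ⟨hθc, ⟨1, fun x => ?_⟩, ⟨A * (L⁻¹ * δ⁻¹), fun x => ?_⟩⟩,
    fun x => Real.smoothTransition.nonneg _, fun x hx => ?_, fun x hx => ?_, fun x => ?_⟩
  · rw [Real.norm_of_nonneg (Real.smoothTransition.nonneg _)]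
    exact Real.smoothTransition.le_one _
  · refine (hgrad x).trans ?_
    gcongr
    rw [inv_mul_le_iff₀ (hN x), ← div_eq_mul_inv, le_div_iff₀ hδ]
    simp only [N]
    nlinarith [sq_nonneg (‖x - x₀‖ - δ)]
  · refine Real.smoothTransition.zero_of_nonpos (div_nonpos_of_nonpos_of_nonneg ?_ hL.le)
    rw [sub_nonpos]
    refine Real.log_le_log (hN x) ?_
    have := pow_le_pow_left₀ (norm_nonneg _) hx 2
    simp only [N]
    nlinarith
  · refine Real.smoothTransition.one_of_one_le ?_
    rw [le_div_iff₀ hL, one_mul, le_sub_iff_add_le, ← Real.log_exp L, ← Real.log_mul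
      (Real.exp_pos _).ne' (by positivity)]
    refine Real.log_le_log (by positivity) ?_
    have := pow_le_pow_left₀ hr.le hx 2
    simp only [N]
    nlinarith [sq_nonneg δ]
  · refine (hgrad x).trans ?_
    rcases (norm_nonneg (x - x₀)).eq_or_lt with h0 | h0
    · rw [← h0]
      simp
    · have h1 : (N x)⁻¹ * (2 * ‖x - x₀‖) ≤ 2 * ‖x - x₀‖⁻¹ := by
        rw [inv_mul_le_iff₀ (hN x), ← div_eq_mul_inv, mul_div_assoc', le_div_iff₀ h0]
        simp only [N]
        nlinarith [sq_nonneg δ]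
      calc A * (L⁻¹ * ((N x)⁻¹ * (2 * ‖x - x₀‖))) ≤ A * (L⁻¹ * (2 * ‖x - x₀‖⁻¹)) := by gcongr
        _ = 2 * A / L * ‖x - x₀‖⁻¹ := by ring

end Cutoff

/-! ### Concentration of energy and the contradiction -/

section Localization

variable {n : ℕ} {Ω : Set (Euc n)} {p : ℝ≥0∞} [Fact (1 ≤ p)] {γ : Euc n → ℝ} {m M : ℝ}

/-- Pointwise form of testing with `θ w`: `a = ∇u`, `t = θ`, `b = ∇θ`, `w` is the value of the
tested function and `ρ` the Hardy weight. Ellipticity bounds the main term below; Young's inequality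
splits the cross term. -/
lemma flux_mul_lower_bound {E : Type*} [NormedAddCommGroup E] [InnerProductSpace ℝ E] {q : ℝ}
    (hq : 1 < q) {g m M κ t w ρ : ℝ} (a b : E) (hm : m ≤ g) (hm0 : 0 < m) (hM : g ≤ M)
    (ht : 0 ≤ t) (hκ : 0 ≤ κ) (hρ : 0 ≤ ρ) (hb : ‖b‖ ≤ κ * ρ) :
    m * (t * ‖a‖ ^ q) - M * κ * (‖a‖ ^ q + ρ ^ q * ‖w‖ ^ q)
      ≤ g * ‖a‖ ^ (q - 2) * ⟪a, t • a + w • b⟫ := by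
  have hg0 : 0 < g := hm0.trans_le hm
  rw [inner_add_right, inner_smul_right, inner_smul_right]
  have h1 : g * ‖a‖ ^ (q - 2) * (t * ⟪a, a⟫ + w * ⟪a, b⟫)
      = g * (t * ‖a‖ ^ q) + g * (w * (‖a‖ ^ (q - 2) * ⟪a, b⟫)) := by
    rw [← norm_rpow_mul_inner_self hq a]
    ring
  rw [h1]
  have h2 : m * (t * ‖a‖ ^ q) ≤ g * (t * ‖a‖ ^ q) := by gcongr
  have h3 : |w * (‖a‖ ^ (q - 2) * ⟪a, b⟫)| ≤ κ * (‖a‖ ^ q + ρ ^ q * ‖w‖ ^ q) := by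
    rw [abs_mul]
    calc |w| * |‖a‖ ^ (q - 2) * ⟪a, b⟫| ≤ |w| * (‖a‖ ^ (q - 1) * ‖b‖) := by
          gcongr
          exact abs_norm_rpow_mul_inner_le hq a b
      _ ≤ |w| * (‖a‖ ^ (q - 1) * (κ * ρ)) := by gcongr
      _ = κ * (‖a‖ ^ (q - 1) * (ρ * ‖w‖)) := by rw [Real.norm_eq_abs]; ring
      _ ≤ κ * (‖a‖ ^ q + ρ ^ q * ‖w‖ ^ q) := by
          have := rpow_mul_le_young hq one_pos (norm_nonneg a)
            (by positivity : 0 ≤ ρ * ‖w‖)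
          rw [one_mul, Real.one_rpow, one_mul, Real.mul_rpow hρ (norm_nonneg w)] at this
          gcongr
  have h4 : g * |w * (‖a‖ ^ (q - 2) * ⟪a, b⟫)| ≤ M * (κ * (‖a‖ ^ q + ρ ^ q * ‖w‖ ^ q)) :=
    mul_le_mul hM h3 (abs_nonneg _) (hg0.le.trans hM)
  have h5 : -(g * |w * (‖a‖ ^ (q - 2) * ⟪a, b⟫)|) ≤ g * (w * (‖a‖ ^ (q - 2) * ⟪a, b⟫)) := by
    rw [← mul_neg]
    exact mul_le_mul_of_nonneg_left (neg_abs_le _) hg0.le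
  linarith

set_option maxHeartbeats 1000000 in
/-- The energy of a solution away from the support of its boundary values. -/
lemma IsElliptic.integral_cutoff_le (h : IsElliptic Ω γ m M) (hp : 1 < p) (hp' : p ≠ ⊤)
    {u w : W1 Ω p} (hu : IsWeakSolution γ u) (hw : w ∈ W10 Ω p) {θ ρ : Euc n → ℝ}
    (hθ : IsMultiplier θ) (hθ0 : ∀ x, 0 ≤ θ x)
    (hθw : ∀ᵐ x ∂(volume.restrict Ω), θ x • grad w x = θ x • grad u x) {κ : ℝ} (hκ : 0 ≤ κ)
    (hρ : ∀ x, 0 ≤ ρ x) (hθd : ∀ x ∈ Ω, ‖gradient θ x‖ ≤ κ * ρ x)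
    (hint : Integrable (fun x => ρ x ^ p.toReal * ‖w.1.1 x‖ ^ p.toReal) (volume.restrict Ω)) :
    m * ∫ x in Ω, θ x * ‖grad u x‖ ^ p.toReal ≤ M * κ * (‖grad u‖ ^ p.toReal
      + ∫ x in Ω, ρ x ^ p.toReal * ‖w.1.1 x‖ ^ p.toReal) := by
  have hq := one_lt_toReal hp hp'
  obtain ⟨T, hT⟩ := hθ.exists_isMulOperator (Ω := Ω) (p := p)
  -- The product `θ w` is an admissible test function, and `hθw` replaces `θ ∇w` by `θ ∇u` in its
  -- gradient.
  have h0 := hu _ (hT.mem_W10 w hw)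
  obtain ⟨C, hC⟩ := hθ.bdd
  have i1 := Lp_integrable_norm_rpow hp hp' (grad u)
  have i2 : Integrable (fun x => θ x * ‖grad u x‖ ^ p.toReal) (volume.restrict Ω) :=
    integrable_bdd_mul i1 hθ.contDiff.continuous.aestronglyMeasurable (Eventually.of_forall hC)
  have i3 : Integrable (fun x => ‖grad u x‖ ^ p.toReal
    + ρ x ^ p.toReal * ‖w.1.1 x‖ ^ p.toReal) (volume.restrict Ω) := i1.add hint
  have h1 : ∫ x in Ω, (m * (θ x * ‖grad u x‖ ^ p.toReal) - M * κ * (‖grad u x‖ ^ p.toReal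
      + ρ x ^ p.toReal * ‖w.1.1 x‖ ^ p.toReal)) ≤ pairing γ u (T w) := by
    refine integral_mono_ae ((i2.const_mul m).sub (i3.const_mul (M * κ)))
      (h.integrable_pairing hp hp' u (T w)) ?_
    filter_upwards [h.ae_mem, hT.grad_ae w, hθw] with x hx h2 h3
    rw [h2, h3]
    exact flux_mul_lower_bound hq _ _ (h.lower x hx) h.pos (h.upper x hx) (hθ0 x) hκ (hρ x)
      (hθd x hx)
  rw [h0, integral_sub (i2.const_mul m) (i3.const_mul (M * κ)), integral_const_mul,
    integral_const_mul, integral_add i1 hint, ← Lp_norm_rpow_eq_integral hp hp'] at h1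
  linarith

lemma exists_isElliptic (hΩ : IsOpen Ω) (hΩb : Bornology.IsBounded Ω) (hne : Ω.Nonempty)
    (hγ : ContinuousOn γ (closure Ω)) (hpos : ∀ x ∈ closure Ω, 0 < γ x) :
    ∃ m M, IsElliptic Ω γ m M := by
  have hK : IsCompact (closure Ω) := hΩb.isCompact_closure
  obtain ⟨a, ha, hamin⟩ := hK.exists_isMinOn hne.closure hγ
  obtain ⟨b, -, hbmax⟩ := hK.exists_isMaxOn hne.closure hγ
  exact ⟨γ a, γ b, hΩ.measurableSet,
    (hγ.mono subset_closure).aestronglyMeasurable hΩ.measurableSet, hpos a ha,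
    fun x hx => hamin (subset_closure hx), fun x hx => hbmax (subset_closure hx)⟩

/-- If `γ₁ ≥ γ₂ + ε` where a cutoff is less than one, then a comparison of energies bounds the
total energy by the energy seen by the cutoff. -/
lemma mul_norm_grad_le_of_energy_le {γ₁ γ₂ : Euc n → ℝ} {m₁ M₁ m₂ M₂ : ℝ}
    (h₁ : IsElliptic Ω γ₁ m₁ M₁) (h₂ : IsElliptic Ω γ₂ m₂ M₂) (hp : 1 < p) (hp' : p ≠ ⊤)
    {u : W1 Ω p} (hu : energy γ₁ u ≤ energy γ₂ u) {θ : Euc n → ℝ} (hθ : IsMultiplier θ)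
    (hθ0 : ∀ x, 0 ≤ θ x) {ε : ℝ} (hε : 0 ≤ ε)
    (hγ : ∀ x ∈ Ω, θ x ≠ 1 → γ₂ x + ε ≤ γ₁ x) :
    ε * ‖grad u‖ ^ p.toReal ≤ (M₂ + ε) * ∫ x in Ω, θ x * ‖grad u x‖ ^ p.toReal := by
  have i1 := Lp_integrable_norm_rpow hp hp' (grad u)
  obtain ⟨C, hC⟩ := hθ.bdd
  have i2 : Integrable (fun x => θ x * ‖grad u x‖ ^ p.toReal) (volume.restrict Ω) :=
    integrable_bdd_mul i1 hθ.contDiff.continuous.aestronglyMeasurable (Eventually.of_forall hC)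
  have e1 := h₁.integrable_energy hp hp' u
  have e2 := h₂.integrable_energy hp hp' u
  have h3 : ∫ x in Ω, (γ₂ x * ‖grad u x‖ ^ p.toReal + ε * ‖grad u x‖ ^ p.toReal)
      ≤ ∫ x in Ω, (γ₁ x * ‖grad u x‖ ^ p.toReal
        + (M₂ + ε) * (θ x * ‖grad u x‖ ^ p.toReal)) := by
    refine integral_mono_ae (e2.add (i1.const_mul ε)) (e1.add (i2.const_mul (M₂ + ε))) ?_
    filter_upwards [h₁.ae_mem] with x hx
    have hg1 := h₁.pos.le.trans (h₁.lower x hx)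
    have hg2 := h₂.upper x hx
    have hM2 : 0 ≤ M₂ := h₂.pos.le.trans ((h₂.lower x hx).trans hg2)
    have hA : 0 ≤ ‖grad u x‖ ^ p.toReal := by positivity
    -- Where `θ = 1` the coefficients are not compared, and `γ₂ + ε ≤ M₂ + ε` is charged to the
    -- cutoff term; elsewhere the gap `ε` is available.
    by_cases h1 : θ x = 1
    · rw [h1]
      have : (γ₂ x + ε) * ‖grad u x‖ ^ p.toReal ≤ (γ₁ x + (M₂ + ε)) * ‖grad u x‖ ^ p.toReal :=
        mul_le_mul_of_nonneg_right (by linarith) hA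
      linarith
    · have h4 := mul_le_mul_of_nonneg_right (hγ x hx h1) hA
      have h5 : 0 ≤ (M₂ + ε) * (θ x * ‖grad u x‖ ^ p.toReal) :=
        mul_nonneg (by linarith) (mul_nonneg (hθ0 x) hA)
      linarith
  rw [integral_add e2 (i1.const_mul ε), integral_add e1 (i2.const_mul (M₂ + ε)),
    integral_const_mul, integral_const_mul, ← Lp_norm_rpow_eq_integral hp hp'] at h3
  unfold energy at hu
  linarith

/-- `N`, `Nv`, `Nw` are the gradient norms of `u`, `v`, `u - v` to the power `q`; `H` is the Hardy
integral, `J` the energy seen by the cutoff, and `D = δ ^ n / δ ^ q`. Every bound is linear in `D`,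
which cancels, leaving a contradiction for large `L`. -/
lemma localization_contradiction {ε c m₁ M₁ M₂ A L C Cv q D N Nv Nw H J : ℝ} (hε : 0 < ε)
    (hm : 0 < m₁) (hM₁ : 0 ≤ M₁) (hM₂ : 0 ≤ M₂) (hA : 0 ≤ A) (hC : 0 ≤ C)
    (hL : 0 < L) (hD : 0 < D)
    (hLbig : (M₂ + ε) * (M₁ * A * ((M₁ * Cv / m₁)
      + C * (2 ^ q * ((M₁ * Cv / m₁) + Cv)))) < ε * c * m₁ * L)
    (h1 : ε * N ≤ (M₂ + ε) * J) (h2 : m₁ * J ≤ M₁ * (A / L) * (N + H)) (h3 : H ≤ C * Nw)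
    (h4 : Nw ≤ 2 ^ q * (N + Nv)) (h5 : m₁ * N ≤ M₁ * Nv) (h6 : Nv ≤ Cv * D)
    (h7 : c * D ≤ N) : False := by
  have k1 : N ≤ M₁ * Cv / m₁ * D := by
    rw [div_mul_eq_mul_div, le_div_iff₀ hm]
    have := mul_le_mul_of_nonneg_left h6 hM₁
    linarith
  have k2 : Nw ≤ 2 ^ q * ((M₁ * Cv / m₁) + Cv) * D := by
    refine h4.trans ?_
    rw [mul_assoc]
    refine mul_le_mul_of_nonneg_left ?_ (by positivity)
    linarith
  have k3 : N + H ≤ ((M₁ * Cv / m₁) + C * (2 ^ q * ((M₁ * Cv / m₁) + Cv))) * D := by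
    have := mul_le_mul_of_nonneg_left k2 hC
    linarith
  have k4 : m₁ * J * L ≤ M₁ * A * (((M₁ * Cv / m₁)
      + C * (2 ^ q * ((M₁ * Cv / m₁) + Cv))) * D) := by
    have e1 : M₁ * (A / L) * (N + H) * L = M₁ * A * (N + H) := by field_simp
    have e2 := mul_le_mul_of_nonneg_right h2 hL.le
    rw [e1] at e2
    exact e2.trans (mul_le_mul_of_nonneg_left k3 (by positivity))
  have k5 : ε * (c * D) * (m₁ * L) ≤ (M₂ + ε) * J * (m₁ * L) :=
    mul_le_mul_of_nonneg_right ((mul_le_mul_of_nonneg_left h7 hε.le).trans h1) (by positivity)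
  have k6 := mul_le_mul_of_nonneg_left k4 (by positivity : 0 ≤ M₂ + ε)
  have k7 := mul_lt_mul_of_pos_right hLbig hD
  linarith

/-- Boundary determination, one-sided version. -/
theorem le_of_dnMap_eq (hn : 2 ≤ n) (hp : 1 < p) (hp' : p ≠ ⊤) (hΩ : IsOpen Ω)
    (hΩb : Bornology.IsBounded Ω) (hΩc : HasC1Boundary Ω) {γ₁ γ₂ : Euc n → ℝ}
    (hγ₁ : ContinuousOn γ₁ (closure Ω)) (hγ₁pos : ∀ x ∈ closure Ω, 0 < γ₁ x)
    (hγ₂ : ContinuousOn γ₂ (closure Ω)) (hγ₂pos : ∀ x ∈ closure Ω, 0 < γ₂ x)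
    (hΛ : dnMap Ω p γ₁ = dnMap Ω p γ₂) {x₀ : Euc n} (hx₀ : x₀ ∈ frontier Ω) :
    γ₁ x₀ ≤ γ₂ x₀ := by
  by_contra! hlt
  have hq := one_lt_toReal hp hp'
  have hx₀c : x₀ ∈ closure Ω := frontier_subset_closure hx₀
  have hx₀Ω : x₀ ∉ Ω := by
    rw [hΩ.frontier_eq] at hx₀
    exact hx₀.2
  have hne : Ω.Nonempty := closure_nonempty_iff.1 ⟨x₀, hx₀c⟩
  obtain ⟨m₁, M₁, h₁⟩ := exists_isElliptic hΩ hΩb hne hγ₁ hγ₁pos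
  obtain ⟨m₂, M₂, h₂⟩ := exists_isElliptic hΩ hΩb hne hγ₂ hγ₂pos
  obtain ⟨z, hz⟩ := hne
  have hM₁ : 0 ≤ M₁ := h₁.pos.le.trans ((h₁.lower z hz).trans (h₁.upper z hz))
  have hM₂ : 0 ≤ M₂ := h₂.pos.le.trans ((h₂.lower z hz).trans (h₂.upper z hz))
  obtain ⟨e, he, hcone, hin⟩ := hΩc.exists_normal hΩ hx₀
  obtain ⟨τ, hτ, heτ⟩ := exists_unit_orthogonal hn e
  set ε : ℝ := (γ₁ x₀ - γ₂ x₀) / 2 with hε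
  have hεpos : 0 < ε := by rw [hε]; linarith
  obtain ⟨r, hr, hγr⟩ : ∃ r > 0, ∀ x ∈ Ω, ‖x - x₀‖ < r → γ₂ x + ε ≤ γ₁ x := by
    have hcw : ContinuousWithinAt (fun x => γ₁ x - γ₂ x) (closure Ω) x₀ :=
      (hγ₁ x₀ hx₀c).sub (hγ₂ x₀ hx₀c)
    have hev := hcw.eventually (lt_mem_nhds (show ε < γ₁ x₀ - γ₂ x₀ by rw [hε]; linarith))
    obtain ⟨r, hr, hrs⟩ := Metric.mem_nhdsWithin_iff.1 hev
    refine ⟨r, hr, fun x hx hxr => ?_⟩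
    have : ε < γ₁ x - γ₂ x := hrs ⟨mem_ball_iff_norm.2 hxr, subset_closure hx⟩
    linarith
  obtain ⟨R₀, hR₀, hcone'⟩ := hcone (1 / 4) (by norm_num)
  -- Hardy's inequality on the ball of radius `R` uses the cone condition up to `2 R`.
  set R : ℝ := R₀ / 2 with hR
  have hRpos : 0 < R := by positivity
  obtain ⟨C, hC, hHardy⟩ := exists_boundary_hardy (p := p) hn hΩb hp hp' hx₀Ω he hRpos
    fun x hx hxR => hcone' x hx (by rw [hR] at hxR; linarith)
  -- The cutoff equals one from `r₁` on, so that `θ ≠ 1` only where the coefficient gap holds and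
  -- `∇θ` lives inside the Hardy ball.
  set r₁ : ℝ := min r (R / 2) with hr₁
  have hr₁pos : 0 < r₁ := by positivity
  have hr₁R : r₁ < R := (min_le_right _ _).trans_lt (by linarith)
  obtain ⟨V, hV, hVc, hVτ, hV0⟩ := exists_linear_profile τ
  obtain ⟨c, hc, hlow⟩ := exists_lower_bound (p := p) hΩ hp hp' he hτ heτ hcone hin hV hVτ
  set Cv : ℝ := ∫ y, ‖gradient V y‖ ^ p.toReal with hCv
  obtain ⟨A, hA, hcut⟩ := exists_log_cutoff
  -- None of the constants depends on `δ`, so `L` is fixed first and `δ` is then taken small enough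
  -- for the cutoff to fit inside `r₁`.
  obtain ⟨L, hLpos, hL⟩ : ∃ L > 0, (M₂ + ε) * (M₁ * A * ((M₁ * Cv / m₁)
      + C * (2 ^ p.toReal * ((M₁ * Cv / m₁) + Cv)))) < ε * c * m₁ * L := by
    have hpos : 0 < ε * c * m₁ := by have := h₁.pos; positivity
    obtain ⟨L, hL⟩ := exists_gt (max 0 ((M₂ + ε) * (M₁ * A * ((M₁ * Cv / m₁)
      + C * (2 ^ p.toReal * ((M₁ * Cv / m₁) + Cv)))) / (ε * c * m₁)))
    refine ⟨L, (le_max_left _ _).trans_lt hL, ?_⟩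
    have := (le_max_right _ _).trans_lt hL
    rwa [div_lt_iff₀ hpos, mul_comm L] at this
  have hsmall : ∀ᶠ δ : ℝ in 𝓝[>] 0, 26 * δ ^ 2 * Real.exp L < r₁ ^ 2 := by
    have hcont : Continuous fun δ : ℝ => 26 * δ ^ 2 * Real.exp L := by fun_prop
    exact nhdsWithin_le_nhds (hcont.continuousAt.eventually (gt_mem_nhds (by
      simp only [ne_eq, OfNat.ofNat_ne_zero, not_false_eq_true, zero_pow, mul_zero, zero_mul]
      positivity)))
  obtain ⟨δ, ⟨hδlow, hδs⟩, hδ⟩ := ((hlow.and hsmall).and self_mem_nhdsWithin).exists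
  obtain ⟨θ, hθ, hθ0, hθin, hθout, hθd⟩ := hcut x₀ r₁ δ L hr₁pos hδ hLpos hδs.le
  obtain ⟨v, -, hv⟩ := exists_W1_of_contDiff (Ω := Ω) (p := p) (contDiff_rescale x₀ δ hV)
    (hasCompactSupport_rescale x₀ hδ hVc)
  obtain ⟨u, hu, huv, hle⟩ := exists_isWeakSolution_of_dnMap_eq h₁ h₂ hn hΩb hp hp' hΛ v
  obtain ⟨hHint, hHle⟩ := hHardy _ huv
  let ρ : Euc n → ℝ := (Metric.ball x₀ R).indicator fun x => ‖x - x₀‖⁻¹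
  have hρ0 : ∀ x, 0 ≤ ρ x := Set.indicator_nonneg fun x _ => by positivity
  have hρq : ∀ x, (Metric.ball x₀ R).indicator (fun x => (‖x - x₀‖⁻¹) ^ p.toReal) x
      = ρ x ^ p.toReal := by
    intro x
    by_cases hx : x ∈ Metric.ball x₀ R
    · simp only [ρ, Set.indicator_of_mem hx]
    · simp only [ρ, Set.indicator_of_notMem hx]
      rw [Real.zero_rpow (by linarith)]
  simp_rw [hρq] at hHint hHle
  have hθρ : ∀ x ∈ Ω, ‖gradient θ x‖ ≤ A / L * ρ x := by
    intro x _
    by_cases hx : x ∈ Metric.ball x₀ R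
    · simp only [ρ, Set.indicator_of_mem hx]
      exact hθd x
    · have hx' : r₁ < ‖x - x₀‖ := by
        rw [mem_ball_iff_norm, not_lt] at hx
        exact hr₁R.trans_le hx
      have hone : θ =ᶠ[𝓝 x] fun _ => 1 := by
        have hc : ContinuousAt (fun y : Euc n => ‖y - x₀‖) x := by fun_prop
        filter_upwards [hc.eventually (lt_mem_nhds hx')] with y hy
        exact hθout y hy.le
      rw [hone.gradient_eq, gradient_fun_const, norm_zero]
      exact mul_nonneg (by positivity) (hρ0 x)
  have hθw : ∀ᵐ x ∂(volume.restrict Ω), θ x • grad (u - v) x = θ x • grad u x := by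
    filter_upwards [hv, grad_sub_ae u v] with x hx hsub
    rw [hsub, hx, smul_sub, sub_eq_self]
    -- Either `θ` vanishes, or `x` is outside the ball of radius `4 δ` that contains the support of
    -- the gradient of the data.
    by_cases hx5 : ‖x - x₀‖ ≤ 5 * δ
    · rw [hθin x hx5, zero_smul]
    · rw [gradient_rescale x₀ δ hV, hV0, smul_zero, smul_zero]
      rw [norm_smul, Real.norm_of_nonneg (by positivity), lt_inv_mul_iff₀ hδ]
      linarith
  have hcutoff := h₁.integral_cutoff_le hp hp' hu huv hθ hθ0 hθw (by positivity) hρ0 hθρ hHint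
  have htotal := mul_norm_grad_le_of_energy_le h₁ h₂ hp hp' hle hθ hθ0 hεpos.le
    fun x hx hx1 => hγr x hx (by
      by_contra! hxr
      exact hx1 (hθout x ((min_le_left _ _).trans hxr)))
  have hgradw : ‖grad (u - v)‖ ^ p.toReal
      ≤ 2 ^ p.toReal * (‖grad u‖ ^ p.toReal + ‖grad v‖ ^ p.toReal) := by
    rw [grad_sub]
    exact (Real.rpow_le_rpow (norm_nonneg _) (norm_sub_le _ _) (by linarith)).trans
      (add_rpow_le_two_rpow hq (norm_nonneg _) (norm_nonneg _))
  have hmin : m₁ * ‖grad u‖ ^ p.toReal ≤ M₁ * ‖grad v‖ ^ p.toReal :=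
    ((h₁.energy_mono hp hp' u).1.trans (h₁.energy_le_of_isWeakSolution hp hp' hu
      (by rw [← neg_sub]; exact Submodule.neg_mem _ huv))).trans (h₁.energy_mono hp hp' v).2
  exact localization_contradiction hεpos h₁.pos hM₁ hM₂ hA hC hLpos (by positivity) hL htotal
    hcutoff hHle hgradw hmin (norm_grad_rescale_le hp hp' hV hVc x₀ hδ hv) (hδlow u v hv huv)

end Localization

end PLap

theorem theorem1p1 {n : ℕ} (hn : 2 ≤ n) (p : ℝ≥0∞) [Fact (1 ≤ p)] (hp : 1 < p) (hp' : p ≠ ⊤)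
    (Ω : Set (PLap.Euc n)) (hΩ : IsOpen Ω) (hΩb : Bornology.IsBounded Ω)
    (hΩc : PLap.HasC1Boundary Ω) (γ₁ γ₂ : PLap.Euc n → ℝ)
    (hγ₁ : ContinuousOn γ₁ (closure Ω)) (hγ₁pos : ∀ x ∈ closure Ω, 0 < γ₁ x)
    (hγ₂ : ContinuousOn γ₂ (closure Ω)) (hγ₂pos : ∀ x ∈ closure Ω, 0 < γ₂ x)
    (hΛ : PLap.dnMap Ω p γ₁ = PLap.dnMap Ω p γ₂) :
    ∀ x ∈ frontier Ω, γ₁ x = γ₂ x := fun _ hx =>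
  le_antisymm
    (PLap.le_of_dnMap_eq hn hp hp' hΩ hΩb hΩc hγ₁ hγ₁pos hγ₂ hγ₂pos hΛ hx)
    (PLap.le_of_dnMap_eq hn hp hp' hΩ hΩb hΩc hγ₂ hγ₂pos hγ₁ hγ₁pos hΛ.symm hx)
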